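/- **System.** A base station with $M$ antennas, $S$ RF chains and power budget $P_{\max}>0$ serves $K$ single-antenna users. The channels $(h_1,\dots,h_K)$, $h_k\in\mathbb C^M$, have a known joint law with finite second moments; $C_k=\mathbb E[h_kh_k^H]$. A control variable is $x=(\theta,p)$ with phases $\theta\in\mathbb R^{MS}$ and powers $p\in\mathbb R^K$; the feasible set is $$\mathcal G_1=\{(\theta,p):\ \theta\in[0,2\pi]^{MS},\ p\ge 0,\ \mathbf 1^Tp\le P_{\max}\}.$$ The analog precoder is $F\in\mathbb C^{M\times S}$ with $F_{ms}=e^{\sqrt{-1}\theta_{ms}}/\sqrt M$. With the pilot matrix $\Psi\in\mathbb C^{T_p\times S}$ and noises $n_k\sim\mathcal{CN}(0,I)$, independent of each other and of the channels, user $k$ observes $y_k=\Psi(h_k^HF)^T+n_k$, and the LMMSE estimate of $F^Hh_k$ is $$\hat h_k=F^HC_kF\Psi^T(\Psi^*F^HC_kF\Psi^T+I)^{-1}y_k^*.$$ Let $\hat H=[\hat h_1,\dots,\hat h_K]^H$, $P=\mathrm{Diag}(p)$ and $G=[g_1,\dots,g_K]=(\hat H^HP\hat H+I)^{-1}\hat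 H^HP\Lambda^{1/2}$, where the diagonal matrix $\Lambda^{1/2}$ normalizes the columns, $\|Fg_k\|_2=1$ ($g_k=0$ if $p_k=0$). The instantaneous rate of user $k$ is $$r_k(x;H,N)=\log\Bigl(1+\frac{p_k|h_k^HFg_k|^2}{\sum_{i\ne k}p_i|h_k^HFg_i|^2+1}\Bigr),\qquad H=(h_k)_k,\ N=(n_k)_k.$$ **Problem $\mathcal P$.** For $\Gamma=(\Gamma(1),\dots,\Gamma(L))$ and $q\in\mathbb R^L$ let $\bar r(\Gamma,q)\in\mathbb R^K$ have the components $\bar r_k=\sum_{l}q_l\,\mathbb E[r_k(\Gamma(l);H,N)]$. Problem $\mathcal P$ is to maximize $f(\Gamma,q)=U(\bar r(\Gamma,q))$ over $\Gamma\in\mathcal G=\mathcal G_1^L$ and $q\in\mathcal Q=\{q\in[0,1]^L:\mathbf 1^Tq=1\}$, where $U$ is continuously differentiable, concave and nondecreasing on $\{\bar r\ge 0\}$ with Lipschitz continuous gradient. **Regularity of the rates.** For every $x\in\mathcal G_1$ and every $k$, $\hat h_k\neq0$ almost surely (so that $G$ can be normalized); $r_k$ is Lipschitz continuous in $x$ in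 mean square, i.e. $\mathbb E|r_k(x;H,N)-r_k(y;H,N)|^2\le C^2\|x-y\|_2^2$ for all $x,y\in\mathcal G_1$; and $x\mapsto\mathbb E[r_k(x;H,N)]$ is differentiable on $\mathcal G_1$ with Lipschitz continuous gradient. **Algorithm (SSCA-RCSHP).** Fix $\tau_q,\tau_\Gamma>0$, $T_{HN}\ge1$, step sizes $\rho_t,\gamma_t\in(0,1]$ and an initial point $\Gamma^0\in\mathcal G$, $q^0\in\mathcal Q$; put $\hat r^{-1}=0$, $\mathbf f^{-1}=0$. In iteration $t=0,1,\dots$ draw $T_{HN}$ new independent samples $(H^t(i),N^t(i))$ from the law of $(H,N)$ and put, for all $k,l$, $$\hat r^t_k(l)=(1-\rho_t)\hat r^{t-1}_k(l)+\frac{\rho_t}{T_{HN}}\sum_i r_k(\Gamma^t(l);H^t(i),N^t(i)),\qquad \hat{\bar r}^t(q)=\Bigl(\sum_lq_l\hat r^t_k(l)\Bigr)_k,$$ $$\mathbf f^t=(1-\rho_t)\mathbf f^{t-1}+\frac{\rho_t}{T_{HN}}\sum_i \mathbf J_\Gamma(\Gamma^t,q^t;H^t(i),N^t(i))\,\nabla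 U(\hat{\bar r}^t(q^t)),$$ where $\mathbf J_\Gamma$ is the Jacobian matrix (gradients as columns) with respect to $\Gamma$ of the vector with components $\sum_lq_lr_k(\Gamma(l);H,N)$, and $\mathbf f^t_l$ denotes the $\Gamma(l)$-block of $\mathbf f^t$. Then let $$\bar q^t=\arg\max_{q\in\mathcal Q}\,U(\hat{\bar r}^t(q))-\tau_q\|q-q^t\|_2^2,\qquad \bar\Gamma^t(l)=\arg\max_{x\in\mathcal G_1}\,(\mathbf f^t_l)^T(x-\Gamma^t(l))-\tau_\Gamma\|x-\Gamma^t(l)\|_2^2,$$ $$q^{t+1}=(1-\gamma_t)q^t+\gamma_t\bar q^t,\qquad \Gamma^{t+1}=(1-\gamma_t)\Gamma^t+\gamma_t\bar\Gamma^t.$$ **Theorem 1 (Convergence of the SSCA-RCSHP algorithm).** Assume that 1. $\rho_t\to0$, $1/\rho_t=O(t^\beta)$ for some $\beta\in(0,1)$, $\sum_t\rho_t^2<\infty$ and $\sum_t\rho_tt^{-1/2}<\infty$; 2. $\gamma_t\to0$, $\sum_t\gamma_t=\infty$ and $\sum_t\gamma_t^2<\infty$; 3. $\gamma_t/\rho_t\to0$.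 Then, almost surely, every limit $(\Gamma^*,q^*)$ of a convergent subsequence of $(\Gamma^t,q^t)_t$ is a KKT point of $\mathcal P$: it is feasible, $f$ is differentiable there (one-sidedly at the boundary of $\{\Gamma\in\mathcal G,\ q\ge0\}$), and there are Lagrange multipliers for the constraints $\theta(l)\ge0$, $\theta(l)\le2\pi$, $p(l)\ge0$, $\mathbf 1^Tp(l)\le P_{\max}$, $q\ge0$, $q\le1$, $\mathbf 1^Tq=1$ (nonnegative for the inequalities) that satisfy complementary slackness and stationarity of the Lagrangian. -/

import Mathlib

open MeasureTheory ProbabilityTheory Filter Topology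
open scoped Matrix NNReal ENNReal

namespace RCSHP

noncomputable section

/-! ### The downlink system with hybrid precoding -/

/-- Data of the downlink with `K` users, `M` antennas, `S` RF chains and `Tp` pilot symbols. -/
structure System (K M S Tp : ℕ) where
  /-- joint law of the user channels `h_1, …, h_K` in `ℂ^M` (the statistical CSI) -/
  channelLaw : Measure (Fin K → Fin M → ℂ)
  /-- pilot matrix `Ψ` -/
  pilot : Matrix (Fin Tp) (Fin S) ℂ
  /-- power budget of the base station -/
  Pmax : ℝ

/-- Random state: the channels `h_k` and the channel estimation noises `n_k`. -/
abbrev State (K M Tp : ℕ) : Type := (Fin K → Fin M → ℂ) × (Fin K → Fin Tp → ℂ)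

/-- A control variable `[θ; p]`: the `M S` phases and the `K` powers, with the Euclidean norm. -/
abbrev Ctrl (K M S : ℕ) : Type := EuclideanSpace ℝ ((Fin M × Fin S) ⊕ Fin K)

/-- The phases of a control variable. -/
def phase {K M S : ℕ} (x : Ctrl K M S) (m : Fin M) (s : Fin S) : ℝ := x (Sum.inl (m, s))

/-- The powers of a control variable. -/
def pow {K M S : ℕ} (x : Ctrl K M S) (k : Fin K) : ℝ := x (Sum.inr k)

/-- The circularly symmetric complex Gaussian law `CN(0, 1)`: independent real and imaginary parts
of variance `1/2`. -/
def complexGaussian : Measure ℂ :=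
  ((gaussianReal 0 (1 / 2)).prod (gaussianReal 0 (1 / 2))).map Complex.measurableEquivRealProd.symm

/-- The estimation noise: the `n_k` are independent with law `CN(0, I)`. -/
def noiseLaw (K Tp : ℕ) : Measure (Fin K → Fin Tp → ℂ) :=
  Measure.pi fun _ => Measure.pi fun _ => complexGaussian

namespace System

variable {K M S Tp : ℕ} (sys : System K M S Tp)

/-- Law of the pair (channels, noises); the noise is independent of the channels. -/
def stateLaw : Measure (State K M Tp) := sys.channelLaw.prod (noiseLaw K Tp)

/-- Channel covariance `C_k = 𝔼[h_k h_kᴴ]`. -/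
def cov (k : Fin K) : Matrix (Fin M) (Fin M) ℂ :=
  Matrix.of fun i j => ∫ h, h k i * star (h k j) ∂sys.channelLaw

end System

/-- Analog precoder `F`, with entries `e^{√-1 θ_{ms}} / √M`. -/
def analog {K M S : ℕ} (x : Ctrl K M S) : Matrix (Fin M) (Fin S) ℂ :=
  Matrix.of fun m s => ((1 / Real.sqrt M : ℝ) : ℂ) * Complex.exp (Complex.I * (phase x m s : ℂ))

namespace System

variable {K M S Tp : ℕ} (sys : System K M S Tp)

/-- Pilot observation `y_k = Ψ (h_kᴴ F)ᵀ + n_k = Ψ conj(Fᴴ h_k) + n_k`. -/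
def observation (x : Ctrl K M S) (ω : State K M Tp) (k : Fin K) : Fin Tp → ℂ :=
  sys.pilot *ᵥ star ((analog x)ᴴ *ᵥ ω.1 k) + ω.2 k

/-- LMMSE estimate of the effective channel `Fᴴ h_k`,
`Fᴴ C_k F Ψᵀ (conj(Ψ) Fᴴ C_k F Ψᵀ + I)⁻¹ conj(y_k)`. -/
def estimate (x : Ctrl K M S) (ω : State K M Tp) (k : Fin K) : Fin S → ℂ :=
  ((analog x)ᴴ * sys.cov k * analog x * sys.pilotᵀ *
    (sys.pilot.map star * ((analog x)ᴴ * sys.cov k * analog x) * sys.pilotᵀ + 1)⁻¹) *ᵥ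
      star (sys.observation x ω k)

/-- Estimated effective channel matrix: its `k`-th row is the conjugate transpose of the `k`-th
estimate. -/
def estMatrix (x : Ctrl K M S) (ω : State K M Tp) : Matrix (Fin K) (Fin S) ℂ :=
  Matrix.of fun k s => star (sys.estimate x ω k s)

/-- `P = Diag(p)`. -/
def powMatrix (x : Ctrl K M S) : Matrix (Fin K) (Fin K) ℂ :=
  Matrix.diagonal fun k => (pow x k : ℂ)

/-- Unnormalised duality-based digital precoder `(Ĥᴴ P Ĥ + I)⁻¹ Ĥᴴ P`. -/
def rawDigital (x : Ctrl K M S) (ω : State K M Tp) : Matrix (Fin S) (Fin K) ℂ :=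
  ((sys.estMatrix x ω)ᴴ * powMatrix x * sys.estMatrix x ω + 1)⁻¹ *
    (sys.estMatrix x ω)ᴴ * powMatrix x

/-- Duality-based digital precoder `G = (Ĥᴴ P Ĥ + I)⁻¹ Ĥᴴ P Λ^{1/2}`, with columns scaled so that
`‖F g_k‖₂ = 1`. (If `p_k = 0` the column `g_k` is zero; it then enters all rates only with the
factor `p_k = 0`.) -/
def digital (x : Ctrl K M S) (ω : State K M Tp) : Matrix (Fin S) (Fin K) ℂ :=
  sys.rawDigital x ω * Matrix.diagonal fun k =>
    ((‖WithLp.toLp 2 (fun m => (analog x * sys.rawDigital x ω) m k)‖⁻¹ : ℝ) : ℂ)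

/-- Gain `|h_kᴴ F g_i|²`. -/
def gain (x : Ctrl K M S) (ω : State K M Tp) (k i : Fin K) : ℝ :=
  ‖star (ω.1 k) ⬝ᵥ (fun m => (analog x * sys.digital x ω) m i)‖ ^ 2

/-- Instantaneous achievable rate `r_k([θ; p]; H, N)`. -/
def rate (k : Fin K) (x : Ctrl K M S) (ω : State K M Tp) : ℝ :=
  Real.log (1 + pow x k * sys.gain x ω k k /
    (∑ i ∈ Finset.univ.erase k, pow x i * sys.gain x ω k i + 1))

/-- Conditional average rate `𝔼_{H,N}[r_k([θ; p]; H, N)]`. -/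
def meanRate (k : Fin K) (x : Ctrl K M S) : ℝ := ∫ ω, sys.rate k x ω ∂sys.stateLaw

/-- Average data rate vector `r̄` of the randomized control policy `(Γ, q)`. -/
def avgRate {L : ℕ} (Γ : Fin L → Ctrl K M S) (q : EuclideanSpace ℝ (Fin L)) :
    EuclideanSpace ℝ (Fin K) :=
  WithLp.toLp 2 fun k => ∑ l, q l * sys.meanRate k (Γ l)

/-- Objective `f(Γ, q) = U(r̄)` of the utility maximization problem. -/
def objective {L : ℕ} (U : EuclideanSpace ℝ (Fin K) → ℝ)
    (x : (Fin L → Ctrl K M S) × EuclideanSpace ℝ (Fin L)) : ℝ :=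
  U (sys.avgRate x.1 x.2)

/-- Feasible control variables: `θ ∈ [0, 2π]^{MS}`, `p ≥ 0`, `1ᵀp ≤ P_max`. -/
def ctrlSet : Set (Ctrl K M S) :=
  {x | (∀ m s, phase x m s ∈ Set.Icc 0 (2 * Real.pi)) ∧ (∀ k, 0 ≤ pow x k) ∧
    ∑ k, pow x k ≤ sys.Pmax}

end System

/-- Feasible time-sharing vectors: `q ∈ [0, 1]^L`, `1ᵀq = 1`. -/
def shareSet (L : ℕ) : Set (EuclideanSpace ℝ (Fin L)) :=
  {q | (∀ l, q l ∈ Set.Icc 0 1) ∧ ∑ l, q l = 1}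

/-! ### Standing assumptions on the model -/

/-- The nonnegative rate vectors. -/
def orthant (K : ℕ) : Set (EuclideanSpace ℝ (Fin K)) := {r | ∀ k, 0 ≤ r k}

/-- A utility function on the nonnegative rate vectors: continuously differentiable, concave,
nondecreasing, with Lipschitz continuous gradient. -/
structure IsUtility {K : ℕ} (U : EuclideanSpace ℝ (Fin K) → ℝ) : Prop where
  differentiableOn : DifferentiableOn ℝ U (orthant K)
  concaveOn : ConcaveOn ℝ (orthant K) U
  monotone : ∀ r ∈ orthant K, ∀ r' ∈ orthant K, (∀ k, r k ≤ r' k) → U r ≤ U r'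
  lipschitz_gradient : ∃ C : ℝ≥0, LipschitzOnWith C (gradientWithin U (orthant K)) (orthant K)

/-- The channel law is a probability law for which the covariances `C_k` exist. -/
structure System.HasCovariances {K M S Tp : ℕ} (sys : System K M S Tp) : Prop where
  isProbabilityMeasure : IsProbabilityMeasure sys.channelLaw
  memLp_two : ∀ k m, MemLp (fun h => h k m) 2 sys.channelLaw

/-- Regularity of the rates on the feasible set. -/
structure System.RegularRates {K M S Tp : ℕ} (sys : System K M S Tp) : Prop where
  /-- for every feasible control the precoder can be normalised, almost surely -/
  estimate_ne_zero : ∀ x ∈ sys.ctrlSet, ∀ k, ∀ᵐ ω ∂sys.stateLaw, sys.estimate x ω k ≠ 0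
  /-- the instantaneous rates are Lipschitz continuous in mean square -/
  rate_lipschitz : ∃ C : ℝ≥0, ∀ k, ∀ x ∈ sys.ctrlSet, ∀ y ∈ sys.ctrlSet,
    eLpNorm (fun ω => sys.rate k x ω - sys.rate k y ω) 2 sys.stateLaw ≤ C * edist x y
  /-- the conditional average rates are differentiable with Lipschitz continuous gradient -/
  meanRate_differentiable : ∀ k, DifferentiableOn ℝ (sys.meanRate k) sys.ctrlSet
  gradient_lipschitz : ∃ C : ℝ≥0, ∀ k,
    LipschitzOnWith C (gradientWithin (sys.meanRate k) sys.ctrlSet) sys.ctrlSet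

/-- The step size conditions. -/
structure StepSizes (ρ γ : ℕ → ℝ) : Prop where
  rho_mem : ∀ t, ρ t ∈ Set.Ioc 0 1
  gamma_mem : ∀ t, γ t ∈ Set.Ioc 0 1
  rho_tendsto : Tendsto ρ atTop (𝓝 0)
  rho_inv_isBigO : ∃ β ∈ Set.Ioo (0 : ℝ) 1,
    (fun t => 1 / ρ t) =O[atTop] fun t : ℕ => (t : ℝ) ^ β
  rho_sq_summable : Summable fun t => ρ t ^ 2
  rho_rpow_summable : Summable fun t : ℕ => ρ t * (t : ℝ) ^ (-(1 / 2) : ℝ)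
  gamma_tendsto : Tendsto γ atTop (𝓝 0)
  gamma_sum : Tendsto (fun n => ∑ t ∈ Finset.range n, γ t) atTop atTop
  gamma_sq_summable : Summable fun t => γ t ^ 2
  ratio_tendsto : Tendsto (fun t => γ t / ρ t) atTop (𝓝 0)

/-! ### The algorithm -/

/-- The sequences produced by the algorithm along one sample path. -/
structure Run (K M S L : ℕ) where
  /-- control variables `Γ^t` -/
  Γ : ℕ → Fin L → Ctrl K M S
  /-- time-sharing vectors `q^t` -/
  q : ℕ → EuclideanSpace ℝ (Fin L)
  /-- recursive estimates `r̂^t_k(l)` of the conditional average rates -/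
  rhat : ℕ → Fin K → Fin L → ℝ
  /-- recursive estimates `f^t_{Γ(l)}` of the partial gradients of the objective -/
  grad : ℕ → Fin L → Ctrl K M S
  /-- surrogate solutions `Γ̄^t` -/
  Γbar : ℕ → Fin L → Ctrl K M S
  /-- surrogate solutions `q̄^t` -/
  qbar : ℕ → EuclideanSpace ℝ (Fin L)

/-- The sequence `a^{t-1}`, with `a^{-1} = 0`. -/
def prev {α : Type*} [Zero α] (a : ℕ → α) : ℕ → α
  | 0 => 0
  | t + 1 => a t

/-- The rate approximation `r̂(q)`, with components `∑_l q_l r̂_k(l)`. -/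
def approxRate {K L : ℕ} (r : Fin K → Fin L → ℝ) (q : EuclideanSpace ℝ (Fin L)) :
    EuclideanSpace ℝ (Fin K) :=
  WithLp.toLp 2 fun k => ∑ l, q l * r k l

/-- The `Γ(l)`-block of `J_Γ(Γ, q; H, N) v`, where `J_Γ` is the Jacobian matrix with respect to `Γ`
of the rate vector with components `∑_l q_l r_k(Γ(l); H, N)`. -/
def jacobianMul {K M S Tp L : ℕ} (sys : System K M S Tp) (Γ : Fin L → Ctrl K M S)
    (q : EuclideanSpace ℝ (Fin L)) (ω : State K M Tp) (v : EuclideanSpace ℝ (Fin K)) (l : Fin L) :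
    Ctrl K M S :=
  ∑ k, (q l * v k) • gradient (fun x => sys.rate k x ω) (Γ l)

/-- `X` is the run of the algorithm on the samples `ω t i` (`i`-th sample of iteration `t`), from
the initial point `(Γ₀, q₀)`, with step sizes `ρ`, `γ` and proximal weights `τq`, `τΓ`. -/
structure IsRun {K M S Tp L TH : ℕ} (sys : System K M S Tp) (U : EuclideanSpace ℝ (Fin K) → ℝ)
    (ρ γ : ℕ → ℝ) (τq τΓ : ℝ) (Γ₀ : Fin L → Ctrl K M S) (q₀ : EuclideanSpace ℝ (Fin L))
    (ω : ℕ → Fin TH → State K M Tp) (X : Run K M S L) : Prop where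
  init_Γ : X.Γ 0 = Γ₀
  init_q : X.q 0 = q₀
  rhat_eq : ∀ t k l, X.rhat t k l = (1 - ρ t) * prev X.rhat t k l +
    ρ t * ∑ i, sys.rate k (X.Γ t l) (ω t i) / TH
  grad_eq : ∀ t l, X.grad t l = (1 - ρ t) • prev X.grad t l +
    ρ t • ∑ i, (TH : ℝ)⁻¹ • jacobianMul sys (X.Γ t) (X.q t) (ω t i)
      (gradientWithin U (orthant K) (approxRate (X.rhat t) (X.q t))) l
  qbar_mem : ∀ t, X.qbar t ∈ shareSet L
  qbar_max : ∀ t, IsMaxOn (fun q => U (approxRate (X.rhat t) q) - τq * ‖q - X.q t‖ ^ 2)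
    (shareSet L) (X.qbar t)
  q_succ : ∀ t, X.q (t + 1) = (1 - γ t) • X.q t + γ t • X.qbar t
  Γbar_mem : ∀ t l, X.Γbar t l ∈ sys.ctrlSet
  Γbar_max : ∀ t l, IsMaxOn
    (fun x => inner ℝ (X.grad t l) (x - X.Γ t l) - τΓ * ‖x - X.Γ t l‖ ^ 2)
    sys.ctrlSet (X.Γbar t l)
  Γ_succ : ∀ t l, X.Γ (t + 1) l = (1 - γ t) • X.Γ t l + γ t • X.Γbar t l

/-! ### KKT points -/

/-- Set on which the objective is differentiated: feasible `Γ` and `q ≥ 0`. The objective is defined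
there, and (for `P_max > 0`) the set is convex with nonempty interior, so that derivatives within it
are unique; at a boundary point they are one-sided. -/
def domain {K M S Tp : ℕ} (sys : System K M S Tp) (L : ℕ) :
    Set ((Fin L → Ctrl K M S) × EuclideanSpace ℝ (Fin L)) :=
  {x | (∀ l, x.1 l ∈ sys.ctrlSet) ∧ ∀ l, 0 ≤ x.2 l}

/-- Lagrange multipliers of the constraints
`-θ ≤ 0`, `θ - 2π ≤ 0`, `-p ≤ 0`, `1ᵀp - P_max ≤ 0`, `-q ≤ 0`, `q - 1 ≤ 0` and `1ᵀq = 1`. -/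
structure Multipliers (K M S L : ℕ) where
  thetaLow : Fin L → Fin M → Fin S → ℝ
  thetaUp : Fin L → Fin M → Fin S → ℝ
  powLow : Fin L → Fin K → ℝ
  powSum : Fin L → ℝ
  shareLow : Fin L → ℝ
  shareUp : Fin L → ℝ
  shareSum : ℝ

/-- `(Γ, q)` is a KKT point of the problem of maximizing `U(r̄(Γ, q))` over feasible `Γ`, `q`: it is
feasible, the objective is differentiable there, and there are multipliers that satisfy dual
feasibility, complementary slackness and stationarity of the Lagrangian. -/
def IsKKT {K M S Tp L : ℕ} (sys : System K M S Tp) (U : EuclideanSpace ℝ (Fin K) → ℝ)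
    (x : (Fin L → Ctrl K M S) × EuclideanSpace ℝ (Fin L)) : Prop :=
  (∀ l, x.1 l ∈ sys.ctrlSet) ∧ x.2 ∈ shareSet L ∧
  ∃ f' : ((Fin L → Ctrl K M S) × EuclideanSpace ℝ (Fin L)) →L[ℝ] ℝ,
    HasFDerivWithinAt (sys.objective U) f' (domain sys L) x ∧
    ∃ μ : Multipliers K M S L,
      -- dual feasibility
      (∀ l m s, 0 ≤ μ.thetaLow l m s) ∧ (∀ l m s, 0 ≤ μ.thetaUp l m s) ∧
      (∀ l k, 0 ≤ μ.powLow l k) ∧ (∀ l, 0 ≤ μ.powSum l) ∧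
      (∀ l, 0 ≤ μ.shareLow l) ∧ (∀ l, 0 ≤ μ.shareUp l) ∧
      -- complementary slackness
      (∀ l m s, μ.thetaLow l m s * phase (x.1 l) m s = 0) ∧
      (∀ l m s, μ.thetaUp l m s * (phase (x.1 l) m s - 2 * Real.pi) = 0) ∧
      (∀ l k, μ.powLow l k * pow (x.1 l) k = 0) ∧
      (∀ l, μ.powSum l * (∑ k, pow (x.1 l) k - sys.Pmax) = 0) ∧
      (∀ l, μ.shareLow l * x.2 l = 0) ∧ (∀ l, μ.shareUp l * (x.2 l - 1) = 0) ∧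
      -- stationarity
      ∀ v : (Fin L → Ctrl K M S) × EuclideanSpace ℝ (Fin L),
        f' v =
          ∑ l, (∑ m, ∑ s, (μ.thetaUp l m s - μ.thetaLow l m s) * phase (v.1 l) m s +
            ∑ k, (μ.powSum l - μ.powLow l k) * pow (v.1 l) k) +
          ∑ l, (μ.shareUp l - μ.shareLow l + μ.shareSum) * v.2 l

end

end RCSHP

/-! The proof is a Lyapunov argument in expectation, followed by a pathwise argument at the limit
points.

Let `V_t` be the expected objective at iteration `t` and `D_t` the expected squared length of the
search direction `(Γ̄^t - Γ^t, q̄^t - q^t)`. Three errors are tracked. `A_t` is the mean square of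
the rate error `r̂^{t-1} - 𝔼[r](Γ^t)`. The gradient estimate cannot be treated the same way, because
`∇U` is evaluated at `r̂^t`, which depends on the very samples that enter the Jacobian, so the noise
is not centred given the past. It is therefore compared with `Run.auxGrad`, where `∇U` is evaluated
at `Run.midTable`, the mean of `r̂^t` given the past. `B_t` is the mean square error of the
auxiliary estimate, and `E_t` is the mean distance between the two estimates.

Orthogonality of fresh centred noise to the past (`PastMeas.batch_noise`,
`integral_sq_recursion_le`) and the Lipschitz bounds give, with one constant `C`, `A_{t+1} ≤
(1-ρ)A_t + Cρ² + C(γ²/ρ)D_t`, `B_{t+1} ≤ (1-ρ)B_t + Cρ² + CρA_t + C(γ²/ρ)D_t`, `E_{t+1} ≤ (1-ρ)E_t +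
Cρ²`. The last source is of order `ρ²` because `r̂^t` differs from its conditional mean by `ρ` times
noise, and this is multiplied by `ρ` once more in the gradient recursion. The proximal terms of the
two surrogates make the search direction an ascent direction up to these errors
(`System.Bounds.exists_ascent`): `V_{t+1} - V_t ≥ γ(κD_t - C(A_{t+1}+B_{t+1}+E_{t+1})) - Cγ²`. Since
`γ/ρ → 0`, the combination `(C+2)A + B + E - V` decreases up to summable terms, so `∑ γ_t (D_t +
A_{t+1} + B_{t+1} + E_{t+1})` is finite (`summable_weighted_errors`). By Tonelli the corresponding
random series converges almost surely.

Along such a path, `∑ γ_t = ∞` and steps of length `O(γ_t)` force late iterates arbitrarily close to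
every limit point at which direction and errors are small (`exists_close_of_summable`). In the
limit, the limit point solves its own proximal problems with the true rates and gradients
(`SampledRun.surrogate_optimal`). The proximal terms are of second order, so first order variational
inequalities remain, and their multipliers can be written down explicitly.

The probabilistic input on gradients comes from mean square Lipschitz continuity: it bounds
difference quotients in `L²`, hence makes them uniformly integrable, so the random gradients have
bounded second moments and their mean is the gradient of the mean rate
(`RegularRates.exists_ratePartial_bound`). -/

namespace RCSHP

open scoped ComplexOrder

/-! ### Entrywise differentiability and measurability of matrix functions -/

section Entrywise

variable {E : Type*} [NormedAddCommGroup E] [NormedSpace ℝ E]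
variable {a b c : Type*} [Fintype a] [Fintype b] [Fintype c]

/-- Entrywise differentiability of a matrix-valued function. -/
def MatDiff (A : E → Matrix a b ℂ) (x : E) : Prop :=
  ∀ i j, DifferentiableAt ℝ (fun y => A y i j) x

omit [Fintype a] [Fintype c] in
lemma MatDiff.mul {A : E → Matrix a b ℂ} {B : E → Matrix b c ℂ} {x : E}
    (hA : MatDiff A x) (hB : MatDiff B x) : MatDiff (fun y => A y * B y) x := by
  intro i j
  simp only [Matrix.mul_apply]
  exact DifferentiableAt.fun_sum fun k _ => (hA i k).mul (hB k j)

omit [Fintype a] [Fintype b] in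
lemma MatDiff.add {A B : E → Matrix a b ℂ} {x : E}
    (hA : MatDiff A x) (hB : MatDiff B x) : MatDiff (fun y => A y + B y) x := by
  intro i j
  simp only [Matrix.add_apply]
  exact (hA i j).add (hB i j)

omit [Fintype a] [Fintype b] in
lemma MatDiff.const (A : Matrix a b ℂ) (x : E) : MatDiff (fun _ => A) x :=
  fun _ _ => differentiableAt_const _

omit [Fintype a] [Fintype b] in
lemma MatDiff.conjTranspose {A : E → Matrix a b ℂ} {x : E} (hA : MatDiff A x) :
    MatDiff (fun y => (A y)ᴴ) x := by
  intro i j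
  simp only [Matrix.conjTranspose_apply]
  exact (hA j i).star

lemma MatDiff.det [DecidableEq a] {A : E → Matrix a a ℂ} {x : E} (hA : MatDiff A x) :
    DifferentiableAt ℝ (fun y => (A y).det) x := by
  simp only [Matrix.det_apply']
  refine DifferentiableAt.fun_sum fun σ _ => DifferentiableAt.const_mul ?_ _
  exact (HasFDerivAt.finsetProd fun i _ => (hA _ i).hasFDerivAt).differentiableAt

/-- Cramer's rule: each entry of the inverse is a cofactor determinant divided by the determinant.
-/
lemma MatDiff.inv [DecidableEq a] {A : E → Matrix a a ℂ} {x : E} (hA : MatDiff A x)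
    (hdet : (A x).det ≠ 0) : MatDiff (fun y => (A y)⁻¹) x := by
  intro i j
  simp only [Matrix.inv_def, Matrix.smul_apply, Ring.inverse_eq_inv', smul_eq_mul,
    Matrix.adjugate_apply]
  refine (hA.det.fun_inv hdet).mul (MatDiff.det fun k l => ?_)
  by_cases h : k = j
  · subst h
    simp only [Matrix.updateRow_self]
    exact differentiableAt_const _
  · simp only [Matrix.updateRow_ne h]
    exact hA k l

omit [Fintype a] in
lemma MatDiff.mulVec {A : E → Matrix a b ℂ} {v : E → b → ℂ} {x : E} (hA : MatDiff A x)
    (hv : ∀ j, DifferentiableAt ℝ (fun y => v y j) x) (i : a) :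
    DifferentiableAt ℝ (fun y => (A y *ᵥ v y) i) x := by
  simp only [Matrix.mulVec, dotProduct]
  exact DifferentiableAt.fun_sum fun k _ => (hA i k).mul (hv k)

variable {X : Type*} [MeasurableSpace X]

/-- Entrywise measurability of a matrix-valued function. -/
def MatMeas (A : X → Matrix a b ℂ) : Prop := ∀ i j, Measurable fun y => A y i j

omit [Fintype a] [Fintype c] in
lemma MatMeas.mul {A : X → Matrix a b ℂ} {B : X → Matrix b c ℂ}
    (hA : MatMeas A) (hB : MatMeas B) : MatMeas (fun y => A y * B y) := by
  intro i j
  simp only [Matrix.mul_apply]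
  exact Finset.measurable_fun_sum _ fun k _ => (hA i k).mul (hB k j)

omit [Fintype a] [Fintype b] in
lemma MatMeas.add {A B : X → Matrix a b ℂ} (hA : MatMeas A) (hB : MatMeas B) :
    MatMeas (fun y => A y + B y) := by
  intro i j
  simp only [Matrix.add_apply]
  exact (hA i j).add (hB i j)

omit [Fintype a] [Fintype b] in
lemma MatMeas.const (A : Matrix a b ℂ) : MatMeas (fun _ : X => A) := fun _ _ => measurable_const

omit [Fintype a] [Fintype b] in
lemma MatMeas.conjTranspose {A : X → Matrix a b ℂ} (hA : MatMeas A) :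
    MatMeas (fun y => (A y)ᴴ) := by
  intro i j
  simp only [Matrix.conjTranspose_apply]
  exact Complex.continuous_conj.measurable.comp (hA j i)

lemma MatMeas.det [DecidableEq a] {A : X → Matrix a a ℂ} (hA : MatMeas A) :
    Measurable (fun y => (A y).det) := by
  simp only [Matrix.det_apply']
  refine Finset.measurable_fun_sum _ fun σ _ => Measurable.const_mul ?_ _
  exact Finset.measurable_fun_prod _ fun i _ => hA _ _

/-- Invertibility plays no role here: the inverse is everywhere the adjugate times the inverted
determinant, and `z ↦ z⁻¹` with `0⁻¹ = 0` is measurable. -/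
lemma MatMeas.inv [DecidableEq a] {A : X → Matrix a a ℂ} (hA : MatMeas A) :
    MatMeas (fun y => (A y)⁻¹) := by
  intro i j
  simp only [Matrix.inv_def, Matrix.smul_apply, Ring.inverse_eq_inv', smul_eq_mul,
    Matrix.adjugate_apply]
  refine hA.det.inv.mul (MatMeas.det fun k l => ?_)
  by_cases h : k = j
  · subst h
    simp only [Matrix.updateRow_self]
    exact measurable_const
  · simp only [Matrix.updateRow_ne h]
    exact hA k l

omit [Fintype a] in
lemma MatMeas.mulVec {A : X → Matrix a b ℂ} {v : X → b → ℂ} (hA : MatMeas A)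
    (hv : ∀ j, Measurable (fun y => v y j)) (i : a) :
    Measurable (fun y => (A y *ᵥ v y) i) := by
  simp only [Matrix.mulVec, dotProduct]
  exact Finset.measurable_fun_sum _ fun k _ => (hA i k).mul (hv k)

end Entrywise

noncomputable section

/-! ### The instantaneous rate as a measurable and differentiable function -/

namespace System

variable {K M S Tp : ℕ} (sys : System K M S Tp)

/-! ### The rates in terms of unnormalised beams -/

/-- The matrix with columns `F (Ĥᴴ P Ĥ + I)⁻¹ ĥ_k`. -/
def beam (x : Ctrl K M S) (ω : State K M Tp) : Matrix (Fin M) (Fin K) ℂ :=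
  analog x * ((sys.estMatrix x ω)ᴴ * powMatrix x * sys.estMatrix x ω + 1)⁻¹ *
    (sys.estMatrix x ω)ᴴ

/-- Gain `|h_kᴴ w_i|² / ‖w_i‖²` of the normalised beam `w_i`. -/
def beamGain (x : Ctrl K M S) (ω : State K M Tp) (k i : Fin K) : ℝ :=
  ‖∑ m, star (ω.1 k m) * sys.beam x ω m i‖ ^ 2 / ∑ m, ‖sys.beam x ω m i‖ ^ 2

/-- The raw column is `p_i` times the beam, so normalisation cancels the size of `p_i` whenever `p_i
≠ 0`, and `p_i = 0` kills both sides. The rates can thus be written without the normalisation that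
degenerates at zero power, which is what makes them differentiable at boundary controls. -/
lemma pow_mul_gain (x : Ctrl K M S) (ω : State K M Tp) (k i : Fin K) :
    pow x i * sys.gain x ω k i = pow x i * sys.beamGain x ω k i := by
  have h1 : ∀ m, (analog x * sys.rawDigital x ω) m i = sys.beam x ω m i * (pow x i : ℂ) := by
    intro m
    have : analog x * sys.rawDigital x ω = sys.beam x ω * powMatrix x := by
      simp only [rawDigital, beam, Matrix.mul_assoc]
    rw [this, powMatrix, Matrix.mul_diagonal]
  set c : ℝ := ‖WithLp.toLp 2 (fun m => (analog x * sys.rawDigital x ω) m i)‖⁻¹ with hc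
  have h2 : ∀ m, (analog x * sys.digital x ω) m i = sys.beam x ω m i * (pow x i : ℂ) * (c : ℂ) := by
    intro m
    rw [digital, ← Matrix.mul_assoc, Matrix.mul_diagonal, h1]
  have hc2 : c ^ 2 = (pow x i ^ 2 * ∑ m, ‖sys.beam x ω m i‖ ^ 2)⁻¹ := by
    rw [hc, inv_pow, EuclideanSpace.norm_sq_eq, Finset.mul_sum]
    congr 1
    refine Finset.sum_congr rfl fun m _ => ?_
    simp only [h1, norm_mul, Complex.norm_real, Real.norm_eq_abs, mul_pow, sq_abs]
    ring
  have h3 : star (ω.1 k) ⬝ᵥ (fun m => (analog x * sys.digital x ω) m i) =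
      (∑ m, star (ω.1 k m) * sys.beam x ω m i) * ((pow x i * c : ℝ) : ℂ) := by
    simp only [dotProduct, h2, Finset.sum_mul, Pi.star_apply]
    refine Finset.sum_congr rfl fun m _ => ?_
    push_cast
    ring
  rw [gain, beamGain, h3, norm_mul, Complex.norm_real, Real.norm_eq_abs, mul_pow, sq_abs, mul_pow,
    hc2]
  by_cases hp : pow x i = 0
  · simp [hp]
  · field_simp

lemma rate_eq (k : Fin K) (x : Ctrl K M S) (ω : State K M Tp) :
    sys.rate k x ω = Real.log (1 + pow x k * sys.beamGain x ω k k /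
      (∑ i ∈ Finset.univ.erase k, pow x i * sys.beamGain x ω k i + 1)) := by
  simp only [rate, pow_mul_gain]

lemma beamGain_nonneg (x : Ctrl K M S) (ω : State K M Tp) (k i : Fin K) :
    0 ≤ sys.beamGain x ω k i := by
  unfold beamGain; positivity

lemma interference_nonneg {x : Ctrl K M S} (hx : ∀ k, 0 ≤ pow x k) (ω : State K M Tp)
    (k : Fin K) : 0 ≤ ∑ i ∈ Finset.univ.erase k, pow x i * sys.beamGain x ω k i :=
  Finset.sum_nonneg fun i _ => mul_nonneg (hx i) (sys.beamGain_nonneg x ω k i)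

lemma rate_nonneg {x : Ctrl K M S} (hx : ∀ k, 0 ≤ pow x k) (ω : State K M Tp) (k : Fin K) :
    0 ≤ sys.rate k x ω := by
  rw [rate_eq]
  refine Real.log_nonneg ?_
  have := sys.interference_nonneg hx ω k
  have := mul_nonneg (hx k) (sys.beamGain_nonneg x ω k k)
  have : 0 ≤ pow x k * sys.beamGain x ω k k /
    (∑ i ∈ Finset.univ.erase k, pow x i * sys.beamGain x ω k i + 1) := by positivity
  linarith

lemma rate_zero (ω : State K M Tp) (k : Fin K) : sys.rate k 0 ω = 0 := by
  simp [rate, pow]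

/-! ### Measurability of the rates -/

lemma measurable_phase (m : Fin M) (s : Fin S) :
    Measurable fun x : Ctrl K M S => phase x m s := by
  unfold phase; fun_prop

lemma measurable_pow (k : Fin K) : Measurable fun x : Ctrl K M S => pow x k := by
  unfold pow; fun_prop

lemma matMeas_analog :
    MatMeas fun p : Ctrl K M S × State K M Tp => analog p.1 := by
  intro m s
  have : Measurable fun p : Ctrl K M S × State K M Tp => phase p.1 m s :=
    (measurable_phase m s).comp measurable_fst
  simp only [analog, Matrix.of_apply]
  exact (Complex.measurable_exp.comp ((Complex.measurable_ofReal.comp this).const_mul _)).const_mul _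

lemma matMeas_powMatrix :
    MatMeas fun p : Ctrl K M S × State K M Tp => powMatrix p.1 := by
  intro i j
  have : Measurable fun p : Ctrl K M S × State K M Tp => pow p.1 i :=
    (measurable_pow i).comp measurable_fst
  simp only [powMatrix, Matrix.diagonal_apply]
  split_ifs
  · exact Complex.measurable_ofReal.comp this
  · exact measurable_const

lemma measurable_estimate (k : Fin K) (s : Fin S) :
    Measurable fun p : Ctrl K M S × State K M Tp => sys.estimate p.1 p.2 k s := by
  have hF := matMeas_analog (K := K) (M := M) (S := S) (Tp := Tp)
  have hFC : MatMeas fun p : Ctrl K M S × State K M Tp =>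
      (analog p.1)ᴴ * sys.cov k * analog p.1 :=
    (hF.conjTranspose.mul (MatMeas.const _)).mul hF
  have hh : ∀ m, Measurable fun p : Ctrl K M S × State K M Tp => p.2.1 k m := fun m => by fun_prop
  have hn : ∀ m, Measurable fun p : Ctrl K M S × State K M Tp => p.2.2 k m := fun m => by fun_prop
  have hobs : ∀ j, Measurable fun p : Ctrl K M S × State K M Tp =>
      sys.observation p.1 p.2 k j := by
    intro j
    simp only [observation, Pi.add_apply]
    refine Measurable.add ((MatMeas.const sys.pilot).mulVec (fun i => ?_) j) (hn j)
    exact Complex.continuous_conj.measurable.comp (hF.conjTranspose.mulVec hh i)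
  refine MatMeas.mulVec ?_ (fun j => ?_) s
  · exact (hFC.mul (MatMeas.const _)).mul
      ((((MatMeas.const _).mul hFC).mul (MatMeas.const _)).add (MatMeas.const _)).inv
  · exact Complex.continuous_conj.measurable.comp (hobs j)

lemma matMeas_beam :
    MatMeas fun p : Ctrl K M S × State K M Tp => sys.beam p.1 p.2 := by
  have hF := matMeas_analog (K := K) (M := M) (S := S) (Tp := Tp)
  have hP := matMeas_powMatrix (K := K) (M := M) (S := S) (Tp := Tp)
  have hH : MatMeas fun p : Ctrl K M S × State K M Tp => sys.estMatrix p.1 p.2 := fun k s =>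
    Complex.continuous_conj.measurable.comp (sys.measurable_estimate k s)
  exact (hF.mul ((hH.conjTranspose.mul hP).mul hH |>.add (MatMeas.const _)).inv).mul
    hH.conjTranspose

lemma measurable_rate (k : Fin K) :
    Measurable fun p : Ctrl K M S × State K M Tp => sys.rate k p.1 p.2 := by
  have hB := sys.matMeas_beam
  have hg : ∀ i, Measurable fun p : Ctrl K M S × State K M Tp =>
      pow p.1 i * sys.beamGain p.1 p.2 k i := by
    intro i
    refine ((measurable_pow i).comp measurable_fst).mul ?_
    have hh : ∀ m, Measurable fun p : Ctrl K M S × State K M Tp => p.2.1 k m := fun m => by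
      fun_prop
    refine Measurable.div ?_ (Finset.measurable_fun_sum _ fun m _ => (hB m i).norm.pow_const 2)
    refine Measurable.pow_const (Measurable.norm (Finset.measurable_fun_sum _ fun m _ => ?_)) 2
    exact (Complex.continuous_conj.measurable.comp (hh m)).mul (hB m i)
  simp only [rate_eq]
  exact Real.measurable_log.comp (measurable_const.add
    ((hg k).div ((Finset.measurable_fun_sum _ fun i _ => hg i).add measurable_const)))

/-! ### Differentiability of the rates -/

lemma estimate_eq_conjTranspose_mulVec (x : Ctrl K M S) (ω : State K M Tp) (k : Fin K) :
    ∃ v, sys.estimate x ω k = (analog x)ᴴ *ᵥ v := by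
  refine ⟨(sys.cov k * analog x * sys.pilotᵀ *
    (sys.pilot.map star * ((analog x)ᴴ * sys.cov k * analog x) * sys.pilotᵀ + 1)⁻¹) *ᵥ
      star (sys.observation x ω k), ?_⟩
  rw [estimate, Matrix.mulVec_mulVec]
  simp only [Matrix.mul_assoc]

/-- The inverse of a singular matrix is `0` by convention and would make the estimate vanish, so a
nonzero estimate already certifies invertibility, with no positivity argument for the covariance. -/
lemma det_pilot_ne_zero {x : Ctrl K M S} {ω : State K M Tp} {k : Fin K}
    (h : sys.estimate x ω k ≠ 0) :
    (sys.pilot.map star * ((analog x)ᴴ * sys.cov k * analog x) * sys.pilotᵀ + 1).det ≠ 0 := by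
  intro h0
  apply h
  rw [estimate, Matrix.nonsing_inv_apply_not_isUnit]
  · simp
  · rw [h0]; simp

lemma posDef_regularized {x : Ctrl K M S} (hx : ∀ k, 0 ≤ pow x k) (ω : State K M Tp) :
    ((sys.estMatrix x ω)ᴴ * powMatrix x * sys.estMatrix x ω + 1).PosDef := by
  have hP : (powMatrix x).PosSemidef := by
    refine Matrix.PosSemidef.diagonal fun k => ?_
    simpa using hx k
  exact Matrix.PosDef.posSemidef_add (hP.conjTranspose_mul_mul_same _) Matrix.PosDef.one

/-- Put `A = Ĥᴴ P Ĥ + 1` and `v = A⁻¹ ĥ_i`. Every estimate lies in the range of `Fᴴ`, and `v = ĥ_i -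
Ĥᴴ P Ĥ v`, so `v = Fᴴ z`. A vanishing beam means `F Fᴴ z = 0`, which forces `v = 0` and then `ĥ_i =
A v = 0`. Hence the denominators of the normalised gains do not vanish. -/
lemma beam_ne_zero {x : Ctrl K M S} (hx : ∀ k, 0 ≤ pow x k) {ω : State K M Tp} {i : Fin K}
    (h : sys.estimate x ω i ≠ 0) : ∃ m, sys.beam x ω m i ≠ 0 := by
  by_contra! hcon
  choose U hU using fun k => sys.estimate_eq_conjTranspose_mulVec x ω k
  set F := analog x
  set H := sys.estMatrix x ω with hH
  set A := Hᴴ * powMatrix x * H + 1 with hA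
  have hdet : IsUnit A.det := (sys.posDef_regularized hx ω).det_pos.ne'.isUnit
  set e : Fin S → ℂ := sys.estimate x ω i with he
  have hHe : ∀ s, Hᴴ s i = e s := fun s => by simp [hH, estMatrix, he]
  have hHU : Hᴴ = Fᴴ * Matrix.of (fun m k => U k m) := by
    ext s k
    have : Hᴴ s k = sys.estimate x ω k s := by simp [hH, estMatrix]
    rw [this, hU k]
    simp [Matrix.mul_apply, Matrix.mulVec, dotProduct]
  set v : Fin S → ℂ := A⁻¹ *ᵥ e with hv
  have hAv : A *ᵥ v = e := by
    rw [hv, Matrix.mulVec_mulVec, Matrix.mul_nonsing_inv _ hdet, Matrix.one_mulVec]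
  have hFv : F *ᵥ v = 0 := by
    ext m
    have := hcon m
    rw [beam, Matrix.mul_assoc, Matrix.mul_assoc] at this
    rw [hv, Matrix.mulVec_mulVec]
    simp only [Matrix.mulVec, dotProduct, Pi.zero_apply]
    rw [← this, ← Matrix.mul_assoc, Matrix.mul_apply, ← Matrix.mul_assoc]
    exact Finset.sum_congr rfl fun s _ => by rw [← hHe s]
  obtain ⟨z, hz⟩ : ∃ z, v = Fᴴ *ᵥ z := by
    refine ⟨U i - Matrix.of (fun m k => U k m) *ᵥ ((powMatrix x * H) *ᵥ v), ?_⟩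
    have h1 : e = (Hᴴ * powMatrix x * H) *ᵥ v + v := by
      rw [← hAv, hA, Matrix.add_mulVec, Matrix.one_mulVec]
    rw [Matrix.mulVec_sub, ← hU i, ← he, Matrix.mulVec_mulVec, ← hHU, Matrix.mulVec_mulVec,
      ← Matrix.mul_assoc, h1, add_sub_cancel_left]
  have hv0 : v = 0 := by
    rw [hz, Matrix.mulVec_mulVec] at hFv
    rw [hz]
    exact (Matrix.self_mul_conjTranspose_mulVec_eq_zero F z).1 hFv
  apply h
  rw [← hAv, hv0, Matrix.mulVec_zero]

lemma differentiableAt_pow (k : Fin K) (x : Ctrl K M S) :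
    DifferentiableAt ℝ (fun y : Ctrl K M S => pow y k) x := by
  unfold pow; fun_prop

lemma matDiff_analog (x : Ctrl K M S) :
    MatDiff (fun y : Ctrl K M S => analog y) x := by
  intro m s
  have h : DifferentiableAt ℝ (fun y : Ctrl K M S => ((phase y m s : ℝ) : ℂ)) x := by
    have : DifferentiableAt ℝ (fun y : Ctrl K M S => phase y m s) x := by unfold phase; fun_prop
    exact Complex.ofRealCLM.differentiableAt.comp x this
  simp only [analog, Matrix.of_apply]
  exact ((h.const_mul _).cexp).const_mul _

lemma matDiff_powMatrix (x : Ctrl K M S) :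
    MatDiff (fun y : Ctrl K M S => powMatrix y) x := by
  intro i j
  simp only [powMatrix, Matrix.diagonal_apply]
  split_ifs
  · exact Complex.ofRealCLM.differentiableAt.comp x (differentiableAt_pow i x)
  · exact differentiableAt_const _

lemma differentiableAt_estimate {x : Ctrl K M S} {ω : State K M Tp} {k : Fin K}
    (h : sys.estimate x ω k ≠ 0) (s : Fin S) :
    DifferentiableAt ℝ (fun y => sys.estimate y ω k s) x := by
  have hF := matDiff_analog (K := K) (M := M) (S := S) x
  have hFC : MatDiff (fun y : Ctrl K M S => (analog y)ᴴ * sys.cov k * analog y) x :=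
    (hF.conjTranspose.mul (MatDiff.const _ x)).mul hF
  have hobs : ∀ j, DifferentiableAt ℝ (fun y : Ctrl K M S => sys.observation y ω k j) x := by
    intro j
    simp only [observation, Pi.add_apply]
    refine DifferentiableAt.add_const _ ((MatDiff.const sys.pilot x).mulVec (fun i => ?_) j)
    exact (hF.conjTranspose.mulVec (v := fun _ => ω.1 k) (fun _ => differentiableAt_const _) i).star
  refine MatDiff.mulVec ?_ (fun j => (hobs j).star) s
  exact (hFC.mul (MatDiff.const _ x)).mul
    ((((MatDiff.const _ x).mul hFC).mul (MatDiff.const _ x)).add (MatDiff.const _ x)|>.inv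
      (sys.det_pilot_ne_zero h))

lemma matDiff_beam {x : Ctrl K M S} (hx : ∀ k, 0 ≤ pow x k) {ω : State K M Tp}
    (h : ∀ k, sys.estimate x ω k ≠ 0) : MatDiff (fun y => sys.beam y ω) x := by
  have hF := matDiff_analog (K := K) (M := M) (S := S) x
  have hP := matDiff_powMatrix (K := K) (M := M) (S := S) x
  have hH : MatDiff (fun y => sys.estMatrix y ω) x := fun k s =>
    (sys.differentiableAt_estimate (h k) s).star
  exact (hF.mul (((hH.conjTranspose.mul hP).mul hH |>.add (MatDiff.const _ x)).inv
    (sys.posDef_regularized hx ω).det_pos.ne')).mul hH.conjTranspose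

/-- The rates are differentiable at every control with nonnegative powers for which all channel
estimates are nonzero. -/
lemma differentiableAt_rate {x : Ctrl K M S} (hx : ∀ k, 0 ≤ pow x k) {ω : State K M Tp}
    (h : ∀ k, sys.estimate x ω k ≠ 0) (k : Fin K) :
    DifferentiableAt ℝ (fun y => sys.rate k y ω) x := by
  have hB := sys.matDiff_beam hx h
  have hg : ∀ i, DifferentiableAt ℝ (fun y => pow y i * sys.beamGain y ω k i) x := by
    intro i
    refine (differentiableAt_pow i x).mul ?_
    have hsum : DifferentiableAt ℝ (fun y => ∑ m, star (ω.1 k m) * sys.beam y ω m i) x :=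
      DifferentiableAt.fun_sum fun m _ => (hB m i).const_mul _
    unfold beamGain
    simp only [div_eq_mul_inv]
    refine (hsum.norm_sq ℝ).mul (DifferentiableAt.fun_inv
      (DifferentiableAt.fun_sum fun m _ => (hB m i).norm_sq ℝ) ?_)
    obtain ⟨m, hm⟩ := sys.beam_ne_zero hx (h i)
    refine (Finset.sum_pos' (fun m _ => by positivity) ⟨m, Finset.mem_univ _, ?_⟩).ne'
    have := norm_pos_iff.2 hm
    positivity
  simp only [rate_eq]
  have h1 := sys.interference_nonneg hx ω k
  have h2 := mul_nonneg (hx k) (sys.beamGain_nonneg x ω k k)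
  refine DifferentiableAt.log (DifferentiableAt.const_add _ ?_) ?_
  · simp only [div_eq_mul_inv]
    refine (hg k).mul (DifferentiableAt.fun_inv
      ((DifferentiableAt.fun_sum fun i _ => hg i).add_const _) ?_)
    positivity
  · have : 0 ≤ pow x k * sys.beamGain x ω k k /
      (∑ i ∈ Finset.univ.erase k, pow x i * sys.beamGain x ω k i + 1) := by positivity
    linarith

end System

end

end RCSHP

/-! ### Exchanging expectation and differentiation for the rates -/

namespace RCSHP

/-! ### Convergence of integrals under a second moment bound -/

/-- An a.e. convergent sequence with bounded second moments has convergent integrals. -/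
lemma tendsto_integral_of_eLpNorm_two_le {Ω : Type*} [MeasurableSpace Ω] {μ : Measure Ω}
    [IsProbabilityMeasure μ] {f : ℕ → Ω → ℝ} {g : Ω → ℝ} {B : ℝ≥0}
    (hf : ∀ n, AEStronglyMeasurable (f n) μ) (hB : ∀ n, eLpNorm (f n) 2 μ ≤ B)
    (hfg : ∀ᵐ x ∂μ, Tendsto (fun n => f n x) atTop (𝓝 (g x))) :
    eLpNorm g 2 μ ≤ B ∧ Tendsto (fun n => ∫ x, f n x ∂μ) atTop (𝓝 (∫ x, g x ∂μ)) := by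
  have hgm : AEStronglyMeasurable g μ := aestronglyMeasurable_of_tendsto_ae atTop hf hfg
  have hgB : eLpNorm g 2 μ ≤ B := Lp.eLpNorm_le_of_ae_tendsto (Eventually.of_forall hB) hf hfg
  have hgL : MemLp g 2 μ := ⟨hgm, hgB.trans_lt ENNReal.coe_lt_top⟩
  have hg1 : MemLp g 1 μ := hgL.mono_exponent one_le_two
  have hfL : ∀ n, MemLp (f n) 2 μ := fun n => ⟨hf n, (hB n).trans_lt ENNReal.coe_lt_top⟩
  have hui : UnifIntegrable f 1 μ := by
    refine unifIntegrable_of le_rfl ENNReal.one_ne_top hf fun ε hε => ?_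
    have hε' : 0 < (B : ℝ) ^ 2 / ε + 1 := by positivity
    -- Where `C ≤ |f|` one has `|f| ≤ |f|² / C`, so the tail integral is at most `B² / C`, which is
    -- below `ε` for this `C`. The summand `1` keeps `C` positive when `B = 0`.
    refine ⟨⟨(B : ℝ) ^ 2 / ε + 1, hε'.le⟩, fun n => ?_⟩
    set C : ℝ≥0 := ⟨(B : ℝ) ^ 2 / ε + 1, hε'.le⟩ with hC
    have hCpos : 0 < C := hε'
    have hint : ∫⁻ x, ‖f n x‖ₑ ^ 2 ∂μ ≤ (B : ℝ≥0∞) ^ 2 := by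
      have := hB n
      rw [eLpNorm_eq_lintegral_rpow_enorm_toReal two_ne_zero ENNReal.ofNat_ne_top] at this
      have h2 := ENNReal.rpow_le_rpow this (z := 2) (by norm_num)
      rw [← ENNReal.rpow_mul] at h2
      simpa using h2
    have h3 : ∀ x, ‖({ x | C ≤ ‖f n x‖₊ }.indicator (f n)) x‖ₑ ≤ (C : ℝ≥0∞)⁻¹ * ‖f n x‖ₑ ^ 2 := by
      intro x
      by_cases hx : x ∈ { x | C ≤ ‖f n x‖₊ }
      · rw [Set.indicator_of_mem hx]
        have hx' : (C : ℝ≥0∞) ≤ ‖f n x‖ₑ := by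
          rw [enorm_eq_nnnorm]; exact_mod_cast hx
        rw [sq, ← mul_assoc]
        calc ‖f n x‖ₑ = (C : ℝ≥0∞)⁻¹ * C * ‖f n x‖ₑ := by
              rw [ENNReal.inv_mul_cancel (by exact_mod_cast hCpos.ne') ENNReal.coe_ne_top, one_mul]
          _ ≤ _ := by gcongr
      · rw [Set.indicator_of_notMem hx]; simp
    rw [eLpNorm_one_eq_lintegral_enorm]
    calc ∫⁻ x, ‖({ x | C ≤ ‖f n x‖₊ }.indicator (f n)) x‖ₑ ∂μ
        ≤ ∫⁻ x, (C : ℝ≥0∞)⁻¹ * ‖f n x‖ₑ ^ 2 ∂μ := lintegral_mono h3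
      _ = (C : ℝ≥0∞)⁻¹ * ∫⁻ x, ‖f n x‖ₑ ^ 2 ∂μ :=
          lintegral_const_mul' _ _ (ENNReal.inv_ne_top.2 (by exact_mod_cast hCpos.ne'))
      _ ≤ (C : ℝ≥0∞)⁻¹ * (B : ℝ≥0∞) ^ 2 := by gcongr
      _ = ((C⁻¹ * B ^ 2 : ℝ≥0) : ℝ≥0∞) := by
          rw [ENNReal.coe_mul, ENNReal.coe_inv hCpos.ne', ENNReal.coe_pow]
      _ ≤ ENNReal.ofReal ε := by
          rw [ENNReal.ofReal, ENNReal.coe_le_coe, ← NNReal.coe_le_coe, Real.coe_toNNReal _ hε.le]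
          push_cast
          rw [inv_mul_le_iff₀ (by exact_mod_cast hCpos)]
          have : (C : ℝ) = (B : ℝ) ^ 2 / ε + 1 := rfl
          rw [this, add_mul, div_mul_cancel₀ _ hε.ne']
          linarith
  have hL := tendsto_Lp_finite_of_tendsto_ae le_rfl ENNReal.one_ne_top hf hg1 hui hfg
  refine ⟨hgB, ?_⟩
  refine tendsto_integral_of_L1 g hgm
    (Eventually.of_forall fun n => memLp_one_iff_integrable.1 ((hfL n).mono_exponent one_le_two)) ?_
  simpa [eLpNorm_one_eq_lintegral_enorm] using hL

/-! ### Convex sets with interior points -/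

noncomputable section

namespace System

variable {K M S Tp : ℕ} (sys : System K M S Tp)

lemma convex_ctrlSet : Convex ℝ sys.ctrlSet := by
  intro x hx y hy a b ha hb hab
  refine ⟨fun m s => ⟨?_, ?_⟩, fun k => ?_, ?_⟩
  · have h1 := (hx.1 m s).1
    have h2 := (hy.1 m s).1
    change 0 ≤ a * phase x m s + b * phase y m s
    positivity
  · have h1 := (hx.1 m s).2
    have h2 := (hy.1 m s).2
    change a * phase x m s + b * phase y m s ≤ _
    calc _ ≤ a * (2 * Real.pi) + b * (2 * Real.pi) := by gcongr
      _ = _ := by rw [← add_mul, hab, one_mul]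
  · have h1 := hx.2.1 k
    have h2 := hy.2.1 k
    change 0 ≤ a * pow x k + b * pow y k
    positivity
  · change ∑ k, (a * pow x k + b * pow y k) ≤ _
    rw [Finset.sum_add_distrib, ← Finset.mul_sum, ← Finset.mul_sum]
    calc _ ≤ a * sys.Pmax + b * sys.Pmax := by
          gcongr
          exacts [hx.2.2, hy.2.2]
      _ = _ := by rw [← add_mul, hab, one_mul]

lemma pow_le_of_mem {x : Ctrl K M S} (hx : x ∈ sys.ctrlSet) (k : Fin K) : pow x k ≤ sys.Pmax :=
  (Finset.single_le_sum (f := fun k => pow x k) (fun k _ => hx.2.1 k) (Finset.mem_univ k)).trans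
    hx.2.2

lemma isClosed_ctrlSet : IsClosed sys.ctrlSet := by
  have h1 : ∀ m s, Continuous fun x : Ctrl K M S => phase x m s := fun m s => by
    unfold phase; fun_prop
  have h2 : ∀ k, Continuous fun x : Ctrl K M S => pow x k := fun k => by unfold pow; fun_prop
  simp only [ctrlSet, Set.ofPred_and, Set.ofPred_forall]
  refine (isClosed_iInter fun m => isClosed_iInter fun s =>
    isClosed_Icc.preimage (h1 m s)).inter ((isClosed_iInter fun k => ?_).inter ?_)
  · exact isClosed_le continuous_const (h2 k)
  · exact isClosed_le (continuous_finsetSum _ fun k _ => h2 k) continuous_const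

lemma isCompact_ctrlSet : IsCompact sys.ctrlSet := by
  refine Metric.isCompact_of_isClosed_isBounded sys.isClosed_ctrlSet ?_
  refine isBounded_iff_forall_norm_le.2
    ⟨√(∑ _i : (Fin M × Fin S) ⊕ Fin K, (2 * Real.pi + sys.Pmax) ^ 2), fun x hx => ?_⟩
  rw [EuclideanSpace.norm_eq]
  refine Real.sqrt_le_sqrt (Finset.sum_le_sum fun i _ => ?_)
  rw [Real.norm_eq_abs, sq_abs]
  have hpi := Real.pi_pos
  rcases i with ⟨m, s⟩ | k
  · have h := hx.1 m s
    have hP : 0 ≤ sys.Pmax := (Finset.sum_nonneg fun k _ => hx.2.1 k).trans hx.2.2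
    change phase x m s ^ 2 ≤ _
    exact pow_le_pow_left₀ h.1 (h.2.trans (by linarith)) 2
  · have h := sys.pow_le_of_mem hx k
    change pow x k ^ 2 ≤ _
    exact pow_le_pow_left₀ (hx.2.1 k) (h.trans (by linarith)) 2

variable {sys}

lemma zero_mem_ctrlSet (hP : 0 < sys.Pmax) : (0 : Ctrl K M S) ∈ sys.ctrlSet :=
  ⟨fun m s => ⟨le_rfl, by simp only [phase, PiLp.zero_apply]; positivity⟩, fun k => le_rfl,
    by simpa [pow] using hP.le⟩

lemma interior_ctrlSet_nonempty (hP : 0 < sys.Pmax) : (interior sys.ctrlSet).Nonempty := by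
  have h1 : ∀ m s, Continuous fun x : Ctrl K M S => phase x m s := fun m s => by
    unfold phase; fun_prop
  have h2 : ∀ k, Continuous fun x : Ctrl K M S => pow x k := fun k => by unfold pow; fun_prop
  set O : Set (Ctrl K M S) := {x | (∀ m s, phase x m s ∈ Set.Ioo 0 (2 * Real.pi)) ∧
    (∀ k, 0 < pow x k) ∧ ∑ k, pow x k < sys.Pmax} with hO
  have hopen : IsOpen O := by
    simp only [hO, Set.ofPred_and, Set.ofPred_forall]
    refine (isOpen_iInter_of_finite fun m => isOpen_iInter_of_finite fun s =>
      isOpen_Ioo.preimage (h1 m s)).inter ((isOpen_iInter_of_finite fun k => ?_).inter ?_)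
    · exact isOpen_lt continuous_const (h2 k)
    · exact isOpen_lt (continuous_finsetSum _ fun k _ => h2 k) continuous_const
  have hsub : O ⊆ sys.ctrlSet := fun x hx =>
    ⟨fun m s => Set.Ioo_subset_Icc_self (hx.1 m s), fun k => (hx.2.1 k).le, hx.2.2.le⟩
  -- Dividing the budget by `K + 1` rather than `K` leaves the sum constraint strict and covers `K =
  -- 0`.
  refine ⟨WithLp.toLp 2 (Sum.elim (fun _ => Real.pi) fun _ => sys.Pmax / (K + 1)),
    interior_maximal hsub hopen ⟨fun m s => ?_, fun k => ?_, ?_⟩⟩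
  · have := Real.pi_pos
    constructor <;> simp only [phase, Sum.elim_inl] <;> linarith
  · simp only [pow, Sum.elim_inr]; positivity
  · simp only [pow, Sum.elim_inr, Finset.sum_const, Finset.card_univ, Fintype.card_fin,
      nsmul_eq_mul]
    rw [mul_div_assoc', div_lt_iff₀ (by positivity)]
    nlinarith

variable (sys)

/-! ### The gradients of the rates and of the average rates -/

/-- Gradient of the average rate within the feasible set. -/
def meanGrad (k : Fin K) (x : Ctrl K M S) : Ctrl K M S :=
  gradientWithin (sys.meanRate k) sys.ctrlSet x

/-- The `j`-th partial derivative of the rate, as an upper limit of difference quotients (so that it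
is defined and jointly measurable everywhere). -/
def ratePartial (k : Fin K) (j : (Fin M × Fin S) ⊕ Fin K) (p : Ctrl K M S × State K M Tp) : ℝ :=
  limsup (fun n : ℕ => ((n : ℝ) + 1) * (sys.rate k
    (p.1 + ((n : ℝ) + 1)⁻¹ • EuclideanSpace.single j (1 : ℝ)) p.2 - sys.rate k p.1 p.2)) atTop

lemma measurable_ratePartial (k : Fin K) (j : (Fin M × Fin S) ⊕ Fin K) :
    Measurable (sys.ratePartial k j) := by
  refine Measurable.limsup fun n => Measurable.const_mul (Measurable.sub ?_ ?_) _
  · exact (sys.measurable_rate k).comp ((measurable_fst.add_const _).prodMk measurable_snd)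
  · exact sys.measurable_rate k

lemma tendsto_diffQuot {E : Type*} [NormedAddCommGroup E] [NormedSpace ℝ E] {f : E → ℝ}
    {f' : E →L[ℝ] ℝ} {s : Set E} {x d : E} (h : HasFDerivWithinAt f f' s x)
    (hd : ∀ n : ℕ, x + ((n : ℝ) + 1)⁻¹ • d ∈ s) :
    Tendsto (fun n : ℕ => ((n : ℝ) + 1) * (f (x + ((n : ℝ) + 1)⁻¹ • d) - f x)) atTop
      (𝓝 (f' d)) := by
  have h0 : Tendsto (fun n : ℕ => ((n : ℝ) + 1)⁻¹) atTop (𝓝 0) := by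
    simpa only [one_div] using tendsto_one_div_add_atTop_nhds_zero_nat (𝕜 := ℝ)
  refine h.lim (c := fun n : ℕ => (n : ℝ) + 1) (d := fun n : ℕ => ((n : ℝ) + 1)⁻¹ • d) ?_
    (Eventually.of_forall hd) ?_
  · simpa using h0.smul_const d
  · refine tendsto_const_nhds.congr fun n => ?_
    rw [smul_smul, mul_inv_cancel₀ (by positivity), one_smul]

/-- Where no estimate vanishes, the rate is differentiable in the full space, even at a boundary
control, so the difference quotients converge and the upper limit is the partial derivative. This
trades the gradient for a jointly measurable function of control and state. -/
lemma gradient_apply_eq_ratePartial {x : Ctrl K M S} (hx : x ∈ sys.ctrlSet) {ω : State K M Tp}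
    (h : ∀ k, sys.estimate x ω k ≠ 0) (k : Fin K) (j : (Fin M × Fin S) ⊕ Fin K) :
    gradient (fun y => sys.rate k y ω) x j = sys.ratePartial k j (x, ω) := by
  have hd := sys.differentiableAt_rate hx.2.1 h k
  have ht := tendsto_diffQuot (d := EuclideanSpace.single j (1 : ℝ))
    hd.hasFDerivAt.hasFDerivWithinAt (s := Set.univ) fun _ => Set.mem_univ _
  rw [ratePartial, ht.limsup_eq, ← inner_gradient_left, EuclideanSpace.inner_single_right]
  simp

instance stateLaw_isProbabilityMeasure [IsProbabilityMeasure sys.channelLaw] :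
    IsProbabilityMeasure sys.stateLaw := by
  have : IsProbabilityMeasure complexGaussian :=
    Measure.isProbabilityMeasure_map (MeasurableEquiv.measurable _).aemeasurable
  unfold stateLaw noiseLaw
  infer_instance

variable {sys}

lemma RegularRates.ae_estimate_ne_zero (hreg : sys.RegularRates) {x : Ctrl K M S}
    (hx : x ∈ sys.ctrlSet) : ∀ᵐ ω ∂sys.stateLaw, ∀ k, sys.estimate x ω k ≠ 0 :=
  ae_all_iff.2 fun k => hreg.estimate_ne_zero x hx k

/-- The zero control is feasible and has rate zero, so mean square Lipschitz continuity against it,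
on a bounded set, bounds the second moment. -/
lemma RegularRates.eLpNorm_rate_le (hreg : sys.RegularRates) (hP : 0 < sys.Pmax) :
    ∃ B : ℝ≥0, ∀ k, ∀ x ∈ sys.ctrlSet, eLpNorm (fun ω => sys.rate k x ω) 2 sys.stateLaw ≤ B := by
  obtain ⟨C, hC⟩ := hreg.rate_lipschitz
  obtain ⟨D, hD⟩ := sys.isCompact_ctrlSet.isBounded.exists_norm_le
  refine ⟨C * ‖D‖₊, fun k x hx => ?_⟩
  have := hC k x hx 0 (zero_mem_ctrlSet hP)
  simp only [rate_zero, sub_zero] at this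
  refine this.trans ?_
  rw [ENNReal.coe_mul, edist_zero_right, enorm_eq_nnnorm]
  gcongr
  rw [← NNReal.coe_le_coe, coe_nnnorm, coe_nnnorm]
  exact (hD x hx).trans (le_abs_self D)

/-- Difference quotients along `y - x` have `L²` norm at most `C ‖y - x‖` and converge almost surely
to the directional derivative, so their expectations converge too. The direction must point to a
feasible `y`, because the Lipschitz bound is available only between feasible controls. -/
lemma RegularRates.integral_fderiv_rate [IsProbabilityMeasure sys.channelLaw]
    (hreg : sys.RegularRates) {C : ℝ≥0} (hP : 0 < sys.Pmax)
    (hC : ∀ k, ∀ x ∈ sys.ctrlSet, ∀ y ∈ sys.ctrlSet,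
      eLpNorm (fun ω => sys.rate k x ω - sys.rate k y ω) 2 sys.stateLaw ≤ C * edist x y)
    (k : Fin K) {x y : Ctrl K M S} (hx : x ∈ sys.ctrlSet) (hy : y ∈ sys.ctrlSet) :
    eLpNorm (fun ω => inner ℝ (gradient (fun z => sys.rate k z ω) x) (y - x)) 2 sys.stateLaw ≤
        (C * ‖y - x‖₊ : ℝ≥0) ∧
      ∫ ω, inner ℝ (gradient (fun z => sys.rate k z ω) x) (y - x) ∂sys.stateLaw =
        inner ℝ (sys.meanGrad k x) (y - x) := by
  have hmem : ∀ n : ℕ, x + ((n : ℝ) + 1)⁻¹ • (y - x) ∈ sys.ctrlSet := fun n =>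
    sys.convex_ctrlSet.add_smul_sub_mem hx hy
      ⟨by positivity, inv_le_one_of_one_le₀ (by linarith [(Nat.cast_nonneg n : (0 : ℝ) ≤ n)])⟩
  have hmeas : ∀ z, Measurable fun ω => sys.rate k z ω := fun z =>
    (sys.measurable_rate k).comp measurable_prodMk_left
  obtain ⟨B, hB⟩ := hreg.eLpNorm_rate_le hP
  have hint : ∀ z ∈ sys.ctrlSet, Integrable (fun ω => sys.rate k z ω) sys.stateLaw := fun z hz =>
    memLp_one_iff_integrable.1 ((MemLp.mono_exponent
      ⟨(hmeas z).aestronglyMeasurable, (hB k z hz).trans_lt ENNReal.coe_lt_top⟩ one_le_two))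
  have key := tendsto_integral_of_eLpNorm_two_le (μ := sys.stateLaw) (B := C * ‖y - x‖₊)
    (f := fun n ω => ((n : ℝ) + 1) * (sys.rate k (x + ((n : ℝ) + 1)⁻¹ • (y - x)) ω -
      sys.rate k x ω))
    (g := fun ω => inner ℝ (gradient (fun z => sys.rate k z ω) x) (y - x))
    (fun n => (((hmeas _).sub (hmeas _)).const_mul _).aestronglyMeasurable) (fun n => ?_) ?_
  · refine ⟨key.1, tendsto_nhds_unique key.2 ?_⟩
    have h2 := tendsto_diffQuot (hreg.meanRate_differentiable k x hx).hasFDerivWithinAt hmem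
    rw [meanGrad, inner_gradientWithin_left]
    refine h2.congr fun n => ?_
    rw [integral_const_mul, integral_sub (hint _ (hmem n)) (hint _ hx)]
    rfl
  · have h1 := hC k _ (hmem n) x hx
    have h2 := eLpNorm_const_smul ((n : ℝ) + 1) (fun ω => sys.rate k (x + ((n : ℝ) + 1)⁻¹ • (y - x)) ω -
      sys.rate k x ω) 2 sys.stateLaw
    simp only [Pi.smul_def, smul_eq_mul] at h2
    refine h2.le.trans ((mul_le_mul_right h1 _).trans ?_)
    have h3 : edist (x + ((n : ℝ) + 1)⁻¹ • (y - x)) x = (‖((n : ℝ) + 1)⁻¹‖₊ * ‖y - x‖₊ : ℝ≥0) := by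
      rw [edist_eq_enorm_sub, add_sub_cancel_left, enorm_eq_nnnorm, nnnorm_smul]
    rw [h3, enorm_eq_nnnorm, ← ENNReal.coe_mul, ← ENNReal.coe_mul, nnnorm_inv]
    refine ENNReal.coe_le_coe.2 (le_of_eq ?_)
    have : ‖(n : ℝ) + 1‖₊ ≠ 0 := nnnorm_ne_zero_iff.2 (by positivity)
    field_simp
  · filter_upwards [hreg.ae_estimate_ne_zero hx] with ω hω
    have hd := sys.differentiableAt_rate hx.2.1 hω k
    have := tendsto_diffQuot hd.hasFDerivAt.hasFDerivWithinAt hmem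
    rwa [← inner_gradient_left] at this

/-- The partial derivatives of the rates have bounded second moments, and their means are the
partial derivatives of the average rates. -/
lemma RegularRates.exists_ratePartial_bound [IsProbabilityMeasure sys.channelLaw]
    (hreg : sys.RegularRates) (hP : 0 < sys.Pmax) :
    ∃ B : ℝ≥0, ∀ k j, ∀ x ∈ sys.ctrlSet,
      eLpNorm (fun ω => sys.ratePartial k j (x, ω)) 2 sys.stateLaw ≤ B ∧
      ∫ ω, sys.ratePartial k j (x, ω) ∂sys.stateLaw = sys.meanGrad k x j := by
  obtain ⟨C, hC⟩ := hreg.rate_lipschitz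
  obtain ⟨D, hD⟩ := sys.isCompact_ctrlSet.isBounded.exists_norm_le
  obtain ⟨x₀, hx₀⟩ := interior_ctrlSet_nonempty hP
  obtain ⟨ε, hε, hball⟩ := Metric.isOpen_iff.1 isOpen_interior x₀ hx₀
  have hx₀' : x₀ ∈ sys.ctrlSet := interior_subset hx₀
  refine ⟨‖2 / ε‖₊ * (C * (2 * ‖D‖₊) + C * (2 * ‖D‖₊)), fun k j x hx => ?_⟩
  -- A coordinate direction need not be feasible at `x`, but it is a multiple of a difference of two
  -- feasible ones: `(ε/2) e_j = (y - x) - (x₀ - x)` with `x₀` interior and `y` in the ball around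
  -- it. This is where the factor `2/ε` comes from.
  set y : Ctrl K M S := x₀ + (ε / 2) • EuclideanSpace.single j (1 : ℝ) with hy
  have hy' : y ∈ sys.ctrlSet := by
    refine interior_subset (hball ?_)
    rw [Metric.mem_ball, hy, dist_eq_norm, add_sub_cancel_left, norm_smul]
    simp only [PiLp.norm_single, norm_one, mul_one, Real.norm_eq_abs]
    rw [abs_of_pos (by positivity)]
    linarith
  have hdiam : ∀ z ∈ sys.ctrlSet, (‖z - x‖₊ : ℝ≥0) ≤ 2 * ‖D‖₊ := by
    intro z hz
    refine (nnnorm_sub_le z x).trans ?_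
    rw [two_mul]
    refine add_le_add ?_ ?_ <;> rw [← NNReal.coe_le_coe, coe_nnnorm, coe_nnnorm]
    exacts [(hD _ hz).trans (le_abs_self D), (hD _ hx).trans (le_abs_self D)]
  obtain ⟨h1, h1'⟩ := hreg.integral_fderiv_rate hP hC k hx hy'
  obtain ⟨h2, h2'⟩ := hreg.integral_fderiv_rate hP hC k hx hx₀'
  have hcoord : ∀ v : Ctrl K M S, v j = (2 / ε) * (inner ℝ v (y - x) - inner ℝ v (x₀ - x)) := by
    intro v
    rw [← inner_sub_right, sub_sub_sub_cancel_right, hy, add_sub_cancel_left, inner_smul_right,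
      EuclideanSpace.inner_single_right]
    simp only [conj_trivial]
    field_simp
  have hae : (fun ω => sys.ratePartial k j (x, ω)) =ᵐ[sys.stateLaw] fun ω =>
      (2 / ε) * (inner ℝ (gradient (fun z => sys.rate k z ω) x) (y - x) -
        inner ℝ (gradient (fun z => sys.rate k z ω) x) (x₀ - x)) := by
    filter_upwards [hreg.ae_estimate_ne_zero hx] with ω hω
    rw [← hcoord, sys.gradient_apply_eq_ratePartial hx hω]
  have hm : ∀ z ∈ sys.ctrlSet, AEStronglyMeasurable
      (fun ω => inner ℝ (gradient (fun z => sys.rate k z ω) x) (z - x)) sys.stateLaw := by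
    intro z _
    have h3 : Measurable fun ω => ∑ i, sys.ratePartial k i (x, ω) * (z - x) i :=
      Finset.measurable_fun_sum _ fun i _ =>
        ((sys.measurable_ratePartial k i).comp measurable_prodMk_left).mul_const _
    refine h3.aestronglyMeasurable.congr ?_
    filter_upwards [hreg.ae_estimate_ne_zero hx] with ω hω
    rw [PiLp.inner_apply]
    refine Finset.sum_congr rfl fun i _ => ?_
    rw [← sys.gradient_apply_eq_ratePartial hx hω]
    simp [mul_comm]
  have hi : ∀ z ∈ sys.ctrlSet, Integrable
      (fun ω => inner ℝ (gradient (fun z => sys.rate k z ω) x) (z - x)) sys.stateLaw := fun z hz =>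
    memLp_one_iff_integrable.1 (MemLp.mono_exponent
      ⟨hm z hz, (hreg.integral_fderiv_rate hP hC k hx hz).1.trans_lt ENNReal.coe_lt_top⟩ one_le_two)
  constructor
  · rw [eLpNorm_congr_ae hae]
    have h3 := eLpNorm_const_smul (2 / ε)
      (fun ω => inner ℝ (gradient (fun z => sys.rate k z ω) x) (y - x) -
        inner ℝ (gradient (fun z => sys.rate k z ω) x) (x₀ - x)) 2 sys.stateLaw
    simp only [Pi.smul_def, smul_eq_mul] at h3
    rw [h3, enorm_eq_nnnorm, ENNReal.coe_mul, ENNReal.coe_add]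
    gcongr
    refine (eLpNorm_sub_le (hm y hy') (hm x₀ hx₀') one_le_two).trans (add_le_add ?_ ?_)
    · exact h1.trans (ENNReal.coe_le_coe.2 (mul_le_mul_right (hdiam y hy') _))
    · exact h2.trans (ENNReal.coe_le_coe.2 (mul_le_mul_right (hdiam x₀ hx₀') _))
  · rw [integral_congr_ae hae, integral_const_mul, integral_sub (hi y hy') (hi x₀ hx₀'), h1', h2',
      ← hcoord]

end System

end

end RCSHP

/-! ### First order expansions and uniform constants of the problem -/

namespace RCSHP

noncomputable section

/-! ### First order expansions -/

section Taylor

variable {E : Type*} [NormedAddCommGroup E] [InnerProductSpace ℝ E] [CompleteSpace E]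

/-- First order expansion of a function with Lipschitz continuous gradient on a convex set. -/
lemma abs_sub_inner_gradientWithin_le {f : E → ℝ} {s : Set E} {C : ℝ≥0} (hs : Convex ℝ s)
    (hf : DifferentiableOn ℝ f s) (hL : LipschitzOnWith C (gradientWithin f s) s) {x y : E}
    (hx : x ∈ s) (hy : y ∈ s) :
    |f y - f x - inner ℝ (gradientWithin f s x) (y - x)| ≤ C * ‖y - x‖ ^ 2 := by
  have hseg : segment ℝ x y ⊆ s := hs.segment_subset hx hy
  have h := (convex_segment x y).norm_image_sub_le_of_norm_hasFDerivWithin_le'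
    (f := f) (f' := fun z => fderivWithin ℝ f s z) (φ := fderivWithin ℝ f s x)
    (C := C * ‖y - x‖)
    (fun z hz => ((hf z (hseg hz)).hasFDerivWithinAt).mono hseg) (fun z hz => ?_)
    (left_mem_segment ℝ x y) (right_mem_segment ℝ x y)
  · rw [inner_gradientWithin_left]
    rw [Real.norm_eq_abs] at h
    linarith [h, sq ‖y - x‖, mul_assoc (C : ℝ) ‖y - x‖ ‖y - x‖]
  · rw [← toDual_gradientWithin, ← toDual_gradientWithin, ← map_sub, LinearIsometryEquiv.norm_map]
    refine (hL.norm_sub_le (hseg hz) hx).trans ?_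
    gcongr
    exact norm_sub_le_of_mem_segment hz

/-- By concavity every forward difference quotient from `x` towards `y` is at least `f y - f x`; the
limit of these quotients is the one-sided derivative, so boundary points are allowed. -/
lemma concaveOn_sub_le_inner_gradientWithin {f : E → ℝ} {s : Set E} (hf : ConcaveOn ℝ s f)
    {x y : E} (hd : DifferentiableWithinAt ℝ f s x) (hx : x ∈ s) (hy : y ∈ s) :
    f y - f x ≤ inner ℝ (gradientWithin f s x) (y - x) := by
  have hmem : ∀ n : ℕ, ((n : ℝ) + 1)⁻¹ ∈ Set.Icc (0 : ℝ) 1 := fun n =>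
    ⟨by positivity, inv_le_one_of_one_le₀ (by linarith [(Nat.cast_nonneg n : (0 : ℝ) ≤ n)])⟩
  have ht := System.tendsto_diffQuot hd.hasFDerivWithinAt (d := y - x)
    fun n => hf.1.add_smul_sub_mem hx hy (hmem n)
  rw [inner_gradientWithin_left]
  refine ge_of_tendsto' ht fun n => ?_
  set t : ℝ := ((n : ℝ) + 1)⁻¹ with ht'
  have hn : (0 : ℝ) < (n : ℝ) + 1 := by positivity
  have h1 := hf.2 hx hy (sub_nonneg.2 (hmem n).2) (hmem n).1 (sub_add_cancel 1 t)
  have h2 : (1 - t) • x + t • y = x + t • (y - x) := by module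
  rw [h2] at h1
  simp only [smul_eq_mul] at h1
  have h3 : ((n : ℝ) + 1) * t = 1 := mul_inv_cancel₀ hn.ne'
  calc f y - f x = ((n : ℝ) + 1) * t * (f y - f x) := by rw [h3, one_mul]
    _ = ((n : ℝ) + 1) * (t * (f y - f x)) := by ring
    _ ≤ _ := by gcongr; linarith

end Taylor

/-! ### The time-sharing simplex and the nonnegative orthant -/

section Simplex

variable {L K : ℕ}

lemma convex_shareSet : Convex ℝ (shareSet L) := by
  intro x hx y hy a b ha hb hab
  refine ⟨fun l => ⟨?_, ?_⟩, ?_⟩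
  · have h1 := (hx.1 l).1
    have h2 := (hy.1 l).1
    change 0 ≤ a * x l + b * y l
    positivity
  · change a * x l + b * y l ≤ 1
    calc _ ≤ a * 1 + b * 1 := by
          gcongr
          exacts [(hx.1 l).2, (hy.1 l).2]
      _ = _ := by rw [← add_mul, hab, one_mul]
  · change ∑ l, (a * x l + b * y l) = 1
    rw [Finset.sum_add_distrib, ← Finset.mul_sum, ← Finset.mul_sum, hx.2, hy.2]
    linarith

lemma norm_le_one_of_mem_shareSet {q : EuclideanSpace ℝ (Fin L)} (hq : q ∈ shareSet L) :
    ‖q‖ ≤ 1 := by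
  rw [EuclideanSpace.norm_eq, Real.sqrt_le_one, ← hq.2]
  refine Finset.sum_le_sum fun l _ => ?_
  rw [Real.norm_eq_abs, sq_abs]
  nlinarith [(hq.1 l).1, (hq.1 l).2]

lemma isCompact_shareSet : IsCompact (shareSet L) := by
  refine Metric.isCompact_of_isClosed_isBounded ?_
    (isBounded_iff_forall_norm_le.2 ⟨1, fun q hq => norm_le_one_of_mem_shareSet hq⟩)
  simp only [shareSet, Set.ofPred_and, Set.ofPred_forall]
  refine (isClosed_iInter fun l => isClosed_Icc.preimage ?_).inter
    (isClosed_eq (continuous_finsetSum _ fun l _ => ?_) continuous_const) <;> fun_prop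

lemma convex_orthant : Convex ℝ (orthant K) := by
  intro x hx y hy a b ha hb _ k
  have h1 := hx k
  have h2 := hy k
  change 0 ≤ a * x k + b * y k
  positivity

lemma isClosed_orthant : IsClosed (orthant K) := by
  simp only [orthant, Set.ofPred_forall]
  exact isClosed_iInter fun k => isClosed_le continuous_const (by fun_prop)

lemma abs_apply_le_norm {ι : Type*} [Fintype ι] (v : EuclideanSpace ℝ ι) (i : ι) : |v i| ≤ ‖v‖ :=
  PiLp.norm_apply_le v i

lemma norm_le_sum_abs {ι : Type*} [Fintype ι] (v : EuclideanSpace ℝ ι) : ‖v‖ ≤ ∑ i, |v i| := by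
  rw [EuclideanSpace.norm_eq, Real.sqrt_le_left (by positivity)]
  simp only [Real.norm_eq_abs]
  exact Finset.sum_sq_le_sq_sum_of_nonneg fun i _ => abs_nonneg _

/-! ### The rate approximation -/

/-- A rate table as a Euclidean vector. -/
def tableVec (r : Fin K → Fin L → ℝ) : EuclideanSpace ℝ (Fin K × Fin L) :=
  WithLp.toLp 2 fun p => r p.1 p.2

lemma norm_tableVec_sq (r : Fin K → Fin L → ℝ) : ‖tableVec r‖ ^ 2 = ∑ k, ∑ l, r k l ^ 2 := by
  rw [EuclideanSpace.norm_sq_eq, Fintype.sum_prod_type]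
  simp [tableVec]

lemma tableVec_sub (r r' : Fin K → Fin L → ℝ) :
    tableVec (r - r') = tableVec r - tableVec r' := rfl

lemma norm_tableVec_le {r : Fin K → Fin L → ℝ} {C : ℝ} (h : ∀ k l, |r k l| ≤ C) :
    ‖tableVec r‖ ≤ K * L * C := by
  refine (norm_le_sum_abs _).trans ((Finset.sum_le_sum fun p _ => h p.1 p.2).trans ?_)
  simp

/-- Cauchy–Schwarz for each user, summed over the users. -/
lemma norm_approxRate_le (r : Fin K → Fin L → ℝ) (q : EuclideanSpace ℝ (Fin L)) :
    ‖approxRate r q‖ ≤ ‖tableVec r‖ * ‖q‖ := by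
  refine abs_le_of_sq_le_sq' ?_ (by positivity) |>.2
  rw [mul_pow, norm_tableVec_sq, EuclideanSpace.norm_sq_eq, EuclideanSpace.norm_sq_eq,
    Finset.sum_mul]
  refine Finset.sum_le_sum fun k _ => ?_
  simp only [Real.norm_eq_abs, sq_abs, approxRate]
  rw [mul_comm]
  exact Finset.sum_mul_sq_le_sq_mul_sq _ _ _

lemma approxRate_sub_left (r r' : Fin K → Fin L → ℝ) (q : EuclideanSpace ℝ (Fin L)) :
    approxRate (r - r') q = approxRate r q - approxRate r' q := by
  ext k
  simp [approxRate, mul_sub]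

lemma approxRate_sub_right (r : Fin K → Fin L → ℝ) (q q' : EuclideanSpace ℝ (Fin L)) :
    approxRate r (q - q') = approxRate r q - approxRate r q' := by
  ext k
  simp [approxRate, sub_mul]

lemma approxRate_mem_orthant {r : Fin K → Fin L → ℝ} (hr : ∀ k l, 0 ≤ r k l)
    {q : EuclideanSpace ℝ (Fin L)} (hq : ∀ l, 0 ≤ q l) : approxRate r q ∈ orthant K :=
  fun k => (Finset.sum_nonneg fun l _ => mul_nonneg (hq l) (hr k l) : 0 ≤ ∑ l, q l * r k l)

end Simplex

namespace System

variable {K M S Tp L : ℕ} (sys : System K M S Tp)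

/-- Gradient of the utility on the nonnegative rate vectors. -/
def _root_.RCSHP.utilGrad (U : EuclideanSpace ℝ (Fin K) → ℝ) (r : EuclideanSpace ℝ (Fin K)) :
    EuclideanSpace ℝ (Fin K) :=
  gradientWithin U (orthant K) r

/-- Table of the conditional average rates. -/
def meanTable (Γ : Fin L → Ctrl K M S) : Fin K → Fin L → ℝ := fun k l => sys.meanRate k (Γ l)

lemma avgRate_eq (Γ : Fin L → Ctrl K M S) (q : EuclideanSpace ℝ (Fin L)) :
    sys.avgRate Γ q = approxRate (sys.meanTable Γ) q := rfl

/-- Feasible pairs of control variables and time-sharing vectors. -/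
def Feasible (Γ : Fin L → Ctrl K M S) (q : EuclideanSpace ℝ (Fin L)) : Prop :=
  (∀ l, Γ l ∈ sys.ctrlSet) ∧ q ∈ shareSet L

/-- The `Γ(l)`-block of the gradient of the objective. -/
def ctrlGrad (U : EuclideanSpace ℝ (Fin K) → ℝ) (Γ : Fin L → Ctrl K M S)
    (q : EuclideanSpace ℝ (Fin L)) (l : Fin L) : Ctrl K M S :=
  ∑ k, (q l * utilGrad U (sys.avgRate Γ q) k) • sys.meanGrad k (Γ l)

/-- Uniform bounds and Lipschitz constants for the data of the problem. -/
structure Bounds (U : EuclideanSpace ℝ (Fin K) → ℝ) (L : ℕ) (c : ℝ) : Prop where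
  one_le : 1 ≤ c
  norm_sub_le : ∀ x ∈ sys.ctrlSet, ∀ y ∈ sys.ctrlSet, ‖x - y‖ ≤ c
  norm_table_le : ∀ Γ : Fin L → Ctrl K M S, (∀ l, Γ l ∈ sys.ctrlSet) →
    ‖tableVec (sys.meanTable Γ)‖ ≤ c
  meanRate_lip : ∀ k, ∀ x ∈ sys.ctrlSet, ∀ y ∈ sys.ctrlSet,
    |sys.meanRate k y - sys.meanRate k x| ≤ c * ‖y - x‖
  meanRate_taylor : ∀ k, ∀ x ∈ sys.ctrlSet, ∀ y ∈ sys.ctrlSet,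
    |sys.meanRate k y - sys.meanRate k x - inner ℝ (sys.meanGrad k x) (y - x)| ≤ c * ‖y - x‖ ^ 2
  norm_meanGrad_le : ∀ k, ∀ x ∈ sys.ctrlSet, ‖sys.meanGrad k x‖ ≤ c
  meanGrad_lip : ∀ k, ∀ x ∈ sys.ctrlSet, ∀ y ∈ sys.ctrlSet,
    ‖sys.meanGrad k y - sys.meanGrad k x‖ ≤ c * ‖y - x‖
  utilGrad_lip : ∀ r ∈ orthant K, ∀ r' ∈ orthant K,
    ‖utilGrad U r' - utilGrad U r‖ ≤ c * ‖r' - r‖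
  util_taylor : ∀ r ∈ orthant K, ∀ r' ∈ orthant K,
    |U r' - U r - inner ℝ (utilGrad U r) (r' - r)| ≤ c * ‖r' - r‖ ^ 2
  util_concave : ∀ r ∈ orthant K, ∀ r' ∈ orthant K, U r' - U r ≤ inner ℝ (utilGrad U r) (r' - r)
  norm_utilGrad_le : ∀ (Γ : Fin L → Ctrl K M S) (q : EuclideanSpace ℝ (Fin L)),
    sys.Feasible Γ q → ‖utilGrad U (sys.avgRate Γ q)‖ ≤ c
  abs_objective_le : ∀ (Γ : Fin L → Ctrl K M S) (q : EuclideanSpace ℝ (Fin L)),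
    sys.Feasible Γ q → |sys.objective U (Γ, q)| ≤ c

variable {sys}

lemma meanRate_nonneg {x : Ctrl K M S} (hx : x ∈ sys.ctrlSet) (k : Fin K) :
    0 ≤ sys.meanRate k x :=
  integral_nonneg fun ω => sys.rate_nonneg hx.2.1 ω k

lemma avgRate_mem_orthant {Γ : Fin L → Ctrl K M S} (hΓ : ∀ l, Γ l ∈ sys.ctrlSet)
    {q : EuclideanSpace ℝ (Fin L)} (hq : ∀ l, 0 ≤ q l) : sys.avgRate Γ q ∈ orthant K :=
  approxRate_mem_orthant (fun k l => meanRate_nonneg (hΓ l) k) hq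

/-- Mean rates and their gradients are continuous on the compact control set. The feasible average
rates are therefore bounded, and the Lipschitz gradient of `U` then bounds `∇U` and `U` on them by
comparison with the zero rate vector. -/
lemma exists_bounds (hreg : sys.RegularRates) {U : EuclideanSpace ℝ (Fin K) → ℝ}
    (hU : IsUtility U) (L : ℕ) : ∃ c, sys.Bounds U L c := by
  obtain ⟨D, hD⟩ := sys.isCompact_ctrlSet.isBounded.exists_norm_le
  obtain ⟨G, hG⟩ := hreg.gradient_lipschitz
  obtain ⟨V, hV⟩ := hU.lipschitz_gradient
  have hR : ∀ k, ∃ C, ∀ x ∈ sys.ctrlSet, |sys.meanRate k x| ≤ C := fun k =>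
    sys.isCompact_ctrlSet.exists_bound_of_continuousOn (hreg.meanRate_differentiable k).continuousOn
  choose Rb hRb using hR
  have hg : ∀ k, ∃ C, ∀ x ∈ sys.ctrlSet, ‖sys.meanGrad k x‖ ≤ C := fun k =>
    sys.isCompact_ctrlSet.exists_bound_of_continuousOn (hG k).continuousOn
  choose gb hgb using hg
  set R : ℝ := ∑ k, |Rb k| with hRdef
  set g : ℝ := ∑ k, |gb k| with hgdef
  have hR : ∀ k, ∀ x ∈ sys.ctrlSet, |sys.meanRate k x| ≤ R := fun k x hx =>
    (hRb k x hx).trans ((le_abs_self _).trans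
      (Finset.single_le_sum (f := fun k => |Rb k|) (fun _ _ => abs_nonneg _) (Finset.mem_univ k)))
  have hg : ∀ k, ∀ x ∈ sys.ctrlSet, ‖sys.meanGrad k x‖ ≤ g := fun k x hx =>
    (hgb k x hx).trans ((le_abs_self _).trans
      (Finset.single_le_sum (f := fun k => |gb k|) (fun _ _ => abs_nonneg _) (Finset.mem_univ k)))
  have hR0 : 0 ≤ R := Finset.sum_nonneg fun _ _ => abs_nonneg _
  have hg0 : 0 ≤ g := Finset.sum_nonneg fun _ _ => abs_nonneg _
  have hdiam : ∀ x ∈ sys.ctrlSet, ∀ y ∈ sys.ctrlSet, ‖x - y‖ ≤ 2 * |D| := fun x hx y hy => by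
    have h1 := (hD x hx).trans (le_abs_self D)
    have h2 := (hD y hy).trans (le_abs_self D)
    linarith [norm_sub_le x y]
  have htay : ∀ k, ∀ x ∈ sys.ctrlSet, ∀ y ∈ sys.ctrlSet,
      |sys.meanRate k y - sys.meanRate k x - inner ℝ (sys.meanGrad k x) (y - x)| ≤
        G * ‖y - x‖ ^ 2 := fun k x hx y hy =>
    abs_sub_inner_gradientWithin_le sys.convex_ctrlSet (hreg.meanRate_differentiable k) (hG k) hx hy
  have hlip : ∀ k, ∀ x ∈ sys.ctrlSet, ∀ y ∈ sys.ctrlSet,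
      |sys.meanRate k y - sys.meanRate k x| ≤ (g + G * (2 * |D|)) * ‖y - x‖ := by
    intro k x hx y hy
    have h1 := htay k x hx y hy
    have h2 := (abs_real_inner_le_norm (sys.meanGrad k x) (y - x)).trans
      (mul_le_mul_of_nonneg_right (hg k x hx) (norm_nonneg _))
    -- The quadratic Taylor remainder becomes linear because one factor is at most the diameter of
    -- the control set.
    have h3 : (G : ℝ) * ‖y - x‖ ^ 2 ≤ G * (2 * |D|) * ‖y - x‖ := by
      rw [sq, ← mul_assoc]
      gcongr
      exact hdiam y hy x hx
    have h4 := abs_add_le (sys.meanRate k y - sys.meanRate k x - inner ℝ (sys.meanGrad k x) (y - x))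
      (inner ℝ (sys.meanGrad k x) (y - x))
    rw [sub_add_cancel] at h4
    linarith
  have htab : ∀ Γ : Fin L → Ctrl K M S, (∀ l, Γ l ∈ sys.ctrlSet) →
      ‖tableVec (sys.meanTable Γ)‖ ≤ K * L * R := fun Γ hΓ =>
    norm_tableVec_le fun k l => hR k _ (hΓ l)
  have h0 : (0 : EuclideanSpace ℝ (Fin K)) ∈ orthant K := fun k => le_rfl
  have hUlip : ∀ r ∈ orthant K, ∀ r' ∈ orthant K,
      ‖utilGrad U r' - utilGrad U r‖ ≤ V * ‖r' - r‖ := fun r hr r' hr' => hV.norm_sub_le hr' hr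
  have hUtay : ∀ r ∈ orthant K, ∀ r' ∈ orthant K,
      |U r' - U r - inner ℝ (utilGrad U r) (r' - r)| ≤ V * ‖r' - r‖ ^ 2 := fun r hr r' hr' =>
    abs_sub_inner_gradientWithin_le convex_orthant hU.differentiableOn hV hr hr'
  have havg : ∀ (Γ : Fin L → Ctrl K M S) (q : EuclideanSpace ℝ (Fin L)), sys.Feasible Γ q →
      ‖sys.avgRate Γ q‖ ≤ K * L * R := by
    intro Γ q h
    rw [avgRate_eq]
    refine (norm_approxRate_le _ _).trans ?_
    exact (mul_le_mul (htab Γ h.1) (norm_le_one_of_mem_shareSet h.2) (norm_nonneg _)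
      (by positivity)).trans (mul_one _).le
  have hgrad : ∀ (Γ : Fin L → Ctrl K M S) (q : EuclideanSpace ℝ (Fin L)), sys.Feasible Γ q →
      ‖utilGrad U (sys.avgRate Γ q)‖ ≤ ‖utilGrad U 0‖ + V * (K * L * R) := by
    intro Γ q h
    have h1 := hUlip 0 h0 _ (avgRate_mem_orthant h.1 fun l => (h.2.1 l).1)
    rw [sub_zero] at h1
    have h2 := norm_add_le (utilGrad U (sys.avgRate Γ q) - utilGrad U 0) (utilGrad U 0)
    rw [sub_add_cancel] at h2
    have h3 : (V : ℝ) * ‖sys.avgRate Γ q‖ ≤ V * (K * L * R) := by gcongr; exact havg Γ q h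
    linarith
  have hobj : ∀ (Γ : Fin L → Ctrl K M S) (q : EuclideanSpace ℝ (Fin L)), sys.Feasible Γ q →
      |sys.objective U (Γ, q)| ≤
        |U 0| + ‖utilGrad U 0‖ * (K * L * R) + V * (K * L * R) ^ 2 := by
    intro Γ q h
    have h1 := hUtay 0 h0 _ (avgRate_mem_orthant h.1 fun l => (h.2.1 l).1)
    rw [sub_zero] at h1
    have h2 := abs_real_inner_le_norm (utilGrad U 0) (sys.avgRate Γ q)
    have h3 : (V : ℝ) * ‖sys.avgRate Γ q‖ ^ 2 ≤ V * (K * L * R) ^ 2 := by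
      gcongr; exact havg Γ q h
    have h4 : ‖utilGrad U 0‖ * ‖sys.avgRate Γ q‖ ≤ ‖utilGrad U 0‖ * (K * L * R) := by
      gcongr; exact havg Γ q h
    change |U (sys.avgRate Γ q)| ≤ _
    have h5 := abs_add_three (U (sys.avgRate Γ q) - U 0 - inner ℝ (utilGrad U 0) (sys.avgRate Γ q))
      (U 0) (inner ℝ (utilGrad U 0) (sys.avgRate Γ q))
    have h6 : U (sys.avgRate Γ q) - U 0 - inner ℝ (utilGrad U 0) (sys.avgRate Γ q) + U 0 +
      inner ℝ (utilGrad U 0) (sys.avgRate Γ q) = U (sys.avgRate Γ q) := by ring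
    rw [h6] at h5
    linarith
  have hKLR : 0 ≤ K * L * R := by positivity
  set u := ‖utilGrad U 0‖
  have hu : 0 ≤ u := norm_nonneg _
  -- One constant serves for everything: the sum of all bounds, each of which is nonnegative, plus
  -- `1`.
  obtain ⟨c, hc⟩ : ∃ c, c = 1 + 2 * |D| + K * L * R + (g + G * (2 * |D|)) + G + V +
    (u + V * (K * L * R)) + (|U 0| + u * (K * L * R) + V * (K * L * R) ^ 2) := ⟨_, rfl⟩
  have e1 : 0 ≤ 2 * |D| := by positivity
  have e2 : 0 ≤ g + G * (2 * |D|) := by positivity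
  have e3 : (0 : ℝ) ≤ G := G.2
  have e4 : (0 : ℝ) ≤ V := V.2
  have e5 : 0 ≤ u + V * (K * L * R) := by positivity
  have e6 : 0 ≤ |U 0| + u * (K * L * R) + V * (K * L * R) ^ 2 := by positivity
  have e7 : 0 ≤ G * (2 * |D|) := by positivity
  refine ⟨c, ⟨by linarith, fun x hx y hy => (hdiam x hx y hy).trans (by linarith),
    fun Γ hΓ => (htab Γ hΓ).trans (by linarith),
    fun k x hx y hy => (hlip k x hx y hy).trans ?_, fun k x hx y hy => (htay k x hx y hy).trans ?_,
    fun k x hx => (hg k x hx).trans (by linarith),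
    fun k x hx y hy => ((hG k).norm_sub_le hy hx).trans ?_,
    fun r hr r' hr' => (hUlip r hr r' hr').trans ?_, fun r hr r' hr' => (hUtay r hr r' hr').trans ?_,
    fun r hr r' hr' => concaveOn_sub_le_inner_gradientWithin hU.concaveOn (hU.differentiableOn r hr) hr hr',
    fun Γ q h => (hgrad Γ q h).trans (by linarith), fun Γ q h => (hobj Γ q h).trans (by linarith)⟩⟩
  all_goals gcongr; linarith

end System

end

end RCSHP

/-! ### Lipschitz estimates and the one-step ascent inequality -/

namespace RCSHP

noncomputable section

namespace System

variable {K M S Tp L : ℕ} {sys : System K M S Tp} {U : EuclideanSpace ℝ (Fin K) → ℝ} {c : ℝ}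

namespace Bounds

lemma nonneg (hc : sys.Bounds U L c) : 0 ≤ c := zero_le_one.trans hc.one_le

lemma norm_meanTable_sub_le (hc : sys.Bounds U L c) {Γ Γ' : Fin L → Ctrl K M S}
    (hΓ : ∀ l, Γ l ∈ sys.ctrlSet) (hΓ' : ∀ l, Γ' l ∈ sys.ctrlSet) {δ : ℝ}
    (hd : ∀ l, ‖Γ' l - Γ l‖ ≤ δ) :
    ‖tableVec (sys.meanTable Γ') - tableVec (sys.meanTable Γ)‖ ≤ K * L * (c * δ) := by
  rw [← tableVec_sub]
  refine norm_tableVec_le fun k l => ?_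
  exact (hc.meanRate_lip k _ (hΓ l) _ (hΓ' l)).trans (mul_le_mul_of_nonneg_left (hd l) hc.nonneg)

/-- Lipschitz continuity of the average rate vector. -/
lemma norm_avgRate_sub_le (hc : sys.Bounds U L c) {Γ Γ' : Fin L → Ctrl K M S}
    {q q' : EuclideanSpace ℝ (Fin L)} (h : sys.Feasible Γ q) (h' : sys.Feasible Γ' q') {δ : ℝ}
    (hd : ∀ l, ‖Γ' l - Γ l‖ ≤ δ) (hq : ‖q' - q‖ ≤ δ) :
    ‖sys.avgRate Γ' q' - sys.avgRate Γ q‖ ≤ (c + K * L * c) * δ := by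
  have hδ : 0 ≤ δ := (norm_nonneg _).trans hq
  have e : sys.avgRate Γ' q' - sys.avgRate Γ q = approxRate (sys.meanTable Γ) (q' - q) +
      approxRate (sys.meanTable Γ' - sys.meanTable Γ) q' := by
    rw [approxRate_sub_left, approxRate_sub_right, avgRate_eq, avgRate_eq]
    abel
  rw [e]
  have h1 : ‖approxRate (sys.meanTable Γ) (q' - q)‖ ≤ c * δ :=
    (norm_approxRate_le _ _).trans
      (mul_le_mul (hc.norm_table_le Γ h.1) hq (norm_nonneg _) hc.nonneg)
  have h2 : ‖approxRate (sys.meanTable Γ' - sys.meanTable Γ) q'‖ ≤ K * L * (c * δ) * 1 := by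
    refine (norm_approxRate_le _ _).trans ?_
    rw [tableVec_sub]
    exact mul_le_mul (hc.norm_meanTable_sub_le h.1 h'.1 hd) (norm_le_one_of_mem_shareSet h'.2)
      (norm_nonneg _) (by have := hc.nonneg; positivity)
  linarith [norm_add_le (approxRate (sys.meanTable Γ) (q' - q))
    (approxRate (sys.meanTable Γ' - sys.meanTable Γ) q')]

/-- Lipschitz continuity of the blocks of the gradient of the objective. -/
lemma norm_ctrlGrad_sub_le (hc : sys.Bounds U L c) {Γ Γ' : Fin L → Ctrl K M S}
    {q q' : EuclideanSpace ℝ (Fin L)} (h : sys.Feasible Γ q) (h' : sys.Feasible Γ' q') {δ : ℝ}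
    (hd : ∀ l, ‖Γ' l - Γ l‖ ≤ δ) (hq : ‖q' - q‖ ≤ δ) (l : Fin L) :
    ‖sys.ctrlGrad U Γ' q' l - sys.ctrlGrad U Γ q l‖ ≤
      K * (c * c + c * (c + K * L * c) * c + c * c) * δ := by
  have hδ : 0 ≤ δ := (norm_nonneg _).trans hq
  have hc0 := hc.nonneg
  set u := utilGrad U (sys.avgRate Γ q) with hu
  set u' := utilGrad U (sys.avgRate Γ' q') with hu'
  have hudiff : ‖u' - u‖ ≤ c * (c + K * L * c) * δ := by
    refine (hc.utilGrad_lip _ (avgRate_mem_orthant h.1 fun l => (h.2.1 l).1) _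
      (avgRate_mem_orthant h'.1 fun l => (h'.2.1 l).1)).trans ?_
    rw [mul_assoc]
    gcongr
    exact hc.norm_avgRate_sub_le h h' hd hq
  have hun : ‖u‖ ≤ c := hc.norm_utilGrad_le Γ q h
  have hun' : ‖u'‖ ≤ c := hc.norm_utilGrad_le Γ' q' h'
  have hql : |q' l - q l| ≤ δ := (abs_apply_le_norm (q' - q) l).trans hq
  have hq1 : |q l| ≤ 1 := abs_le.2 ⟨by linarith [(h.2.1 l).1], (h.2.1 l).2⟩
  have hq1' : |q' l| ≤ 1 := abs_le.2 ⟨by linarith [(h'.2.1 l).1], (h'.2.1 l).2⟩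
  have hterm : ∀ k, ‖(q' l * u' k) • sys.meanGrad k (Γ' l) - (q l * u k) • sys.meanGrad k (Γ l)‖ ≤
      (c * c + c * (c + K * L * c) * c + c * c) * δ := by
    intro k
    -- The three factors of the product are changed one at a time.
    have e : (q' l * u' k) • sys.meanGrad k (Γ' l) - (q l * u k) • sys.meanGrad k (Γ l) =
        ((q' l - q l) * u' k) • sys.meanGrad k (Γ' l) +
        (q l * (u' - u) k) • sys.meanGrad k (Γ' l) +
        (q l * u k) • (sys.meanGrad k (Γ' l) - sys.meanGrad k (Γ l)) := by
      rw [PiLp.sub_apply]; module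
    rw [e]
    refine (norm_add₃_le).trans ?_
    simp only [norm_smul, norm_mul, Real.norm_eq_abs]
    have a1 : |q' l - q l| * |u' k| * ‖sys.meanGrad k (Γ' l)‖ ≤ δ * c * c := by
      gcongr
      exacts [(abs_apply_le_norm u' k).trans hun', hc.norm_meanGrad_le k _ (h'.1 l)]
    have a2 : |q l| * |(u' - u) k| * ‖sys.meanGrad k (Γ' l)‖ ≤
        1 * (c * (c + K * L * c) * δ) * c := by
      gcongr
      exacts [(abs_apply_le_norm (u' - u) k).trans hudiff, hc.norm_meanGrad_le k _ (h'.1 l)]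
    have a3 : |q l| * |u k| * ‖sys.meanGrad k (Γ' l) - sys.meanGrad k (Γ l)‖ ≤
        1 * c * (c * δ) := by
      gcongr
      · exact (abs_apply_le_norm u k).trans hun
      · exact (hc.meanGrad_lip k _ (h.1 l) _ (h'.1 l)).trans (by gcongr; exact hd l)
    linarith
  rw [ctrlGrad, ctrlGrad, ← Finset.sum_sub_distrib]
  refine (norm_sum_le _ _).trans ((Finset.sum_le_sum fun k _ => hterm k).trans ?_)
  simp [mul_assoc]

/-- First order lower bound for the objective along a feasible direction. -/
lemma objective_step_ge (hc : sys.Bounds U L c) {Γ Γ' Γb : Fin L → Ctrl K M S}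
    {q q' qb : EuclideanSpace ℝ (Fin L)} {γ : ℝ} (h0 : 0 ≤ γ)
    (h : sys.Feasible Γ q) (h' : sys.Feasible Γ' q') (hb : sys.Feasible Γb qb)
    (hΓ' : ∀ l, Γ' l = (1 - γ) • Γ l + γ • Γb l) (hq' : q' = (1 - γ) • q + γ • qb) :
    γ * (∑ l, inner ℝ (sys.ctrlGrad U Γ q l) (Γb l - Γ l) +
        inner ℝ (utilGrad U (sys.avgRate Γ q)) (approxRate (sys.meanTable Γ) (qb - q))) -
      (c * (K * (L * (2 * c * (c + 2) ^ 2))) + c * ((c + K * L * c) * (c + 2)) ^ 2) * γ ^ 2 ≤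
    sys.objective U (Γ', q') - sys.objective U (Γ, q) := by
  have hc0 := hc.nonneg
  set u := utilGrad U (sys.avgRate Γ q) with hu
  have hdl : ∀ l, ‖Γb l - Γ l‖ ≤ c + 2 := fun l =>
    (hc.norm_sub_le _ (hb.1 l) _ (h.1 l)).trans (by linarith)
  have hdq : ‖qb - q‖ ≤ c + 2 := by
    linarith [_root_.norm_sub_le qb q, norm_le_one_of_mem_shareSet h.2, norm_le_one_of_mem_shareSet hb.2]
  have eΓ : ∀ l, Γ' l - Γ l = γ • (Γb l - Γ l) := fun l => by rw [hΓ' l]; module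
  have eq : q' - q = γ • (qb - q) := by rw [hq']; module
  have hdl' : ∀ l, ‖Γ' l - Γ l‖ ≤ γ * (c + 2) := fun l => by
    rw [eΓ, norm_smul, Real.norm_of_nonneg h0]
    exact mul_le_mul_of_nonneg_left (hdl l) h0
  have hdq' : ‖q' - q‖ ≤ γ * (c + 2) := by
    rw [eq, norm_smul, Real.norm_of_nonneg h0]
    exact mul_le_mul_of_nonneg_left hdq h0
  -- linear part of the increment of the average rates
  set lin : EuclideanSpace ℝ (Fin K) := approxRate (sys.meanTable Γ) (qb - q) +
    WithLp.toLp 2 (fun k => ∑ l, q l * inner ℝ (sys.meanGrad k (Γ l)) (Γb l - Γ l)) with hlin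
  have hinner : inner ℝ u lin = ∑ l, inner ℝ (sys.ctrlGrad U Γ q l) (Γb l - Γ l) +
      inner ℝ u (approxRate (sys.meanTable Γ) (qb - q)) := by
    rw [hlin, inner_add_right, add_comm]
    congr 1
    simp only [ctrlGrad, sum_inner, PiLp.inner_apply, inner_smul_left, RCLike.inner_apply,
      conj_trivial]
    rw [Finset.sum_comm]
    simp only [Finset.sum_mul, Finset.mul_sum]
    refine Finset.sum_congr rfl fun k _ => Finset.sum_congr rfl fun l _ => ?_
    refine Finset.sum_congr rfl fun i _ => ?_
    ring
  -- The remainder has two sources, both of order `γ²`: the Taylor remainder of the mean rates, and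
  -- the product of the change of `q` with the change of the mean rates.
  have herr : ‖sys.avgRate Γ' q' - sys.avgRate Γ q - γ • lin‖ ≤
      K * (L * (2 * c * (c + 2) ^ 2)) * γ ^ 2 := by
    refine (norm_le_sum_abs _).trans ?_
    have hk : ∀ k, |(sys.avgRate Γ' q' - sys.avgRate Γ q - γ • lin) k| ≤
        L * (2 * c * (c + 2) ^ 2) * γ ^ 2 := by
      intro k
      have e : (sys.avgRate Γ' q' - sys.avgRate Γ q - γ • lin) k =
          ∑ l, (q l * (sys.meanRate k (Γ' l) - sys.meanRate k (Γ l) -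
            inner ℝ (sys.meanGrad k (Γ l)) (Γ' l - Γ l)) +
            (q' - q) l * (sys.meanRate k (Γ' l) - sys.meanRate k (Γ l))) := by
        have e1 : (sys.avgRate Γ' q' - sys.avgRate Γ q - γ • lin) k =
            ∑ l, q' l * sys.meanRate k (Γ' l) - ∑ l, q l * sys.meanRate k (Γ l) -
            γ * (∑ l, (qb - q) l * sys.meanRate k (Γ l) +
              ∑ l, q l * inner ℝ (sys.meanGrad k (Γ l)) (Γb l - Γ l)) := rfl
        rw [e1, ← Finset.sum_add_distrib, Finset.mul_sum, ← Finset.sum_sub_distrib,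
          ← Finset.sum_sub_distrib]
        refine Finset.sum_congr rfl fun l _ => ?_
        have e2 : q' l = q l + γ * (qb - q) l := by
          have := congrArg (fun v : EuclideanSpace ℝ (Fin L) => v l) eq
          simp only [PiLp.sub_apply, PiLp.smul_apply, smul_eq_mul] at this ⊢
          linarith
        have e3 : (q' - q) l = γ * (qb - q) l := by
          rw [eq]; rfl
        rw [e3, e2, eΓ, inner_smul_right]
        ring
      rw [e]
      have hl : ∀ l, |q l * (sys.meanRate k (Γ' l) - sys.meanRate k (Γ l) -
            inner ℝ (sys.meanGrad k (Γ l)) (Γ' l - Γ l)) +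
            (q' - q) l * (sys.meanRate k (Γ' l) - sys.meanRate k (Γ l))| ≤
          2 * c * (c + 2) ^ 2 * γ ^ 2 := by
        intro l
        have hq1 : |q l| ≤ 1 := abs_le.2 ⟨by linarith [(h.2.1 l).1], (h.2.1 l).2⟩
        refine (abs_add_le _ _).trans ?_
        rw [abs_mul, abs_mul]
        have b1 : |q l| * |sys.meanRate k (Γ' l) - sys.meanRate k (Γ l) -
            inner ℝ (sys.meanGrad k (Γ l)) (Γ' l - Γ l)| ≤ 1 * (c * (γ * (c + 2)) ^ 2) := by
          gcongr
          refine (hc.meanRate_taylor k _ (h.1 l) _ (h'.1 l)).trans ?_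
          gcongr
          exact hdl' l
        have b2 : |(q' - q) l| * |sys.meanRate k (Γ' l) - sys.meanRate k (Γ l)| ≤
            γ * (c + 2) * (c * (γ * (c + 2))) := by
          gcongr
          · exact (abs_apply_le_norm (q' - q) l).trans hdq'
          · refine (hc.meanRate_lip k _ (h.1 l) _ (h'.1 l)).trans ?_
            gcongr
            exact hdl' l
        linarith
      refine (Finset.abs_sum_le_sum_abs _ _).trans ((Finset.sum_le_sum fun l _ => hl l).trans ?_)
      simp [mul_assoc]
    refine (Finset.sum_le_sum fun k _ => hk k).trans ?_
    simp [mul_assoc]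
  have hmem := avgRate_mem_orthant h.1 fun l => (h.2.1 l).1
  have hmem' := avgRate_mem_orthant h'.1 fun l => (h'.2.1 l).1
  have htay := (abs_le.1 (hc.util_taylor _ hmem _ hmem')).1
  have hav := hc.norm_avgRate_sub_le h h' hdl' hdq'
  have hun : ‖u‖ ≤ c := hc.norm_utilGrad_le Γ q h
  have hsq : c * ‖sys.avgRate Γ' q' - sys.avgRate Γ q‖ ^ 2 ≤
      c * ((c + K * L * c) * (c + 2)) ^ 2 * γ ^ 2 := by
    have : c * ‖sys.avgRate Γ' q' - sys.avgRate Γ q‖ ^ 2 ≤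
      c * ((c + K * L * c) * (γ * (c + 2))) ^ 2 := by gcongr
    refine this.trans (le_of_eq (by ring))
  have hin : -(c * (K * (L * (2 * c * (c + 2) ^ 2)) * γ ^ 2)) ≤
      inner ℝ u (sys.avgRate Γ' q' - sys.avgRate Γ q - γ • lin) := by
    refine (abs_le.1 ((abs_real_inner_le_norm _ _).trans ?_)).1
    exact mul_le_mul hun herr (norm_nonneg _) hc0
  rw [inner_sub_right, inner_smul_right, hinner] at hin
  change _ ≤ U (sys.avgRate Γ' q') - U (sys.avgRate Γ q)
  linarith

set_option maxHeartbeats 1000000 in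
/-- One iteration increases the objective by a multiple of the squared step direction, up to
the errors of the recursive estimates. -/
lemma exists_ascent (hc : sys.Bounds U L c) {τq τΓ : ℝ} (hτq : 0 < τq) (hτΓ : 0 < τΓ) :
    ∃ κ > 0, ∃ C ≥ 0, ∀ (Γ Γ' Γb : Fin L → Ctrl K M S) (q q' qb : EuclideanSpace ℝ (Fin L))
      (r : Fin K → Fin L → ℝ) (f v : Fin L → Ctrl K M S) (γ : ℝ), 0 ≤ γ → γ ≤ 1 →
      sys.Feasible Γ q → sys.Feasible Γ' q' → sys.Feasible Γb qb → (∀ k l, 0 ≤ r k l) →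
      (∀ l, Γ' l = (1 - γ) • Γ l + γ • Γb l) → q' = (1 - γ) • q + γ • qb →
      (∀ l, IsMaxOn (fun x => inner ℝ (f l) (x - Γ l) - τΓ * ‖x - Γ l‖ ^ 2) sys.ctrlSet (Γb l)) →
      IsMaxOn (fun p => U (approxRate r p) - τq * ‖p - q‖ ^ 2) (shareSet L) qb →
      γ * (κ * (∑ l, ‖Γb l - Γ l‖ ^ 2 + ‖qb - q‖ ^ 2) -
        C * (‖tableVec (r - sys.meanTable Γ')‖ ^ 2 +
          ∑ l, ‖v l - sys.ctrlGrad U Γ' q' l‖ ^ 2 + ∑ l, ‖f l - v l‖)) - C * γ ^ 2 ≤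
      sys.objective U (Γ', q') - sys.objective U (Γ, q) := by
  have hc0 := hc.nonneg
  obtain ⟨B, hB⟩ : ∃ B, B = K * (c * c + c * (c + K * L * c) * c + c * c) := ⟨_, rfl⟩
  obtain ⟨A, hA⟩ : ∃ A, A = K * L * (c * (c + 2)) := ⟨_, rfl⟩
  obtain ⟨T, hT⟩ : ∃ T, T = c * (K * (L * (2 * c * (c + 2) ^ 2))) +
    c * ((c + K * L * c) * (c + 2)) ^ 2 := ⟨_, rfl⟩
  -- Cost of a rate error `e` in the time-sharing block: `2c` from the term quadratic in `e`, where
  -- `‖q̄ - q‖ ≤ 2`, and the fraction from Young's inequality, which charges half of the proximal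
  -- gain for the term linear in `e`.
  obtain ⟨C₁, hC₁⟩ : ∃ C₁, C₁ = 2 * c + (c * (c + 1)) ^ 2 / (2 * τq) := ⟨_, rfl⟩
  have hB0 : 0 ≤ B := by rw [hB]; positivity
  have hA0 : 0 ≤ A := by rw [hA]; positivity
  have hT0 : 0 ≤ T := by rw [hT]; positivity
  have hC₁0 : 0 ≤ C₁ := by rw [hC₁]; positivity
  obtain ⟨C, hC⟩ : ∃ C, C = 2 * C₁ + 1 / (2 * τΓ) + c +
    (T + 2 * C₁ * A ^ 2 + L * (B * (c + 2) * c)) := ⟨_, rfl⟩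
  have hτΓ' : 0 ≤ 1 / (2 * τΓ) := by positivity
  have hLast : 0 ≤ 2 * C₁ * A ^ 2 + L * (B * (c + 2) * c) := by positivity
  refine ⟨min τq τΓ / 2, by positivity, C, by rw [hC]; positivity, ?_⟩
  intro Γ Γ' Γb q q' qb r f v γ h0 h1 h h' hb hr hΓ' hq' hΓmax hqmax
  have hdl : ∀ l, ‖Γb l - Γ l‖ ≤ c := fun l => hc.norm_sub_le _ (hb.1 l) _ (h.1 l)
  have hdq : ‖qb - q‖ ≤ 2 := by
    linarith [_root_.norm_sub_le qb q, norm_le_one_of_mem_shareSet h.2,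
      norm_le_one_of_mem_shareSet hb.2]
  have hdl' : ∀ l, ‖Γ' l - Γ l‖ ≤ γ * (c + 2) := fun l => by
    have : Γ' l - Γ l = γ • (Γb l - Γ l) := by rw [hΓ' l]; module
    rw [this, norm_smul, Real.norm_of_nonneg h0]
    exact mul_le_mul_of_nonneg_left ((hdl l).trans (by linarith)) h0
  have hdq' : ‖q' - q‖ ≤ γ * (c + 2) := by
    have : q' - q = γ • (qb - q) := by rw [hq']; module
    rw [this, norm_smul, Real.norm_of_nonneg h0]
    exact mul_le_mul_of_nonneg_left (hdq.trans (by linarith)) h0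
  -- the control blocks
  have hctrl : ∀ l, τΓ / 2 * ‖Γb l - Γ l‖ ^ 2 - 1 / (2 * τΓ) * ‖v l - sys.ctrlGrad U Γ' q' l‖ ^ 2 -
      c * ‖f l - v l‖ - B * (c + 2) * c * γ ≤ inner ℝ (sys.ctrlGrad U Γ q l) (Γb l - Γ l) := by
    intro l
    set d := Γb l - Γ l with hd
    -- The surrogate maximizer is compared with the current iterate, where the surrogate is zero.
    have a1 : τΓ * ‖d‖ ^ 2 ≤ inner ℝ (f l) d := by
      have := hΓmax l (h.1 l)
      simp only [sub_self, inner_zero_right, norm_zero, Set.mem_ofPred_eq] at this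
      nlinarith
    have a2 : inner ℝ (f l - v l) d ≤ ‖f l - v l‖ * c :=
      (real_inner_le_norm _ _).trans (by gcongr; exact hdl l)
    have a3 : inner ℝ (v l - sys.ctrlGrad U Γ' q' l) d ≤
        τΓ / 2 * ‖d‖ ^ 2 + 1 / (2 * τΓ) * ‖v l - sys.ctrlGrad U Γ' q' l‖ ^ 2 := by
      refine (real_inner_le_norm _ _).trans ?_
      set n := ‖v l - sys.ctrlGrad U Γ' q' l‖
      have : τΓ / 2 * ‖d‖ ^ 2 + 1 / (2 * τΓ) * n ^ 2 - n * ‖d‖ =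
          (τΓ * ‖d‖ - n) ^ 2 / (2 * τΓ) := by field_simp; ring
      have h2 : 0 ≤ (τΓ * ‖d‖ - n) ^ 2 / (2 * τΓ) := by positivity
      linarith
    have a4 : inner ℝ (sys.ctrlGrad U Γ' q' l - sys.ctrlGrad U Γ q l) d ≤
        B * (γ * (c + 2)) * c := by
      refine (real_inner_le_norm _ _).trans ?_
      rw [hB]
      exact mul_le_mul (hc.norm_ctrlGrad_sub_le h h' hdl' hdq' l) (hdl l) (norm_nonneg _)
        (by positivity)
    -- The gradient error splits in three. The distance of `f` to `v` enters linearly, as only its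
    -- mean will be under control; the error of `v` is measured at the new point, and half of the
    -- proximal gain pays for its square; the change of the true gradient over one step is of order
    -- `γ`.
    have e : inner ℝ (sys.ctrlGrad U Γ q l) d = inner ℝ (f l) d - inner ℝ (f l - v l) d -
        inner ℝ (v l - sys.ctrlGrad U Γ' q' l) d -
        inner ℝ (sys.ctrlGrad U Γ' q' l - sys.ctrlGrad U Γ q l) d := by
      rw [← inner_sub_left, ← inner_sub_left, ← inner_sub_left]
      congr 1
      abel
    rw [e]
    linarith
  -- the time-sharing block
  set u := utilGrad U (sys.avgRate Γ q) with hu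
  set e := ‖tableVec (r - sys.meanTable Γ)‖ with he
  set a := ‖tableVec (r - sys.meanTable Γ')‖ with ha
  have he0 : 0 ≤ e := norm_nonneg _
  -- The rate table is used at the old control, while its error is measured at the new one; the
  -- shift costs `O(γ)`.
  have hea : e ≤ a + A * γ := by
    have h2 := hc.norm_meanTable_sub_le h.1 h'.1 hdl'
    have h3 : tableVec (r - sys.meanTable Γ) = tableVec (r - sys.meanTable Γ') +
        (tableVec (sys.meanTable Γ') - tableVec (sys.meanTable Γ)) := by
      simp only [tableVec_sub]; abel
    rw [he, h3]
    refine (norm_add_le _ _).trans ?_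
    rw [hA]
    linarith
  have hesq : e ^ 2 ≤ 2 * a ^ 2 + 2 * A ^ 2 * γ ^ 2 := by
    have := pow_le_pow_left₀ he0 hea 2
    nlinarith [sq_nonneg (a - A * γ)]
  have hshare : τq / 2 * ‖qb - q‖ ^ 2 - C₁ * e ^ 2 ≤
      inner ℝ u (approxRate (sys.meanTable Γ) (qb - q)) := by
    have hmem := approxRate_mem_orthant hr fun l => (h.2.1 l).1
    have hmemb := approxRate_mem_orthant hr fun l => (hb.2.1 l).1
    set u' := utilGrad U (approxRate r q) with hu'
    -- Here the surrogate is nonlinear in `q`; concavity of `U` turns its increase into an inner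
    -- product with the gradient.
    have b1 : τq * ‖qb - q‖ ^ 2 ≤ inner ℝ u' (approxRate r (qb - q)) := by
      have h2 := hqmax h.2
      simp only [sub_self, norm_zero, Set.mem_ofPred_eq] at h2
      have h3 := hc.util_concave _ hmem _ hmemb
      rw [← approxRate_sub_right] at h3
      nlinarith
    have b2 : ‖u' - u‖ ≤ c * e := by
      refine (hc.utilGrad_lip _ (avgRate_mem_orthant h.1 fun l => (h.2.1 l).1) _ hmem).trans ?_
      rw [avgRate_eq, ← approxRate_sub_left]
      gcongr
      exact (norm_approxRate_le _ _).trans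
        ((mul_le_mul_of_nonneg_left (norm_le_one_of_mem_shareSet h.2) he0).trans (mul_one _).le)
    have b3 : ‖approxRate r (qb - q)‖ ≤ (c + e) * ‖qb - q‖ := by
      refine (norm_approxRate_le _ _).trans ?_
      gcongr
      have h3 : tableVec r = tableVec (sys.meanTable Γ) + tableVec (r - sys.meanTable Γ) := by
        simp only [tableVec_sub]; abel
      rw [h3]
      exact (norm_add_le _ _).trans (add_le_add_left (hc.norm_table_le Γ h.1) _)
    have b4 : inner ℝ (u' - u) (approxRate r (qb - q)) ≤ c * e * ((c + e) * ‖qb - q‖) :=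
      (real_inner_le_norm _ _).trans (by gcongr)
    have b5 : inner ℝ u (approxRate (r - sys.meanTable Γ) (qb - q)) ≤ c * (e * ‖qb - q‖) := by
      refine (real_inner_le_norm _ _).trans ?_
      gcongr
      exacts [hc.norm_utilGrad_le Γ q h, norm_approxRate_le _ _]
    have eqn : inner ℝ u (approxRate (sys.meanTable Γ) (qb - q)) =
        inner ℝ u' (approxRate r (qb - q)) - inner ℝ (u' - u) (approxRate r (qb - q)) -
        inner ℝ u (approxRate (r - sys.meanTable Γ) (qb - q)) := by
      rw [approxRate_sub_left, inner_sub_left, inner_sub_right]; ring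
    rw [eqn]
    set n := ‖qb - q‖
    have b6 : c * e ^ 2 * n ≤ c * e ^ 2 * 2 := by gcongr
    have b7 : c * (c + 1) * e * n ≤ τq / 2 * n ^ 2 + (c * (c + 1)) ^ 2 / (2 * τq) * e ^ 2 := by
      have h2 : τq / 2 * n ^ 2 + (c * (c + 1)) ^ 2 / (2 * τq) * e ^ 2 - c * (c + 1) * e * n =
          (τq * n - c * (c + 1) * e) ^ 2 / (2 * τq) := by field_simp; ring
      have h3 : 0 ≤ (τq * n - c * (c + 1) * e) ^ 2 / (2 * τq) := by positivity
      linarith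
    rw [hC₁]
    linarith
  have hstep := hc.objective_step_ge h0 h h' hb hΓ' hq'
  rw [← hT, ← hu] at hstep
  refine le_trans ?_ hstep
  have hsum := Finset.sum_le_sum fun l (_ : l ∈ Finset.univ) => hctrl l
  simp only [Finset.sum_sub_distrib, ← Finset.mul_sum, Finset.sum_const, Finset.card_univ,
    Fintype.card_fin, nsmul_eq_mul] at hsum
  set D₁ := ∑ l, ‖Γb l - Γ l‖ ^ 2
  set E₁ := ∑ l, ‖v l - sys.ctrlGrad U Γ' q' l‖ ^ 2 with hE₁
  set E₂ := ∑ l, ‖f l - v l‖ with hE₂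
  have hD₁ : 0 ≤ D₁ := by positivity
  have hE₁0 : 0 ≤ E₁ := by positivity
  have hE₂0 : 0 ≤ E₂ := by positivity
  have m1 : min τq τΓ / 2 * D₁ ≤ τΓ / 2 * D₁ := by gcongr; exact min_le_right _ _
  have m2 : min τq τΓ / 2 * ‖qb - q‖ ^ 2 ≤ τq / 2 * ‖qb - q‖ ^ 2 := by
    gcongr; exact min_le_left _ _
  have m3 : (2 * C₁) * a ^ 2 + 1 / (2 * τΓ) * E₁ + c * E₂ ≤ C * (a ^ 2 + E₁ + E₂) := by
    have n1 : 2 * C₁ * a ^ 2 ≤ C * a ^ 2 := by gcongr; linarith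
    have n2 : 1 / (2 * τΓ) * E₁ ≤ C * E₁ := by gcongr; linarith
    have n3 : c * E₂ ≤ C * E₂ := by gcongr; linarith
    linarith
  have m4 : (T + 2 * C₁ * A ^ 2 + L * (B * (c + 2) * c)) * γ ^ 2 ≤ C * γ ^ 2 := by
    gcongr; linarith
  have m5 : γ * (C₁ * (2 * A ^ 2 * γ ^ 2)) ≤ C₁ * (2 * A ^ 2 * γ ^ 2) :=
    mul_le_of_le_one_left (by positivity) h1
  have m6 : C₁ * e ^ 2 ≤ C₁ * (2 * a ^ 2 + 2 * A ^ 2 * γ ^ 2) := by gcongr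
  have m7 := mul_le_mul_of_nonneg_left (add_le_add hsum (hshare)) h0
  have m8 : γ * (min τq τΓ / 2 * (D₁ + ‖qb - q‖ ^ 2) - C * (a ^ 2 + E₁ + E₂)) ≤
      γ * (τΓ / 2 * D₁ + τq / 2 * ‖qb - q‖ ^ 2 - (2 * C₁ * a ^ 2 + 1 / (2 * τΓ) * E₁ + c * E₂)) := by
    gcongr ?_ * ?_
    linarith
  have m9 : γ * (C₁ * e ^ 2) ≤ γ * (C₁ * (2 * a ^ 2 + 2 * A ^ 2 * γ ^ 2)) := by gcongr
  linarith

end Bounds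

end System

end

end RCSHP

/-! ### Unique maximizers and measurable dependence on the past samples -/

namespace RCSHP

/-! ### Continuity of unique maximizers -/

/-- A unique maximizer over a compact set depends continuously on the parameter. -/
lemma continuousOn_of_isMaxOn {P E : Type*} [TopologicalSpace P] [TopologicalSpace E]
    {s : Set P} {T : Set E} (hT : IsCompact T) {F : P → E → ℝ}
    (hF : ContinuousOn (Function.uncurry F) (s ×ˢ T)) {Φ : P → E} (hΦ : ∀ p ∈ s, Φ p ∈ T)
    (hmax : ∀ p ∈ s, IsMaxOn (F p) T (Φ p))
    (huniq : ∀ p ∈ s, ∀ x ∈ T, ∀ y ∈ T, IsMaxOn (F p) T x → IsMaxOn (F p) T y → x = y) :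
    ContinuousOn Φ s := by
  intro p₀ hp₀
  -- By compactness it suffices that every cluster point of the maximizers maximizes the limiting
  -- problem; this follows by passing to the limit in the maximality inequality along an
  -- ultrafilter.
  refine hT.tendsto_nhds_of_unique_mapClusterPt
    (eventually_mem_nhdsWithin.mono fun p hp => hΦ p hp) fun y hy hclus => ?_
  refine huniq p₀ hp₀ y hy _ (hΦ p₀ hp₀) (fun z hz => ?_) (hmax p₀ hp₀)
  obtain ⟨V, hV, hVy⟩ := mapClusterPt_iff_ultrafilter.1 hclus
  have hVp : Tendsto (fun p : P => p) V (𝓝 p₀) := tendsto_id.mono_left (hV.trans inf_le_left)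
  have hVs : ∀ᶠ p in (V : Filter P), p ∈ s := hV eventually_mem_nhdsWithin
  have h1 : Tendsto (fun p => F p z) V (𝓝 (F p₀ z)) := by
    refine (hF (p₀, z) ⟨hp₀, hz⟩).tendsto.comp (tendsto_nhdsWithin_iff.2
      ⟨hVp.prodMk_nhds tendsto_const_nhds, hVs.mono fun p hp => ⟨hp, hz⟩⟩)
  have h2 : Tendsto (fun p => F p (Φ p)) V (𝓝 (F p₀ y)) := by
    refine (hF (p₀, y) ⟨hp₀, hy⟩).tendsto.comp (tendsto_nhdsWithin_iff.2
      ⟨hVp.prodMk_nhds hVy, hVs.mono fun p hp => ⟨hp, hΦ p hp⟩⟩)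
  exact le_of_tendsto_of_tendsto h1 h2 (hVs.mono fun p hp => hmax p hp hz)

/-- A concave function minus a positive multiple of a squared distance has at most one maximizer. -/
lemma eq_of_isMaxOn_sub_norm_sq {E : Type*} [NormedAddCommGroup E] [InnerProductSpace ℝ E]
    {s : Set E} {G : E → ℝ} (hG : ConcaveOn ℝ s G) {τ : ℝ} (hτ : 0 < τ) (a : E) {x y : E}
    (hx : x ∈ s) (hy : y ∈ s) (hxm : IsMaxOn (fun z => G z - τ * ‖z - a‖ ^ 2) s x)
    (hym : IsMaxOn (fun z => G z - τ * ‖z - a‖ ^ 2) s y) : x = y := by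
  -- Both maximizers are compared with their midpoint; by the parallelogram law the midpoint would
  -- win by a multiple of `‖x - y‖²`.
  have hm : (1 / 2 : ℝ) • x + (1 / 2 : ℝ) • y ∈ s :=
    hG.1 hx hy (by norm_num) (by norm_num) (by norm_num)
  have h1 := hG.2 hx hy (by norm_num : (0 : ℝ) ≤ 1 / 2) (by norm_num : (0 : ℝ) ≤ 1 / 2) (by norm_num)
  have h2 := hxm hm
  have h3 := hym hm
  simp only [Set.mem_ofPred_eq, smul_eq_mul] at h1 h2 h3
  have h4 := parallelogram_law_with_norm ℝ (x - a) (y - a)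
  have e1 : x - a + (y - a) = (2 : ℝ) • ((1 / 2 : ℝ) • x + (1 / 2 : ℝ) • y - a) := by module
  have e2 : x - a - (y - a) = x - y := by abel
  rw [e1, e2, norm_smul, Real.norm_of_nonneg zero_le_two] at h4
  have h5 : ‖x - y‖ ^ 2 = 0 := by
    refine le_antisymm ?_ (by positivity)
    have h6 := congrArg (τ * ·) h4
    have h7 : τ * ‖x - y‖ ^ 2 ≤ τ * 0 := by linarith
    exact le_of_mul_le_mul_left h7 hτ
  exact sub_eq_zero.1 (norm_eq_zero.1 (pow_eq_zero_iff two_ne_zero |>.1 h5))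

/-! ### Functions of the past samples -/

section Past

variable {Ω Z : Type*} [MeasurableSpace Ω] [MeasurableSpace Z] {TH : ℕ}

/-- The samples drawn before iteration `t`. -/
def pastSamples (ξ : ℕ → Fin TH → Ω → Z) (t : ℕ) (ω : Ω) :
    (Finset.range t ×ˢ (Finset.univ : Finset (Fin TH)) : Finset (ℕ × Fin TH)) → Z :=
  fun p => ξ p.1.1 p.1.2 ω

/-- `f` is almost everywhere a measurable function of the samples drawn before iteration `t`. -/
def PastMeas (Pr : Measure Ω) (ξ : ℕ → Fin TH → Ω → Z) (t : ℕ) {β : Type*} [MeasurableSpace β]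
    (f : Ω → β) : Prop :=
  ∃ g : ((Finset.range t ×ˢ (Finset.univ : Finset (Fin TH)) : Finset (ℕ × Fin TH)) → Z) → β,
    Measurable g ∧ f =ᵐ[Pr] fun ω => g (pastSamples ξ t ω)

namespace PastMeas

variable {Pr : Measure Ω} {ξ : ℕ → Fin TH → Ω → Z} {t : ℕ}
variable {α β : Type*} [MeasurableSpace α] [MeasurableSpace β]

lemma const (b : β) : PastMeas Pr ξ t (fun _ => b) := ⟨fun _ => b, measurable_const, ae_eq_rfl⟩

lemma congr {f g : Ω → β} (hf : PastMeas Pr ξ t f) (h : f =ᵐ[Pr] g) : PastMeas Pr ξ t g := by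
  obtain ⟨g', hg', hfg⟩ := hf
  exact ⟨g', hg', h.symm.trans hfg⟩

lemma comp {f : Ω → α} (hf : PastMeas Pr ξ t f) {φ : α → β} (hφ : Measurable φ) :
    PastMeas Pr ξ t fun ω => φ (f ω) := by
  obtain ⟨g, hg, hfg⟩ := hf
  exact ⟨φ ∘ g, hφ.comp hg, hfg.mono fun ω h => congrArg φ h⟩

lemma prodMk {f : Ω → α} {g : Ω → β} (hf : PastMeas Pr ξ t f) (hg : PastMeas Pr ξ t g) :
    PastMeas Pr ξ t fun ω => (f ω, g ω) := by
  obtain ⟨f', hf', hff⟩ := hf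
  obtain ⟨g', hg', hgg⟩ := hg
  refine ⟨fun p => (f' p, g' p), hf'.prodMk hg', ?_⟩
  filter_upwards [hff, hgg] with ω h1 h2
  rw [h1, h2]

lemma pi {ι : Type*} [Countable ι] {f : Ω → ι → β} (hf : ∀ i, PastMeas Pr ξ t fun ω => f ω i) :
    PastMeas Pr ξ t f := by
  choose g hg hfg using hf
  refine ⟨fun p i => g i p, measurable_pi_lambda _ hg, ?_⟩
  filter_upwards [ae_all_iff.2 hfg] with ω h
  exact funext h

lemma succ {f : Ω → β} (hf : PastMeas Pr ξ t f) : PastMeas Pr ξ (t + 1) f := by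
  obtain ⟨g, hg, hfg⟩ := hf
  have hsub : ∀ p ∈ Finset.range t ×ˢ (Finset.univ : Finset (Fin TH)),
      p ∈ Finset.range (t + 1) ×ˢ (Finset.univ : Finset (Fin TH)) := by
    intro p hp
    simp only [Finset.mem_product, Finset.mem_range, Finset.mem_univ, and_true] at hp ⊢
    omega
  exact ⟨fun z => g fun p => z ⟨p.1, hsub p.1 p.2⟩,
    hg.comp (measurable_pi_lambda _ fun p => measurable_pi_apply _), hfg⟩

lemma sample (i : Fin TH) : PastMeas Pr ξ (t + 1) (ξ t i) :=
  ⟨fun z => z ⟨(t, i), by simp⟩, measurable_pi_apply _, ae_eq_rfl⟩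

lemma comp_continuousOn [IsProbabilityMeasure Pr] [TopologicalSpace α] [BorelSpace α] [TopologicalSpace β]
    [BorelSpace β] {f : Ω → α} (hf : PastMeas Pr ξ t f) {φ : α → β} {s : Set α} (hφ : ContinuousOn φ s)
    (hs : MeasurableSet s) (hfs : ∀ ω, f ω ∈ s) : PastMeas Pr ξ t fun ω => φ (f ω) := by
  classical
  obtain ⟨ω₀⟩ : Nonempty Ω := Pr.nonempty_of_neZero
  -- Continuity is known on `s` only; off `s` the function is replaced by an arbitrary constant,
  -- which the values of `f` never see.
  have hm : Measurable (s.piecewise φ fun _ => φ (f ω₀)) :=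
    hφ.measurable_piecewise continuousOn_const hs
  refine (hf.comp hm).congr (Eventually.of_forall fun ω => ?_)
  exact Set.piecewise_eq_of_mem _ _ _ (hfs ω)

/-- No measurable selection is needed: the maximizer is unique, hence a continuous function of the
parameter, and the given maximizers must agree with it. -/
lemma argmax [IsProbabilityMeasure Pr] [TopologicalSpace α] [BorelSpace α] [TopologicalSpace β]
    [BorelSpace β] {s : Set α} {T : Set β} (hs : MeasurableSet s) (hT : IsCompact T) (hTne : T.Nonempty)
    {F : α → β → ℝ} (hF : ContinuousOn (Function.uncurry F) (s ×ˢ T))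
    (huniq : ∀ p ∈ s, ∀ x ∈ T, ∀ y ∈ T, IsMaxOn (F p) T x → IsMaxOn (F p) T y → x = y)
    {f : Ω → α} (hf : PastMeas Pr ξ t f) (hfs : ∀ ω, f ω ∈ s) {y : Ω → β} (hy : ∀ ω, y ω ∈ T)
    (hmax : ∀ ω, IsMaxOn (F (f ω)) T (y ω)) : PastMeas Pr ξ t y := by
  have hex : ∀ p : α, ∃ x, p ∈ s → x ∈ T ∧ IsMaxOn (F p) T x := by
    intro p
    obtain ⟨x₀, hx₀⟩ := hTne
    by_cases hp : p ∈ s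
    · obtain ⟨x, hx, hxm⟩ := hT.exists_isMaxOn ⟨x₀, hx₀⟩
        (hF.comp (f := fun x => (p, x)) (by fun_prop) fun x hx => ⟨hp, hx⟩)
      exact ⟨x, fun _ => ⟨hx, hxm⟩⟩
    · exact ⟨x₀, fun h => absurd h hp⟩
  choose Φ hΦ using hex
  have hcont : ContinuousOn Φ s := continuousOn_of_isMaxOn hT hF (fun p hp => (hΦ p hp).1)
    (fun p hp => (hΦ p hp).2) huniq
  refine (hf.comp_continuousOn hcont hs hfs).congr (Eventually.of_forall fun ω => ?_)
  exact huniq _ (hfs ω) _ (hΦ _ (hfs ω)).1 _ (hy ω) (hΦ _ (hfs ω)).2 (hmax ω)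

lemma aemeasurable {f : Ω → β} (hf : PastMeas Pr ξ t f) (hξ : ∀ t i, Measurable (ξ t i)) :
    AEMeasurable f Pr := by
  obtain ⟨g, hg, hfg⟩ := hf
  exact ⟨_, hg.comp (measurable_pi_lambda _ fun p => hξ _ _), hfg⟩

/-- Samples before iteration `t` and the sample `(t, i)` carry disjoint index sets. -/
lemma indepFun {f : Ω → β} (hf : PastMeas Pr ξ t f) (hξ : ∀ t i, Measurable (ξ t i))
    (hind : iIndepFun (fun ti : ℕ × Fin TH => ξ ti.1 ti.2) Pr) (i : Fin TH) :
    IndepFun f (ξ t i) Pr := by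
  obtain ⟨g, hg, hfg⟩ := hf
  have hdis : Disjoint (Finset.range t ×ˢ (Finset.univ : Finset (Fin TH))) {(t, i)} := by
    simp
  have h := hind.indepFun_finset _ _ hdis (fun p => hξ p.1 p.2)
  have h2 := h.comp hg (measurable_pi_apply (⟨(t, i), Finset.mem_singleton_self _⟩ :
    ({(t, i)} : Finset (ℕ × Fin TH))))
  exact h2.congr hfg.symm ae_eq_rfl

lemma map_prodMk [IsProbabilityMeasure Pr] {f : Ω → β} (hf : PastMeas Pr ξ t f)
    (hξ : ∀ t i, Measurable (ξ t i))
    (hind : iIndepFun (fun ti : ℕ × Fin TH => ξ ti.1 ti.2) Pr) {μ : Measure Z}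
    (hμ : ∀ t i, Pr.map (ξ t i) = μ) (i : Fin TH) :
    Pr.map (fun ω => (f ω, ξ t i ω)) = (Pr.map f).prod μ := by
  rw [← hμ t i]
  exact (indepFun_iff_map_prod_eq_prod_map_map (hf.aemeasurable hξ) (hξ t i).aemeasurable).1
    (hf.indepFun hξ hind i)

/-- A property that holds almost surely for every admissible value of the past holds almost
surely. -/
lemma ae_prodMk [IsProbabilityMeasure Pr] {f : Ω → β} (hf : PastMeas Pr ξ t f)
    (hξ : ∀ t i, Measurable (ξ t i))
    (hind : iIndepFun (fun ti : ℕ × Fin TH => ξ ti.1 ti.2) Pr) {μ : Measure Z}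
    [IsProbabilityMeasure μ] (hμ : ∀ t i, Pr.map (ξ t i) = μ) (i : Fin TH) {s : Set β}
    (hs : MeasurableSet s) (hfs : ∀ ω, f ω ∈ s) {p : β × Z → Prop} (hp : MeasurableSet {z | p z})
    (h : ∀ b ∈ s, ∀ᵐ z ∂μ, p (b, z)) : ∀ᵐ ω ∂Pr, p (f ω, ξ t i ω) := by
  have hfm := hf.aemeasurable hξ
  have hae : ∀ᵐ b ∂Pr.map f, b ∈ s := (ae_map_iff hfm hs).2 (Eventually.of_forall hfs)
  have := Measure.isProbabilityMeasure_map hfm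
  have h2 : ∀ᵐ z ∂(Pr.map f).prod μ, p z :=
    (Measure.ae_prod_iff_ae_ae hp).2 (hae.mono fun b hb => h b hb)
  rw [← hf.map_prodMk hξ hind hμ i] at h2
  exact ae_of_ae_map (hfm.prodMk (hξ t i).aemeasurable) h2

end PastMeas

end Past

end RCSHP

/-! ### The iterates as functions of the past samples -/

namespace RCSHP

noncomputable section

variable {K M S Tp L TH : ℕ} {sys : System K M S Tp} {U : EuclideanSpace ℝ (Fin K) → ℝ}
  {ρ γ : ℕ → ℝ} {τq τΓ : ℝ} {Γ₀ : Fin L → Ctrl K M S} {q₀ : EuclideanSpace ℝ (Fin L)}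

/-! ### Runs of the algorithm -/

/-- The table `(1 - ρ) r̂ + ρ 𝔼[r]`, the mean of the next rate estimate. -/
def Run.midTable (sys : System K M S Tp) (ρ : ℕ → ℝ) (X : Run K M S L) (t : ℕ) :
    Fin K → Fin L → ℝ :=
  fun k l => (1 - ρ t) * prev X.rhat t k l + ρ t * sys.meanRate k (X.Γ t l)

/-- The vector of the partial derivatives of a rate. -/
def System.rateGrad (sys : System K M S Tp) (k : Fin K) (p : Ctrl K M S × State K M Tp) :
    Ctrl K M S :=
  WithLp.toLp 2 fun j => sys.ratePartial k j p

/-- Weights of the rate gradients in the recursive gradient estimate, with the utility gradient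
taken at the mean of the next rate estimate. -/
def Run.midWeight (sys : System K M S Tp) (U : EuclideanSpace ℝ (Fin K) → ℝ) (ρ : ℕ → ℝ)
    (X : Run K M S L) (t : ℕ) (k : Fin K) (l : Fin L) : ℝ :=
  X.q t l * utilGrad U (approxRate (X.midTable sys ρ t) (X.q t)) k

/-- The recursive gradient estimate in which the utility gradient is evaluated before the samples of
the current iteration are drawn. -/
def Run.auxGrad (sys : System K M S Tp) (U : EuclideanSpace ℝ (Fin K) → ℝ) (ρ : ℕ → ℝ)
    (X : Run K M S L) (ω : ℕ → Fin TH → State K M Tp) : ℕ → Fin L → Ctrl K M S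
  | 0 => 0
  | t + 1 => fun l => (1 - ρ t) • Run.auxGrad sys U ρ X ω t l +
      ρ t • ∑ i, (TH : ℝ)⁻¹ • ∑ k, X.midWeight sys U ρ t k l •
        sys.rateGrad k (X.Γ t l, ω t i)

namespace IsRun

variable {ω : ℕ → Fin TH → State K M Tp} {X : Run K M S L}

lemma feasible (h : IsRun sys U ρ γ τq τΓ Γ₀ q₀ ω X) (hγ : ∀ t, γ t ∈ Set.Ioc 0 1)
    (hΓ₀ : ∀ l, Γ₀ l ∈ sys.ctrlSet) (hq₀ : q₀ ∈ shareSet L) (t : ℕ) :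
    sys.Feasible (X.Γ t) (X.q t) := by
  induction t with
  | zero => rw [h.init_Γ, h.init_q]; exact ⟨hΓ₀, hq₀⟩
  | succ t ih =>
    have h1 : 0 ≤ 1 - γ t := sub_nonneg.2 (hγ t).2
    refine ⟨fun l => ?_, ?_⟩
    · rw [h.Γ_succ]
      exact sys.convex_ctrlSet (ih.1 l) (h.Γbar_mem t l) h1 (hγ t).1.le (sub_add_cancel _ _)
    · rw [h.q_succ]
      exact convex_shareSet ih.2 (h.qbar_mem t) h1 (hγ t).1.le (sub_add_cancel _ _)

lemma prev_rhat_nonneg (h : IsRun sys U ρ γ τq τΓ Γ₀ q₀ ω X) (hρ : ∀ t, ρ t ∈ Set.Ioc 0 1)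
    (hfeas : ∀ t, sys.Feasible (X.Γ t) (X.q t)) (t : ℕ) (k : Fin K) (l : Fin L) :
    0 ≤ prev X.rhat t k l := by
  induction t with
  | zero => exact le_rfl
  | succ t ih =>
    change 0 ≤ X.rhat t k l
    rw [h.rhat_eq]
    have h1 : 0 ≤ 1 - ρ t := sub_nonneg.2 (hρ t).2
    have h2 : 0 ≤ ∑ i, sys.rate k (X.Γ t l) (ω t i) / TH := Finset.sum_nonneg fun i _ =>
      div_nonneg (sys.rate_nonneg ((hfeas t).1 l).2.1 _ k) (Nat.cast_nonneg _)
    have := (hρ t).1.le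
    positivity

lemma midTable_nonneg (h : IsRun sys U ρ γ τq τΓ Γ₀ q₀ ω X) (hρ : ∀ t, ρ t ∈ Set.Ioc 0 1)
    (hfeas : ∀ t, sys.Feasible (X.Γ t) (X.q t)) (t : ℕ) (k : Fin K) (l : Fin L) :
    0 ≤ X.midTable sys ρ t k l := by
  have h1 : 0 ≤ 1 - ρ t := sub_nonneg.2 (hρ t).2
  have h2 := h.prev_rhat_nonneg hρ hfeas t k l
  have h3 := System.meanRate_nonneg ((hfeas t).1 l) k
  have := (hρ t).1.le
  unfold Run.midTable
  positivity

end IsRun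

/-! ### Measurability of the average rates and gradients -/

lemma System.measurable_meanRate (sys : System K M S Tp) [IsProbabilityMeasure sys.channelLaw]
    (k : Fin K) : Measurable (sys.meanRate k) :=
  (StronglyMeasurable.integral_prod_right (sys.measurable_rate k).stronglyMeasurable).measurable

lemma System.measurable_rateGrad (sys : System K M S Tp) (k : Fin K) :
    Measurable (sys.rateGrad k) :=
  (PiLp.continuous_toLp 2 _).measurable.comp
    (measurable_pi_lambda _ fun j => sys.measurable_ratePartial k j)

lemma continuous_approxRate :
    Continuous fun p : (Fin K → Fin L → ℝ) × EuclideanSpace ℝ (Fin L) => approxRate p.1 p.2 := by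
  unfold approxRate
  refine (PiLp.continuous_toLp 2 _).comp (continuous_pi fun k => continuous_finsetSum _ fun l _ => ?_)
  fun_prop

lemma IsUtility.continuousOn_utilGrad (hU : IsUtility U) : ContinuousOn (utilGrad U) (orthant K) := by
  obtain ⟨V, hV⟩ := hU.lipschitz_gradient
  exact hV.continuousOn

/-- The standing assumptions on the samples and on the run. -/
structure SampledRun (sys : System K M S Tp) (U : EuclideanSpace ℝ (Fin K) → ℝ) (ρ γ : ℕ → ℝ)
    (τq τΓ : ℝ) (Γ₀ : Fin L → Ctrl K M S) (q₀ : EuclideanSpace ℝ (Fin L)) {Ω : Type*}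
    [MeasurableSpace Ω] (Pr : Measure Ω) (ξ : ℕ → Fin TH → Ω → State K M Tp)
    (X : Ω → Run K M S L) : Prop where
  pmax_pos : 0 < sys.Pmax
  prob : IsProbabilityMeasure sys.channelLaw
  regular : sys.RegularRates
  utility : IsUtility U
  rho_mem : ∀ t, ρ t ∈ Set.Ioc 0 1
  gamma_mem : ∀ t, γ t ∈ Set.Ioc 0 1
  share_pos : 0 < τq
  ctrl_pos : 0 < τΓ
  batch_pos : 0 < TH
  init_ctrl : ∀ l, Γ₀ l ∈ sys.ctrlSet
  init_share : q₀ ∈ shareSet L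
  measurable : ∀ t i, Measurable (ξ t i)
  indep : iIndepFun (fun ti : ℕ × Fin TH => ξ ti.1 ti.2) Pr
  law : ∀ t i, Pr.map (ξ t i) = sys.stateLaw
  run : ∀ ω, IsRun sys U ρ γ τq τΓ Γ₀ q₀ (fun t i => ξ t i ω) (X ω)

namespace SampledRun

variable {Ω : Type*} [MeasurableSpace Ω] {Pr : Measure Ω} [IsProbabilityMeasure Pr]
  {ξ : ℕ → Fin TH → Ω → State K M Tp} {X : Ω → Run K M S L}

omit [IsProbabilityMeasure Pr] in
lemma feasible (h : SampledRun sys U ρ γ τq τΓ Γ₀ q₀ Pr ξ X) (t : ℕ) (ω : Ω) :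
    sys.Feasible ((X ω).Γ t) ((X ω).q t) :=
  (h.run ω).feasible h.gamma_mem h.init_ctrl h.init_share t

/-- The control is random, but independent of the fresh sample. By Fubini, the almost sure
nonvanishing of the estimates at each fixed control carries over to it. -/
lemma ae_gradient_eq (h : SampledRun sys U ρ γ τq τΓ Γ₀ q₀ Pr ξ X) {t : ℕ} {l : Fin L}
    (hΓ : PastMeas Pr ξ t fun ω => (X ω).Γ t l) (i : Fin TH) :
    ∀ᵐ ω ∂Pr, ∀ k, gradient (fun x => sys.rate k x (ξ t i ω)) ((X ω).Γ t l) =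
      sys.rateGrad k ((X ω).Γ t l, ξ t i ω) := by
  have := h.prob
  have hm : MeasurableSet {z : Ctrl K M S × State K M Tp | ∀ k, sys.estimate z.1 z.2 k ≠ 0} := by
    simp only [Set.ofPred_forall]
    refine MeasurableSet.iInter fun k => ?_
    have : Measurable fun z : Ctrl K M S × State K M Tp => sys.estimate z.1 z.2 k :=
      measurable_pi_lambda _ fun s => sys.measurable_estimate k s
    exact this (measurableSet_singleton 0).compl
  have key := hΓ.ae_prodMk h.measurable h.indep h.law i sys.isClosed_ctrlSet.measurableSet
    (fun ω => (h.feasible t ω).1 l) hm fun x hx => h.regular.ae_estimate_ne_zero hx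
  filter_upwards [key] with ω hω k
  ext j
  exact sys.gradient_apply_eq_ratePartial ((h.feasible t ω).1 l) hω k j

/-- The state of the algorithm is a function of the past samples. -/
structure StateMeas (Pr : Measure Ω) (ξ : ℕ → Fin TH → Ω → State K M Tp) (X : Ω → Run K M S L)
    (t : ℕ) : Prop where
  ctrl : ∀ l, PastMeas Pr ξ t fun ω => (X ω).Γ t l
  share : PastMeas Pr ξ t fun ω => (X ω).q t
  rate : ∀ k l, PastMeas Pr ξ t fun ω => prev (X ω).rhat t k l
  grad : ∀ l, PastMeas Pr ξ t fun ω => prev (X ω).grad t l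

omit [IsProbabilityMeasure Pr] in
lemma pastMeas_utilGrad [IsProbabilityMeasure Pr] (hU : IsUtility U) {t : ℕ}
    {r : Ω → Fin K → Fin L → ℝ} {q : Ω → EuclideanSpace ℝ (Fin L)}
    (hr : ∀ k l, PastMeas Pr ξ t fun ω => r ω k l) (hq : PastMeas Pr ξ t q)
    (hr0 : ∀ ω k l, 0 ≤ r ω k l) (hq0 : ∀ ω l, 0 ≤ q ω l) (k : Fin K) :
    PastMeas Pr ξ t fun ω => utilGrad U (approxRate (r ω) (q ω)) k := by
  have h1 : PastMeas Pr ξ t fun ω => approxRate (r ω) (q ω) :=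
    PastMeas.comp (.prodMk (.pi fun k => .pi fun l => hr k l) hq) continuous_approxRate.measurable
  have h2 := h1.comp_continuousOn hU.continuousOn_utilGrad isClosed_orthant.measurableSet
    fun ω => approxRate_mem_orthant (hr0 ω) (hq0 ω)
  exact h2.comp (φ := fun v : EuclideanSpace ℝ (Fin K) => v k) (by fun_prop)

omit [IsProbabilityMeasure Pr] in
lemma _root_.RCSHP.PastMeas.finsetSum {ι E : Type*} [NormedAddCommGroup E] [MeasurableSpace E]
    [BorelSpace E] [SecondCountableTopology E] {t : ℕ} (s : Finset ι) {f : ι → Ω → E}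
    (hf : ∀ i, PastMeas Pr ξ t (f i)) : PastMeas Pr ξ t fun ω => ∑ i ∈ s, f i ω := by
  choose g hg hfg using hf
  refine ⟨fun z => ∑ i ∈ s, g i z, Finset.measurable_fun_sum _ fun i _ => hg i, ?_⟩
  have : ∀ᵐ ω ∂Pr, ∀ i ∈ s, f i ω = g i (pastSamples ξ t ω) :=
    (ae_ball_iff s.countable_toSet).2 fun i _ => hfg i
  filter_upwards [this] with ω hω
  exact Finset.sum_congr rfl hω

lemma pastMeas_ctrlBar (h : SampledRun sys U ρ γ τq τΓ Γ₀ q₀ Pr ξ X) {t s : ℕ} {l : Fin L}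
    (hf : PastMeas Pr ξ s fun ω => (X ω).grad t l) (hΓ : PastMeas Pr ξ s fun ω => (X ω).Γ t l) :
    PastMeas Pr ξ s fun ω => (X ω).Γbar t l := by
  set F : Ctrl K M S × Ctrl K M S → Ctrl K M S → ℝ :=
    fun p x => inner ℝ p.1 (x - p.2) - τΓ * ‖x - p.2‖ ^ 2 with hF
  have hcont : Continuous (Function.uncurry F) := by
    simp only [hF, Function.uncurry_def]
    fun_prop
  refine PastMeas.argmax (α := Ctrl K M S × Ctrl K M S) (β := Ctrl K M S) (F := F)
    MeasurableSet.univ sys.isCompact_ctrlSet ⟨0, System.zero_mem_ctrlSet h.pmax_pos⟩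
    hcont.continuousOn ?_ (f := fun ω => ((X ω).grad t l, (X ω).Γ t l)) (hf.prodMk hΓ)
    (fun _ => Set.mem_univ _) (fun ω => (h.run ω).Γbar_mem t l) (fun ω => (h.run ω).Γbar_max t l)
  intro p _ x hx y hy hxm hym
  refine eq_of_isMaxOn_sub_norm_sq ?_ h.ctrl_pos p.2 hx hy hxm hym
  refine ⟨sys.convex_ctrlSet, fun x _ y _ a b _ _ hab => le_of_eq ?_⟩
  have e : a • x + b • y - p.2 = a • (x - p.2) + b • (y - p.2) := by
    have : p.2 = (a + b) • p.2 := by rw [hab, one_smul]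
    nth_rewrite 1 [this]
    module
  simp only [smul_eq_mul]
  rw [e, inner_add_right, inner_smul_right, inner_smul_right]

lemma pastMeas_shareBar (h : SampledRun sys U ρ γ τq τΓ Γ₀ q₀ Pr ξ X) {t n : ℕ}
    (hr : ∀ k l, PastMeas Pr ξ n fun ω => (X ω).rhat t k l)
    (hq : PastMeas Pr ξ n fun ω => (X ω).q t) (hr0 : ∀ ω k l, 0 ≤ (X ω).rhat t k l) :
    PastMeas Pr ξ n fun ω => (X ω).qbar t := by
  set s : Set ((Fin K → Fin L → ℝ) × EuclideanSpace ℝ (Fin L)) := {p | ∀ k l, 0 ≤ p.1 k l}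
    with hs
  have hmem : ∀ p ∈ s, ∀ x ∈ shareSet L, approxRate p.1 x ∈ orthant K := fun p hp x hx =>
    approxRate_mem_orthant hp fun l => (hx.1 l).1
  have hclosed : IsClosed s := by
    simp only [hs, Set.ofPred_forall]
    exact isClosed_iInter fun k => isClosed_iInter fun l =>
      isClosed_le continuous_const (by fun_prop)
  refine PastMeas.argmax (s := s) hclosed.measurableSet isCompact_shareSet ⟨q₀, h.init_share⟩
    (F := fun p x => U (approxRate p.1 x) - τq * ‖x - p.2‖ ^ 2) ?_ ?_
    (f := fun ω => ((X ω).rhat t, (X ω).q t))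
    ((PastMeas.pi fun k => .pi fun l => hr k l).prodMk hq) (fun ω => hr0 ω)
    (fun ω => (h.run ω).qbar_mem t) (fun ω => (h.run ω).qbar_max t)
  · refine ContinuousOn.sub ?_ (Continuous.continuousOn (by fun_prop))
    refine h.utility.differentiableOn.continuousOn.comp
      (f := fun p : ((Fin K → Fin L → ℝ) × EuclideanSpace ℝ (Fin L)) ×
        EuclideanSpace ℝ (Fin L) => approxRate p.1.1 p.2) ?_ fun p hp => hmem _ hp.1 _ hp.2
    exact (continuous_approxRate.comp (by fun_prop : Continuous fun p :
      ((Fin K → Fin L → ℝ) × EuclideanSpace ℝ (Fin L)) × EuclideanSpace ℝ (Fin L) =>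
        (p.1.1, p.2))).continuousOn
  · intro p hp x hx y hy hxm hym
    refine eq_of_isMaxOn_sub_norm_sq (G := fun x => U (approxRate p.1 x)) ?_ h.share_pos p.2
      hx hy hxm hym
    refine ⟨convex_shareSet, fun x hx y hy a b ha hb hab => ?_⟩
    have e : approxRate p.1 (a • x + b • y) = a • approxRate p.1 x + b • approxRate p.1 y := by
      ext k
      simp only [approxRate, PiLp.add_apply, PiLp.smul_apply, smul_eq_mul, Finset.mul_sum,
        ← Finset.sum_add_distrib]
      exact Finset.sum_congr rfl fun l _ => by ring
    simp only [e]
    exact h.utility.concaveOn.2 (hmem p hp x hx) (hmem p hp y hy) ha hb hab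

/-- Induction on `t`: the update is a measurable function of the old state and the fresh samples,
the two surrogate solutions being unique maximizers. The gradients agree with the measurable
`rateGrad` only almost surely, which is why dependence on the past is understood up to null sets. -/
lemma stateMeas (h : SampledRun sys U ρ γ τq τΓ Γ₀ q₀ Pr ξ X) (t : ℕ) : StateMeas Pr ξ X t := by
  have := h.prob
  induction t with
  | zero =>
    refine ⟨fun l => (PastMeas.const (Γ₀ l)).congr (Eventually.of_forall fun ω => ?_),
      (PastMeas.const q₀).congr (Eventually.of_forall fun ω => ?_), fun k l => .const 0,
      fun l => .const 0⟩
    · exact (congrFun (h.run ω).init_Γ l).symm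
    · exact (h.run ω).init_q.symm
  | succ t ih =>
    have hfeas := h.feasible
    have hΓ : ∀ l, PastMeas Pr ξ (t + 1) fun ω => (X ω).Γ t l := fun l => (ih.ctrl l).succ
    have hq : PastMeas Pr ξ (t + 1) fun ω => (X ω).q t := ih.share.succ
    have hpair : ∀ l i, PastMeas Pr ξ (t + 1) fun ω => ((X ω).Γ t l, ξ t i ω) := fun l i =>
      (hΓ l).prodMk (.sample i)
    have hrhat0 : ∀ ω k l, 0 ≤ (X ω).rhat t k l := fun ω =>
      (h.run ω).prev_rhat_nonneg h.rho_mem (fun t => hfeas t ω) (t + 1)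
    have hrhat : ∀ k l, PastMeas Pr ξ (t + 1) fun ω => (X ω).rhat t k l := by
      intro k l
      simp only [(h.run _).rhat_eq]
      have h1 := (ih.rate k l).succ
      have h2 : PastMeas Pr ξ (t + 1) fun ω => ∑ i, sys.rate k ((X ω).Γ t l) (ξ t i ω) / TH :=
        PastMeas.finsetSum _ fun i => (hpair l i).comp ((sys.measurable_rate k).div_const _)
      exact (h1.prodMk h2).comp (φ := fun p : ℝ × ℝ => (1 - ρ t) * p.1 + ρ t * p.2) (by fun_prop)
    have hgrad : ∀ l, PastMeas Pr ξ (t + 1) fun ω => (X ω).grad t l := by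
      intro l
      have h1 : PastMeas Pr ξ (t + 1) fun ω => ∑ i : Fin TH, (TH : ℝ)⁻¹ • ∑ k,
          ((X ω).q t l * utilGrad U (approxRate ((X ω).rhat t) ((X ω).q t)) k) •
            sys.rateGrad k ((X ω).Γ t l, ξ t i ω) := by
        refine PastMeas.finsetSum _ fun i => PastMeas.comp (φ := fun v => (TH : ℝ)⁻¹ • v)
          (PastMeas.finsetSum _ fun k => ?_) (by fun_prop)
        have h2 := pastMeas_utilGrad h.utility hrhat hq hrhat0 (fun ω l => ((hfeas t ω).2.1 l).1) k
        have h3 := (hpair l i).comp (sys.measurable_rateGrad k)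
        exact ((hq.prodMk h2).prodMk h3).comp
          (φ := fun p : (EuclideanSpace ℝ (Fin L) × ℝ) × Ctrl K M S => (p.1.1 l * p.1.2) • p.2)
          (by fun_prop)
      have h4 := ((ih.grad l).succ.prodMk h1).comp
        (φ := fun p : Ctrl K M S × Ctrl K M S => (1 - ρ t) • p.1 + ρ t • p.2) (by fun_prop)
      refine h4.congr ?_
      filter_upwards [ae_all_iff.2 fun i => h.ae_gradient_eq (ih.ctrl l) i] with ω hω
      simp only [(h.run ω).grad_eq, jacobianMul, hω]
      rfl
    have hΓbar := fun l => h.pastMeas_ctrlBar (hgrad l) (hΓ l)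
    have hqbar := h.pastMeas_shareBar hrhat hq hrhat0
    refine ⟨fun l => ?_, ?_, hrhat, hgrad⟩
    · simp only [(h.run _).Γ_succ]
      exact ((hΓ l).prodMk (hΓbar l)).comp
        (φ := fun p : Ctrl K M S × Ctrl K M S => (1 - γ t) • p.1 + γ t • p.2) (by fun_prop)
    · simp only [(h.run _).q_succ]
      exact (hq.prodMk hqbar).comp (φ := fun p : EuclideanSpace ℝ (Fin L) × EuclideanSpace ℝ (Fin L)
        => (1 - γ t) • p.1 + γ t • p.2) (by fun_prop)

end SampledRun

end

end RCSHP

/-! ### Fresh centred noise and mean square recursions -/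

namespace RCSHP

/-! ### Second moment recursions -/

/-- One step of a recursive average with orthogonal noise `v` and perturbation `w`. -/
lemma integral_sq_recursion_le {Ω : Type*} [MeasurableSpace Ω] {μ : Measure Ω} {a v w : Ω → ℝ}
    (ha : MemLp a 2 μ) (hv : MemLp v 2 μ) (hw : MemLp w 2 μ) (hav : ∫ ω, a ω * v ω ∂μ = 0) {ρ : ℝ}
    (hρ : ρ ∈ Set.Ioc (0 : ℝ) 1) :
    ∫ ω, ((1 - ρ) * a ω + ρ * v ω + w ω) ^ 2 ∂μ ≤
      (1 - ρ) * ∫ ω, a ω ^ 2 ∂μ + 2 * ρ ^ 2 * ∫ ω, v ω ^ 2 ∂μ + 3 / ρ * ∫ ω, w ω ^ 2 ∂μ := by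
  obtain ⟨h0, h1⟩ := hρ
  have hpt : ∀ ω, ((1 - ρ) * a ω + ρ * v ω + w ω) ^ 2 ≤
      (1 - ρ) * a ω ^ 2 + 2 * ρ ^ 2 * v ω ^ 2 + 3 / ρ * w ω ^ 2 +
        2 * ρ * (1 - ρ) * (a ω * v ω) := by
    intro ω
    -- The gap between the two sides is an explicit sum of squares. The product `a v` is kept
    -- exactly, since its integral vanishes; the cross terms with `w` are absorbed at the price of
    -- the factor `3/ρ`.
    have e : (1 - ρ) * a ω ^ 2 + 2 * ρ ^ 2 * v ω ^ 2 + 3 / ρ * w ω ^ 2 +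
        2 * ρ * (1 - ρ) * (a ω * v ω) - ((1 - ρ) * a ω + ρ * v ω + w ω) ^ 2 =
        (1 - ρ) / ρ * (ρ * a ω - w ω) ^ 2 + (ρ * v ω - w ω) ^ 2 + (2 - ρ) / ρ * w ω ^ 2 := by
      field_simp
      ring
    have h2 : 0 ≤ (1 - ρ) / ρ := div_nonneg (by linarith) h0.le
    have h3 : 0 ≤ (2 - ρ) / ρ := div_nonneg (by linarith) h0.le
    have h4 : 0 ≤ (1 - ρ) / ρ * (ρ * a ω - w ω) ^ 2 + (ρ * v ω - w ω) ^ 2 +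
      (2 - ρ) / ρ * w ω ^ 2 := by positivity
    linarith
  have i1 := ha.integrable_sq.const_mul (1 - ρ)
  have i2 := hv.integrable_sq.const_mul (2 * ρ ^ 2)
  have i3 := hw.integrable_sq.const_mul (3 / ρ)
  have i4 : Integrable (fun ω => 2 * ρ * (1 - ρ) * (a ω * v ω)) μ :=
    (ha.integrable_mul hv).const_mul _
  have hL : MemLp (fun ω => (1 - ρ) * a ω + ρ * v ω + w ω) 2 μ :=
    ((ha.const_mul _).add (hv.const_mul _)).add hw
  refine (integral_mono hL.integrable_sq (((i1.add i2).add i3).add i4) hpt).trans (le_of_eq ?_)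
  have e1 := integral_add ((i1.add i2).add i3) i4
  have e2 := integral_add (i1.add i2) i3
  have e3 := integral_add i1 i2
  simp only [Pi.add_apply] at e1 e2 e3
  simp only [Pi.add_apply]
  rw [e1, e2, e3, integral_const_mul, integral_const_mul, integral_const_mul, integral_const_mul,
    hav]
  ring

section Past

variable {Ω Z β : Type*} [MeasurableSpace Ω] [MeasurableSpace Z] [MeasurableSpace β] {TH : ℕ}
  {Pr : Measure Ω} [IsProbabilityMeasure Pr] {ξ : ℕ → Fin TH → Ω → Z} {t : ℕ}
  {μ : Measure Z} [IsProbabilityMeasure μ]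

namespace PastMeas

lemma lintegral_prodMk {f : Ω → β} (hf : PastMeas Pr ξ t f)
    (hξ : ∀ t i, Measurable (ξ t i))
    (hind : iIndepFun (fun ti : ℕ × Fin TH => ξ ti.1 ti.2) Pr)
    (hμ : ∀ t i, Pr.map (ξ t i) = μ) (i : Fin TH) {g : β × Z → ℝ≥0∞} (hg : Measurable g) :
    ∫⁻ ω, g (f ω, ξ t i ω) ∂Pr = ∫⁻ ω, ∫⁻ z, g (f ω, z) ∂μ ∂Pr := by
  have hfm := hf.aemeasurable hξ
  rw [← lintegral_map' hg.aemeasurable (hfm.prodMk (hξ t i).aemeasurable),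
    hf.map_prodMk hξ hind hμ i, lintegral_prod _ hg.aemeasurable,
    lintegral_map' hg.lintegral_prod_right'.aemeasurable hfm]

lemma integral_prodMk {f : Ω → β} (hf : PastMeas Pr ξ t f)
    (hξ : ∀ t i, Measurable (ξ t i))
    (hind : iIndepFun (fun ti : ℕ × Fin TH => ξ ti.1 ti.2) Pr)
    (hμ : ∀ t i, Pr.map (ξ t i) = μ) (i : Fin TH) {g : β × Z → ℝ} (hg : Measurable g)
    (hint : Integrable (fun ω => g (f ω, ξ t i ω)) Pr) :
    ∫ ω, g (f ω, ξ t i ω) ∂Pr = ∫ ω, ∫ z, g (f ω, z) ∂μ ∂Pr := by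
  have hfm := hf.aemeasurable hξ
  have hpm := hfm.prodMk (hξ t i).aemeasurable
  have := Measure.isProbabilityMeasure_map hfm
  have hint' : Integrable g ((Pr.map f).prod μ) := by
    rw [← hf.map_prodMk hξ hind hμ i]
    exact (integrable_map_measure hg.aestronglyMeasurable hpm).2 hint
  rw [← integral_map hpm hg.aestronglyMeasurable, hf.map_prodMk hξ hind hμ i,
    integral_prod _ hint', integral_map hfm]
  exact hg.stronglyMeasurable.integral_prod_right'.aestronglyMeasurable

variable {s : Set β} {φ : β × Z → ℝ} {B : ℝ≥0} {f : Ω → β}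

lemma _root_.RCSHP.lintegral_enorm_sq_le {μ : Measure Z} {g : Z → ℝ} (h : eLpNorm g 2 μ ≤ B) :
    ∫⁻ z, ‖g z‖ₑ ^ 2 ∂μ ≤ (B : ℝ≥0∞) ^ 2 := by
  rw [eLpNorm_eq_lintegral_rpow_enorm_toReal two_ne_zero ENNReal.ofNat_ne_top] at h
  have h2 := ENNReal.rpow_le_rpow h (z := 2) (by norm_num)
  rw [← ENNReal.rpow_mul] at h2
  simpa using h2

/-- A square integrable function of the past, multiplied by a function of the past and of a fresh
sample with uniformly bounded second moments, is square integrable. -/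
lemma memLp_mul (hf : PastMeas Pr ξ t f) (hξ : ∀ t i, Measurable (ξ t i))
    (hind : iIndepFun (fun ti : ℕ × Fin TH => ξ ti.1 ti.2) Pr)
    (hμ : ∀ t i, Pr.map (ξ t i) = μ) (hfs : ∀ ω, f ω ∈ s) (hφ : Measurable φ)
    (hB : ∀ b ∈ s, eLpNorm (fun z => φ (b, z)) 2 μ ≤ B) {a : Ω → ℝ} (ha : PastMeas Pr ξ t a)
    (ha2 : MemLp a 2 Pr) (i : Fin TH) :
    MemLp (fun ω => a ω * φ (f ω, ξ t i ω)) 2 Pr ∧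
      ∫ ω, (a ω * φ (f ω, ξ t i ω)) ^ 2 ∂Pr ≤ B ^ 2 * ∫ ω, a ω ^ 2 ∂Pr := by
  have hm : AEMeasurable (fun ω => a ω * φ (f ω, ξ t i ω)) Pr :=
    (ha.aemeasurable hξ).mul
      (hφ.comp_aemeasurable ((hf.aemeasurable hξ).prodMk (hξ t i).aemeasurable))
  have key : ∫⁻ ω, ‖a ω * φ (f ω, ξ t i ω)‖ₑ ^ 2 ∂Pr ≤ (B : ℝ≥0∞) ^ 2 * ∫⁻ ω, ‖a ω‖ₑ ^ 2 ∂Pr := by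
    have h1 := (ha.prodMk hf).lintegral_prodMk hξ hind hμ i
      (g := fun p : (ℝ × β) × Z => ‖p.1.1 * φ (p.1.2, p.2)‖ₑ ^ 2) (by fun_prop)
    simp only at h1
    rw [h1, ← lintegral_const_mul'' _ ((ha.aemeasurable hξ).enorm.pow_const 2)]
    refine lintegral_mono fun ω => ?_
    simp only [enorm_mul, mul_pow]
    rw [lintegral_const_mul' _ _ (by simp), mul_comm]
    gcongr
    exact lintegral_enorm_sq_le (hB _ (hfs ω))
  have hsq : ∀ g : Ω → ℝ, ∀ ω, ENNReal.ofReal (g ω ^ 2) = ‖g ω‖ₑ ^ 2 := fun g ω => by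
    rw [← enorm_pow, Real.enorm_eq_ofReal (sq_nonneg _)]
  have hafin : ∫⁻ ω, ‖a ω‖ₑ ^ 2 ∂Pr = ENNReal.ofReal (∫ ω, a ω ^ 2 ∂Pr) := by
    rw [ofReal_integral_eq_lintegral_ofReal ha2.integrable_sq
      (Eventually.of_forall fun ω => sq_nonneg _)]
    simp only [hsq]
  have hmem : MemLp (fun ω => a ω * φ (f ω, ξ t i ω)) 2 Pr := by
    rw [memLp_two_iff_integrable_sq hm.aestronglyMeasurable]
    refine ⟨(hm.pow_const 2).aestronglyMeasurable, ?_⟩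
    rw [hasFiniteIntegral_iff_enorm]
    simp only [enorm_pow]
    refine key.trans_lt (ENNReal.mul_lt_top (by simp) ?_)
    rw [hafin]
    exact ENNReal.ofReal_lt_top
  refine ⟨hmem, ?_⟩
  rw [← ENNReal.ofReal_le_ofReal_iff (by positivity), ofReal_integral_eq_lintegral_ofReal
    hmem.integrable_sq (Eventually.of_forall fun ω => sq_nonneg _), ENNReal.ofReal_mul (by positivity),
    ← hafin, ENNReal.ofReal_pow NNReal.zero_le_coe, ENNReal.ofReal_coe_nnreal]
  simp only [hsq fun ω => a ω * φ (f ω, ξ t i ω)]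
  exact key

/-- An integrable function of the past is orthogonal to centred fresh noise. -/
lemma integral_mul_centred (hf : PastMeas Pr ξ t f) (hξ : ∀ t i, Measurable (ξ t i))
    (hind : iIndepFun (fun ti : ℕ × Fin TH => ξ ti.1 ti.2) Pr)
    (hμ : ∀ t i, Pr.map (ξ t i) = μ) (hfs : ∀ ω, f ω ∈ s) (hφ : Measurable φ)
    (hB : ∀ b ∈ s, eLpNorm (fun z => φ (b, z)) 2 μ ≤ B) (h0 : ∀ b ∈ s, ∫ z, φ (b, z) ∂μ = 0)
    {a : Ω → ℝ} (ha : PastMeas Pr ξ t a) (ha1 : Integrable a Pr) (i : Fin TH) :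
    Integrable (fun ω => a ω * φ (f ω, ξ t i ω)) Pr ∧
      ∫ ω, a ω * φ (f ω, ξ t i ω) ∂Pr = 0 := by
  have hm : AEMeasurable (fun ω => a ω * φ (f ω, ξ t i ω)) Pr :=
    (ha.aemeasurable hξ).mul
      (hφ.comp_aemeasurable ((hf.aemeasurable hξ).prodMk (hξ t i).aemeasurable))
  -- Integrability of `a` suffices: given the past, the mean of `|φ|` is at most its `L²` norm,
  -- hence at most `B`.
  have hint : Integrable (fun ω => a ω * φ (f ω, ξ t i ω)) Pr := by
    refine ⟨hm.aestronglyMeasurable, ?_⟩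
    rw [hasFiniteIntegral_iff_enorm]
    have h1 := (ha.prodMk hf).lintegral_prodMk hξ hind hμ i
      (g := fun p : (ℝ × β) × Z => ‖p.1.1 * φ (p.1.2, p.2)‖ₑ) (by fun_prop)
    simp only at h1
    rw [h1]
    have h2 : ∫⁻ ω, ∫⁻ z, ‖a ω * φ (f ω, z)‖ₑ ∂μ ∂Pr ≤ ∫⁻ ω, ‖a ω‖ₑ * B ∂Pr := by
      refine lintegral_mono fun ω => ?_
      simp only [enorm_mul]
      rw [lintegral_const_mul' _ _ (by simp)]
      gcongr
      rw [← eLpNorm_one_eq_lintegral_enorm]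
      refine (eLpNorm_le_eLpNorm_of_exponent_le one_le_two ?_).trans (hB _ (hfs ω))
      exact (hφ.comp measurable_prodMk_left).aestronglyMeasurable
    refine h2.trans_lt ?_
    rw [lintegral_mul_const'' _ (ha.aemeasurable hξ).enorm]
    exact ENNReal.mul_lt_top ha1.2 ENNReal.coe_lt_top
  refine ⟨hint, ?_⟩
  have h3 := (ha.prodMk hf).integral_prodMk hξ hind hμ i
    (g := fun p : (ℝ × β) × Z => p.1.1 * φ (p.1.2, p.2)) (by fun_prop) hint
  simp only at h3
  rw [h3]
  simp only [integral_const_mul, h0 _ (hfs _), mul_zero, integral_zero]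

/-- Weighted batch averages of centred fresh noise: square integrability, second moments and
orthogonality to the past. -/
lemma batch_noise (hf : PastMeas Pr ξ t f) (hξ : ∀ t i, Measurable (ξ t i))
    (hind : iIndepFun (fun ti : ℕ × Fin TH => ξ ti.1 ti.2) Pr)
    (hμ : ∀ t i, Pr.map (ξ t i) = μ) (hTH : 0 < TH) (hfs : ∀ ω, f ω ∈ s) (hφ : Measurable φ)
    (hB : ∀ b ∈ s, eLpNorm (fun z => φ (b, z)) 2 μ ≤ B) (h0 : ∀ b ∈ s, ∫ z, φ (b, z) ∂μ = 0)
    {a : Ω → ℝ} (ha : PastMeas Pr ξ t a) (ha2 : MemLp a 2 Pr) :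
    MemLp (fun ω => ∑ i, (TH : ℝ)⁻¹ * (a ω * φ (f ω, ξ t i ω))) 2 Pr ∧
      ∫ ω, (∑ i, (TH : ℝ)⁻¹ * (a ω * φ (f ω, ξ t i ω))) ^ 2 ∂Pr ≤ B ^ 2 * ∫ ω, a ω ^ 2 ∂Pr ∧
      ∀ b : Ω → ℝ, PastMeas Pr ξ t b → MemLp b 2 Pr →
        ∫ ω, b ω * ∑ i, (TH : ℝ)⁻¹ * (a ω * φ (f ω, ξ t i ω)) ∂Pr = 0 := by
  have hmul := fun i => hf.memLp_mul hξ hind hμ hfs hφ hB ha ha2 i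
  have hTH' : (TH : ℝ) ≠ 0 := by exact_mod_cast hTH.ne'
  have hmem : MemLp (fun ω => ∑ i, (TH : ℝ)⁻¹ * (a ω * φ (f ω, ξ t i ω))) 2 Pr :=
    memLp_finsetSum _ fun i _ => (hmul i).1.const_mul _
  refine ⟨hmem, ?_, fun b hb hb2 => ?_⟩
  · have hpt : ∀ ω, (∑ i, (TH : ℝ)⁻¹ * (a ω * φ (f ω, ξ t i ω))) ^ 2 ≤
        ∑ i, (TH : ℝ)⁻¹ * (a ω * φ (f ω, ξ t i ω)) ^ 2 := by
      intro ω
      have hx : ∀ x : Fin TH → ℝ, (∑ i, (TH : ℝ)⁻¹ * x i) ^ 2 ≤ ∑ i, (TH : ℝ)⁻¹ * x i ^ 2 := by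
        intro x
        rw [← Finset.mul_sum, ← Finset.mul_sum, mul_pow]
        have := sq_sum_le_card_mul_sum_sq (s := (Finset.univ : Finset (Fin TH))) (f := x)
        rw [Finset.card_univ, Fintype.card_fin] at this
        calc _ ≤ ((TH : ℝ)⁻¹) ^ 2 * (TH * ∑ i, x i ^ 2) := by gcongr
          _ = _ := by rw [sq, ← mul_assoc, mul_assoc _ _ (TH : ℝ), inv_mul_cancel₀ hTH', mul_one]
      exact hx _
    have hint : ∀ i : Fin TH, Integrable (fun ω => (TH : ℝ)⁻¹ * (a ω * φ (f ω, ξ t i ω)) ^ 2) Pr :=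
      fun i => (hmul i).1.integrable_sq.const_mul _
    refine (integral_mono hmem.integrable_sq (integrable_finsetSum _ fun i _ => hint i) hpt).trans ?_
    rw [integral_finsetSum _ fun i _ => hint i]
    simp only [integral_const_mul]
    refine (Finset.sum_le_sum fun i _ => mul_le_mul_of_nonneg_left (hmul i).2
      (by positivity : 0 ≤ (TH : ℝ)⁻¹)).trans ?_
    rw [Finset.sum_const, Finset.card_univ, Fintype.card_fin, nsmul_eq_mul, ← mul_assoc,
      mul_inv_cancel₀ hTH', one_mul]
  · have hba : PastMeas Pr ξ t fun ω => b ω * a ω :=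
      (hb.prodMk ha).comp (φ := fun p : ℝ × ℝ => p.1 * p.2) (by fun_prop)
    have hc := fun i => hf.integral_mul_centred hξ hind hμ hfs hφ hB h0 hba
      (hb2.integrable_mul ha2) i
    simp only [Finset.mul_sum]
    have e : ∀ i ω, b ω * ((TH : ℝ)⁻¹ * (a ω * φ (f ω, ξ t i ω))) =
        (TH : ℝ)⁻¹ * (b ω * a ω * φ (f ω, ξ t i ω)) := fun i ω => by ring
    simp only [e]
    rw [integral_finsetSum _ fun i _ => (hc i).1.const_mul _]
    simp only [integral_const_mul, (hc _).2, mul_zero, Finset.sum_const_zero]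

end PastMeas

/-- Centring at most doubles the `L²` norm. -/
lemma eLpNorm_centred_le {g : Z → ℝ} {B : ℝ≥0} (hg : AEStronglyMeasurable g μ)
    (hB : eLpNorm g 2 μ ≤ B) :
    eLpNorm (fun z => g z - ∫ y, g y ∂μ) 2 μ ≤ (2 * B : ℝ≥0) ∧
      ∫ z, (g z - ∫ y, g y ∂μ) ∂μ = 0 := by
  have hL : MemLp g 2 μ := ⟨hg, hB.trans_lt ENNReal.coe_lt_top⟩
  have hi : Integrable g μ := memLp_one_iff_integrable.1 (hL.mono_exponent one_le_two)
  constructor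
  · refine (eLpNorm_sub_le hg aestronglyMeasurable_const one_le_two).trans ?_
    rw [two_mul, ENNReal.coe_add]
    refine add_le_add hB ?_
    rw [eLpNorm_const _ two_ne_zero (IsProbabilityMeasure.ne_zero μ)]
    simp only [measure_univ, ENNReal.one_rpow, mul_one]
    refine (enorm_integral_le_lintegral_enorm g).trans ?_
    rw [← eLpNorm_one_eq_lintegral_enorm]
    exact (eLpNorm_le_eLpNorm_of_exponent_le one_le_two hg).trans hB
  · rw [integral_sub hi (integrable_const _)]
    simp

end Past

end RCSHP

/-! ### Mean square recursion for the rate estimates -/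

namespace RCSHP

noncomputable section

variable {K M S Tp L TH : ℕ} {sys : System K M S Tp} {U : EuclideanSpace ℝ (Fin K) → ℝ}
  {ρ γ : ℕ → ℝ} {τq τΓ : ℝ} {Γ₀ : Fin L → Ctrl K M S} {q₀ : EuclideanSpace ℝ (Fin L)}

/-! ### Estimation errors along a run -/

/-- Error of the recursive rate estimates. -/
def Run.rateErr (sys : System K M S Tp) (X : Run K M S L) (t : ℕ) : Fin K → Fin L → ℝ :=
  fun k l => prev X.rhat t k l - sys.meanRate k (X.Γ t l)

/-- Error of the auxiliary gradient estimates. -/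
def Run.gradErr (sys : System K M S Tp) (U : EuclideanSpace ℝ (Fin K) → ℝ) (ρ : ℕ → ℝ)
    (X : Run K M S L) (ω : ℕ → Fin TH → State K M Tp) (t : ℕ) (l : Fin L) : Ctrl K M S :=
  X.auxGrad sys U ρ ω t l - sys.ctrlGrad U (X.Γ t) (X.q t) l

/-- Distance between the recursive and the auxiliary gradient estimates. -/
def Run.auxErr (sys : System K M S Tp) (U : EuclideanSpace ℝ (Fin K) → ℝ) (ρ : ℕ → ℝ)
    (X : Run K M S L) (ω : ℕ → Fin TH → State K M Tp) (t : ℕ) (l : Fin L) : ℝ :=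
  ‖prev X.grad t l - X.auxGrad sys U ρ ω t l‖

/-- Squared length of the search direction. -/
def Run.stepSq (X : Run K M S L) (t : ℕ) : ℝ :=
  ∑ l, ‖X.Γbar t l - X.Γ t l‖ ^ 2 + ‖X.qbar t - X.q t‖ ^ 2

lemma Run.stepSq_nonneg (X : Run K M S L) (t : ℕ) : 0 ≤ X.stepSq t := by
  unfold Run.stepSq; positivity

/-- Centred rates. -/
def System.centredRate (sys : System K M S Tp) (k : Fin K) (p : Ctrl K M S × State K M Tp) : ℝ :=
  sys.rate k p.1 p.2 - sys.meanRate k p.1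

/-- Centred partial derivatives of the rates. -/
def System.centredPartial (sys : System K M S Tp) (k : Fin K) (j : (Fin M × Fin S) ⊕ Fin K)
    (p : Ctrl K M S × State K M Tp) : ℝ :=
  sys.ratePartial k j p - ∫ z, sys.ratePartial k j (p.1, z) ∂sys.stateLaw

lemma System.measurable_centredRate (sys : System K M S Tp) [IsProbabilityMeasure sys.channelLaw]
    (k : Fin K) : Measurable (sys.centredRate k) :=
  (sys.measurable_rate k).sub ((sys.measurable_meanRate k).comp measurable_fst)

lemma System.measurable_centredPartial (sys : System K M S Tp)
    [IsProbabilityMeasure sys.channelLaw] (k : Fin K) (j : (Fin M × Fin S) ⊕ Fin K) :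
    Measurable (sys.centredPartial k j) := by
  have h1 : Measurable fun x : Ctrl K M S => ∫ z, sys.ratePartial k j (x, z) ∂sys.stateLaw :=
    (StronglyMeasurable.integral_prod_right'
      (sys.measurable_ratePartial k j).stronglyMeasurable).measurable
  exact (sys.measurable_ratePartial k j).sub (h1.comp measurable_fst)

/-- A common bound for the second moments of the rates and of their partial derivatives. -/
structure System.MomentBound (sys : System K M S Tp) (B : ℝ≥0) : Prop where
  centredRate : ∀ k, ∀ x ∈ sys.ctrlSet,
    eLpNorm (fun z => sys.centredRate k (x, z)) 2 sys.stateLaw ≤ B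
  integral_centredRate : ∀ k, ∀ x ∈ sys.ctrlSet,
    ∫ z, sys.centredRate k (x, z) ∂sys.stateLaw = 0
  partialDeriv : ∀ k j, ∀ x ∈ sys.ctrlSet,
    eLpNorm (fun z => sys.ratePartial k j (x, z)) 2 sys.stateLaw ≤ B
  integral_partialDeriv : ∀ k j, ∀ x ∈ sys.ctrlSet,
    ∫ z, sys.ratePartial k j (x, z) ∂sys.stateLaw = sys.meanGrad k x j
  centredPartial : ∀ k j, ∀ x ∈ sys.ctrlSet,
    eLpNorm (fun z => sys.centredPartial k j (x, z)) 2 sys.stateLaw ≤ B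
  integral_centredPartial : ∀ k j, ∀ x ∈ sys.ctrlSet,
    ∫ z, sys.centredPartial k j (x, z) ∂sys.stateLaw = 0

lemma System.RegularRates.exists_momentBound [IsProbabilityMeasure sys.channelLaw]
    (hreg : sys.RegularRates) (hP : 0 < sys.Pmax) : ∃ B, sys.MomentBound B := by
  obtain ⟨B₁, h₁⟩ := hreg.eLpNorm_rate_le hP
  obtain ⟨B₂, h₂⟩ := hreg.exists_ratePartial_bound hP
  have m1 : ∀ k x, AEStronglyMeasurable (fun z => sys.rate k x z) sys.stateLaw := fun k x =>
    ((sys.measurable_rate k).comp measurable_prodMk_left).aestronglyMeasurable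
  have m2 : ∀ k j x, AEStronglyMeasurable (fun z => sys.ratePartial k j (x, z)) sys.stateLaw :=
    fun k j x => ((sys.measurable_ratePartial k j).comp measurable_prodMk_left).aestronglyMeasurable
  have e1 : (2 * B₁ : ℝ≥0) ≤ 2 * B₁ + 2 * B₂ := le_self_add
  have e2 : (2 * B₂ : ℝ≥0) ≤ 2 * B₁ + 2 * B₂ := le_add_self
  have e3 : B₂ ≤ 2 * B₁ + 2 * B₂ := le_trans (by rw [two_mul]; exact le_self_add) e2
  exact ⟨2 * B₁ + 2 * B₂,
    fun k x hx => (eLpNorm_centred_le (m1 k x) (h₁ k x hx)).1.trans (ENNReal.coe_le_coe.2 e1),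
    fun k x hx => (eLpNorm_centred_le (m1 k x) (h₁ k x hx)).2,
    fun k j x hx => (h₂ k j x hx).1.trans (ENNReal.coe_le_coe.2 e3),
    fun k j x hx => (h₂ k j x hx).2,
    fun k j x hx => (eLpNorm_centred_le (m2 k j x) (h₂ k j x hx).1).1.trans
      (ENNReal.coe_le_coe.2 e2),
    fun k j x hx => (eLpNorm_centred_le (m2 k j x) (h₂ k j x hx).1).2⟩

namespace SampledRun

variable {Ω : Type*} [MeasurableSpace Ω] {Pr : Measure Ω} [IsProbabilityMeasure Pr]
  {ξ : ℕ → Fin TH → Ω → State K M Tp} {X : Ω → Run K M S L} {c : ℝ} {B : ℝ≥0}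

omit [IsProbabilityMeasure Pr] in
lemma norm_ctrl_step_le (h : SampledRun sys U ρ γ τq τΓ Γ₀ q₀ Pr ξ X) (t : ℕ) (ω : Ω)
    (l : Fin L) : ‖(X ω).Γ (t + 1) l - (X ω).Γ t l‖ ≤ γ t * √((X ω).stepSq t) := by
  have e : (X ω).Γ (t + 1) l - (X ω).Γ t l = γ t • ((X ω).Γbar t l - (X ω).Γ t l) := by
    rw [(h.run ω).Γ_succ]; module
  rw [e, norm_smul, Real.norm_of_nonneg (h.gamma_mem t).1.le]
  refine mul_le_mul_of_nonneg_left (Real.le_sqrt_of_sq_le ?_) (h.gamma_mem t).1.le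
  have := Finset.single_le_sum (f := fun l => ‖(X ω).Γbar t l - (X ω).Γ t l‖ ^ 2)
    (fun _ _ => by positivity) (Finset.mem_univ l)
  have h2 : 0 ≤ ‖(X ω).qbar t - (X ω).q t‖ ^ 2 := by positivity
  unfold Run.stepSq
  linarith

omit [IsProbabilityMeasure Pr] in
lemma norm_share_step_le (h : SampledRun sys U ρ γ τq τΓ Γ₀ q₀ Pr ξ X) (t : ℕ) (ω : Ω) :
    ‖(X ω).q (t + 1) - (X ω).q t‖ ≤ γ t * √((X ω).stepSq t) := by
  have e : (X ω).q (t + 1) - (X ω).q t = γ t • ((X ω).qbar t - (X ω).q t) := by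
    rw [(h.run ω).q_succ]; module
  rw [e, norm_smul, Real.norm_of_nonneg (h.gamma_mem t).1.le]
  refine mul_le_mul_of_nonneg_left (Real.le_sqrt_of_sq_le ?_) (h.gamma_mem t).1.le
  unfold Run.stepSq
  have : 0 ≤ ∑ l, ‖(X ω).Γbar t l - (X ω).Γ t l‖ ^ 2 := by positivity
  linarith

omit [IsProbabilityMeasure Pr] in
lemma stepSq_le (h : SampledRun sys U ρ γ τq τΓ Γ₀ q₀ Pr ξ X) (hc : sys.Bounds U L c) (t : ℕ)
    (ω : Ω) : (X ω).stepSq t ≤ L * c ^ 2 + 4 := by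
  have h1 : ∀ l, ‖(X ω).Γbar t l - (X ω).Γ t l‖ ^ 2 ≤ c ^ 2 := fun l =>
    pow_le_pow_left₀ (norm_nonneg _)
      (hc.norm_sub_le _ ((h.run ω).Γbar_mem t l) _ ((h.feasible t ω).1 l)) 2
  have h2 : ‖(X ω).qbar t - (X ω).q t‖ ≤ 2 := by
    linarith [norm_sub_le ((X ω).qbar t) ((X ω).q t),
      norm_le_one_of_mem_shareSet ((h.run ω).qbar_mem t),
      norm_le_one_of_mem_shareSet (h.feasible t ω).2]
  have h3 := pow_le_pow_left₀ (norm_nonneg _) h2 2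
  have h4 := Finset.sum_le_sum fun l (_ : l ∈ Finset.univ) => h1 l
  simp only [Finset.sum_const, Finset.card_univ, Fintype.card_fin, nsmul_eq_mul] at h4
  unfold Run.stepSq
  linarith

lemma pastMeas_stepSq (h : SampledRun sys U ρ γ τq τΓ Γ₀ q₀ Pr ξ X) (t : ℕ) :
    PastMeas Pr ξ (t + 1) fun ω => (X ω).stepSq t := by
  have h0 := h.stateMeas t
  have h1 := h.stateMeas (t + 1)
  have hb := fun l => h.pastMeas_ctrlBar (h1.grad l) (h0.ctrl l).succ
  have hq := h.pastMeas_shareBar h1.rate h0.share.succ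
    fun ω => (h.run ω).prev_rhat_nonneg h.rho_mem (fun t => h.feasible t ω) (t + 1)
  have hs : PastMeas Pr ξ (t + 1) fun ω => ∑ l, ‖(X ω).Γbar t l - (X ω).Γ t l‖ ^ 2 :=
    PastMeas.finsetSum _ fun l => ((hb l).prodMk (h0.ctrl l).succ).comp
      (φ := fun p : Ctrl K M S × Ctrl K M S => ‖p.1 - p.2‖ ^ 2) (by fun_prop)
  exact (hs.prodMk (hq.prodMk h0.share.succ)).comp
    (φ := fun p : ℝ × EuclideanSpace ℝ (Fin L) × EuclideanSpace ℝ (Fin L) =>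
      p.1 + ‖p.2.1 - p.2.2‖ ^ 2) (by fun_prop)

lemma integrable_stepSq (h : SampledRun sys U ρ γ τq τΓ Γ₀ q₀ Pr ξ X) (hc : sys.Bounds U L c)
    (t : ℕ) : Integrable (fun ω => (X ω).stepSq t) Pr := by
  refine Integrable.of_bound ((h.pastMeas_stepSq t).aemeasurable h.measurable).aestronglyMeasurable
    (L * c ^ 2 + 4) (Eventually.of_forall fun ω => ?_)
  rw [Real.norm_of_nonneg ((X ω).stepSq_nonneg t)]
  exact h.stepSq_le hc t ω

/-! ### The rate errors -/

omit [IsProbabilityMeasure Pr] in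
-- This splits the new estimate into its predictable part and `ρ t` times centred noise. The factor
-- `1 *` is the weight expected by `batch_noise`.
lemma rhat_eq_midTable (h : SampledRun sys U ρ γ τq τΓ Γ₀ q₀ Pr ξ X) (t : ℕ) (ω : Ω) (k : Fin K)
    (l : Fin L) : (X ω).rhat t k l = (X ω).midTable sys ρ t k l +
      ρ t * ∑ i, (TH : ℝ)⁻¹ * (1 * sys.centredRate k ((X ω).Γ t l, ξ t i ω)) := by
  have hTH : (TH : ℝ) ≠ 0 := by exact_mod_cast h.batch_pos.ne'
  rw [(h.run ω).rhat_eq, Run.midTable]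
  simp only [System.centredRate, one_mul, mul_sub, Finset.sum_sub_distrib, Finset.sum_const,
    Finset.card_univ, Fintype.card_fin, nsmul_eq_mul, div_eq_inv_mul]
  field_simp
  ring

omit [IsProbabilityMeasure Pr] in
-- Contraction, orthogonal noise and drift of the target, in the form of `integral_sq_recursion_le`.
-- The error at `t` pairs `r̂^{t-1}` with `Γ^t`, so it depends only on samples before iteration `t`,
-- and the noise of iteration `t` is orthogonal to it.
lemma rateErr_succ (h : SampledRun sys U ρ γ τq τΓ Γ₀ q₀ Pr ξ X) (t : ℕ) (ω : Ω) (k : Fin K)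
    (l : Fin L) : (X ω).rateErr sys (t + 1) k l = (1 - ρ t) * (X ω).rateErr sys t k l +
      ρ t * (∑ i, (TH : ℝ)⁻¹ * (1 * sys.centredRate k ((X ω).Γ t l, ξ t i ω))) +
      (sys.meanRate k ((X ω).Γ t l) - sys.meanRate k ((X ω).Γ (t + 1) l)) := by
  change (X ω).rhat t k l - _ = _
  rw [h.rhat_eq_midTable, Run.midTable, Run.rateErr]
  ring

lemma pastMeas_meanRate (h : SampledRun sys U ρ γ τq τΓ Γ₀ q₀ Pr ξ X) (t : ℕ) (k : Fin K)
    (l : Fin L) : PastMeas Pr ξ t fun ω => sys.meanRate k ((X ω).Γ t l) :=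
  have := h.prob
  ((h.stateMeas t).ctrl l).comp (sys.measurable_meanRate k)

lemma pastMeas_rateErr (h : SampledRun sys U ρ γ τq τΓ Γ₀ q₀ Pr ξ X) (t : ℕ) (k : Fin K)
    (l : Fin L) : PastMeas Pr ξ t fun ω => (X ω).rateErr sys t k l :=
  (((h.stateMeas t).rate k l).prodMk (h.pastMeas_meanRate t k l)).comp
    (φ := fun p : ℝ × ℝ => p.1 - p.2) (by fun_prop)

omit [IsProbabilityMeasure Pr] in
lemma abs_meanRate_le (h : SampledRun sys U ρ γ τq τΓ Γ₀ q₀ Pr ξ X) (hc : sys.Bounds U L c)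
    (t : ℕ) (ω : Ω) (k : Fin K) (l : Fin L) : |sys.meanRate k ((X ω).Γ t l)| ≤ c :=
  (abs_apply_le_norm (tableVec (sys.meanTable ((X ω).Γ t))) (k, l)).trans
    (hc.norm_table_le _ (h.feasible t ω).1)

lemma memLp_rateDrift (h : SampledRun sys U ρ γ τq τΓ Γ₀ q₀ Pr ξ X) (hc : sys.Bounds U L c)
    (t : ℕ) (k : Fin K) (l : Fin L) :
    MemLp (fun ω => sys.meanRate k ((X ω).Γ t l) - sys.meanRate k ((X ω).Γ (t + 1) l)) 2 Pr := by
  have hm : ∀ t, MemLp (fun ω => sys.meanRate k ((X ω).Γ t l)) 2 Pr := fun t =>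
    MemLp.of_bound ((h.pastMeas_meanRate t k l).aemeasurable h.measurable).aestronglyMeasurable c
      (Eventually.of_forall fun ω => h.abs_meanRate_le hc t ω k l)
  exact (hm t).sub (hm (t + 1))

lemma rateNoise (h : SampledRun sys U ρ γ τq τΓ Γ₀ q₀ Pr ξ X) (hB : sys.MomentBound B) (t : ℕ)
    (k : Fin K) (l : Fin L) :
    MemLp (fun ω => ∑ i, (TH : ℝ)⁻¹ * (1 * sys.centredRate k ((X ω).Γ t l, ξ t i ω))) 2 Pr ∧
      ∫ ω, (∑ i, (TH : ℝ)⁻¹ * (1 * sys.centredRate k ((X ω).Γ t l, ξ t i ω))) ^ 2 ∂Pr ≤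
        (B : ℝ) ^ 2 ∧
      ∀ b : Ω → ℝ, PastMeas Pr ξ t b → MemLp b 2 Pr →
        ∫ ω, b ω * ∑ i, (TH : ℝ)⁻¹ * (1 * sys.centredRate k ((X ω).Γ t l, ξ t i ω)) ∂Pr = 0 := by
  have := h.prob
  have := ((h.stateMeas t).ctrl l).batch_noise h.measurable h.indep h.law h.batch_pos
    (fun ω => (h.feasible t ω).1 l) (sys.measurable_centredRate k) (hB.centredRate k)
    (hB.integral_centredRate k) (a := fun _ => 1) (.const 1) (memLp_const 1)
  refine ⟨this.1, this.2.1.trans (le_of_eq ?_), this.2.2⟩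
  simp

lemma memLp_rateErr (h : SampledRun sys U ρ γ τq τΓ Γ₀ q₀ Pr ξ X) (hc : sys.Bounds U L c)
    (hB : sys.MomentBound B) (t : ℕ) (k : Fin K) (l : Fin L) :
    MemLp (fun ω => (X ω).rateErr sys t k l) 2 Pr := by
  induction t with
  | zero =>
    refine MemLp.of_bound
      ((h.pastMeas_rateErr 0 k l).aemeasurable h.measurable).aestronglyMeasurable c
      (Eventually.of_forall fun ω => ?_)
    have := h.abs_meanRate_le hc 0 ω k l
    simpa [Run.rateErr, prev] using this
  | succ t ih =>
    simp only [h.rateErr_succ]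
    exact ((ih.const_mul _).add ((h.rateNoise hB t k l).1.const_mul _)).add
      (h.memLp_rateDrift hc t k l)

/-- Mean square of the rate errors. -/
def _root_.RCSHP.meanRateErr (sys : System K M S Tp) (Pr : Measure Ω) (X : Ω → Run K M S L) (t : ℕ) :
    ℝ :=
  ∫ ω, ‖tableVec ((X ω).rateErr sys t)‖ ^ 2 ∂Pr

lemma integrable_rateErr_sq (h : SampledRun sys U ρ γ τq τΓ Γ₀ q₀ Pr ξ X) (hc : sys.Bounds U L c)
    (hB : sys.MomentBound B) (t : ℕ) :
    Integrable (fun ω => ‖tableVec ((X ω).rateErr sys t)‖ ^ 2) Pr := by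
  simp only [norm_tableVec_sq]
  exact integrable_finsetSum _ fun k _ => integrable_finsetSum _ fun l _ =>
    (h.memLp_rateErr hc hB t k l).integrable_sq

lemma meanRateErr_eq (h : SampledRun sys U ρ γ τq τΓ Γ₀ q₀ Pr ξ X) (hc : sys.Bounds U L c)
    (hB : sys.MomentBound B) (t : ℕ) :
    meanRateErr sys Pr X t = ∑ k, ∑ l, ∫ ω, (X ω).rateErr sys t k l ^ 2 ∂Pr := by
  have hi := fun k l => (h.memLp_rateErr hc hB t k l).integrable_sq
  simp only [meanRateErr, norm_tableVec_sq]
  rw [integral_finsetSum _ fun k _ => integrable_finsetSum _ fun l _ => hi k l]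
  exact Finset.sum_congr rfl fun k _ => integral_finsetSum _ fun l _ => hi k l

/-- The noise contributes `ρ²` times its variance. The drift is at most `c γ` times the length of
the search direction, and its square is weighted by `3/ρ`. -/
lemma meanRateErr_succ_le (h : SampledRun sys U ρ γ τq τΓ Γ₀ q₀ Pr ξ X) (hc : sys.Bounds U L c)
    (hB : sys.MomentBound B) :
    ∃ C ≥ 0, ∀ t, meanRateErr sys Pr X (t + 1) ≤ (1 - ρ t) * meanRateErr sys Pr X t +
      C * ρ t ^ 2 + C * (γ t ^ 2 / ρ t) * ∫ ω, (X ω).stepSq t ∂Pr := by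
  have hc0 := hc.nonneg
  refine ⟨K * L * (2 * B ^ 2 + 3 * c ^ 2), by positivity, fun t => ?_⟩
  have hρ := h.rho_mem t
  have hD : 0 ≤ ∫ ω, (X ω).stepSq t ∂Pr := integral_nonneg fun ω => (X ω).stepSq_nonneg t
  have hkl : ∀ k l, ∫ ω, (X ω).rateErr sys (t + 1) k l ^ 2 ∂Pr ≤
      (1 - ρ t) * ∫ ω, (X ω).rateErr sys t k l ^ 2 ∂Pr + (2 * ρ t ^ 2 * B ^ 2 +
        3 / ρ t * (c ^ 2 * γ t ^ 2 * ∫ ω, (X ω).stepSq t ∂Pr)) := by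
    intro k l
    obtain ⟨n1, n2, n3⟩ := h.rateNoise hB t k l
    have ha := h.memLp_rateErr hc hB t k l
    have hw := h.memLp_rateDrift hc t k l
    simp only [h.rateErr_succ]
    refine (integral_sq_recursion_le ha n1 hw (n3 _ (h.pastMeas_rateErr t k l) ha) hρ).trans ?_
    rw [add_assoc]
    have e1 : ∫ ω, (sys.meanRate k ((X ω).Γ t l) - sys.meanRate k ((X ω).Γ (t + 1) l)) ^ 2 ∂Pr ≤
        c ^ 2 * γ t ^ 2 * ∫ ω, (X ω).stepSq t ∂Pr := by
      rw [← integral_const_mul]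
      refine integral_mono hw.integrable_sq ((h.integrable_stepSq hc t).const_mul _) fun ω => ?_
      have h1 := hc.meanRate_lip k _ ((h.feasible t ω).1 l) _ ((h.feasible (t + 1) ω).1 l)
      have h2 : |sys.meanRate k ((X ω).Γ (t + 1) l) - sys.meanRate k ((X ω).Γ t l)| ≤
          c * (γ t * √((X ω).stepSq t)) :=
        h1.trans (mul_le_mul_of_nonneg_left (h.norm_ctrl_step_le t ω l) hc0)
      have h3 := pow_le_pow_left₀ (abs_nonneg _) h2 2
      rw [sq_abs, mul_pow, mul_pow, Real.sq_sqrt ((X ω).stepSq_nonneg t)] at h3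
      simp only
      linarith
    have : 0 ≤ 3 / ρ t := div_nonneg (by norm_num) hρ.1.le
    gcongr
  rw [h.meanRateErr_eq hc hB, h.meanRateErr_eq hc hB]
  set D := ∫ ω, (X ω).stepSq t ∂Pr
  obtain ⟨Y, hY⟩ : ∃ Y, Y = 2 * ρ t ^ 2 * B ^ 2 + 3 / ρ t * (c ^ 2 * γ t ^ 2 * D) := ⟨_, rfl⟩
  rw [← hY] at hkl
  refine (Finset.sum_le_sum fun k _ => Finset.sum_le_sum fun l _ => hkl k l).trans ?_
  simp only [Finset.sum_add_distrib, ← Finset.mul_sum, Finset.sum_const, Finset.card_univ,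
    Fintype.card_fin, nsmul_eq_mul]
  have hr : 0 ≤ γ t ^ 2 / ρ t * D := mul_nonneg (div_nonneg (sq_nonneg _) hρ.1.le) hD
  have e2 : 3 / ρ t * (c ^ 2 * γ t ^ 2 * D) = 3 * c ^ 2 * (γ t ^ 2 / ρ t * D) := by ring
  rw [hY, e2]
  have f1 : 0 ≤ (K : ℝ) * L * (3 * c ^ 2) * ρ t ^ 2 := by positivity
  have f2 : 0 ≤ (K : ℝ) * L * (2 * B ^ 2) * (γ t ^ 2 / ρ t * D) := by positivity
  linarith

end SampledRun

end

end RCSHP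

/-! ### Mean square recursion for the auxiliary gradient estimates -/

namespace RCSHP

noncomputable section

variable {K M S Tp L TH : ℕ} {sys : System K M S Tp} {U : EuclideanSpace ℝ (Fin K) → ℝ}
  {ρ γ : ℕ → ℝ} {τq τΓ : ℝ} {Γ₀ : Fin L → Ctrl K M S} {q₀ : EuclideanSpace ℝ (Fin L)}

/-! ### The gradient errors -/

/-- Perturbation in the recursion of the gradient errors. -/
def Run.gradDrift (sys : System K M S Tp) (U : EuclideanSpace ℝ (Fin K) → ℝ) (ρ : ℕ → ℝ)
    (X : Run K M S L) (t : ℕ) (l : Fin L) (j : (Fin M × Fin S) ⊕ Fin K) : ℝ :=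
  ρ t * ∑ k, (X.midWeight sys U ρ t k l - X.q t l * utilGrad U (sys.avgRate (X.Γ t) (X.q t)) k) *
    sys.meanGrad k (X.Γ t l) j -
  (sys.ctrlGrad U (X.Γ (t + 1)) (X.q (t + 1)) l - sys.ctrlGrad U (X.Γ t) (X.q t) l) j

namespace SampledRun

variable {Ω : Type*} [MeasurableSpace Ω] {Pr : Measure Ω} [IsProbabilityMeasure Pr]
  {ξ : ℕ → Fin TH → Ω → State K M Tp} {X : Ω → Run K M S L} {c : ℝ} {B : ℝ≥0}

omit [IsProbabilityMeasure Pr] in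
-- The weights are known before the samples are drawn, so the centred partial derivatives, so
-- weighted, are noise orthogonal to the past. What remains is collected in `gradDrift`: the weights
-- differ from the true ones, and the target gradient moves.
lemma gradErr_succ (h : SampledRun sys U ρ γ τq τΓ Γ₀ q₀ Pr ξ X) (hB : sys.MomentBound B) (t : ℕ)
    (ω : Ω) (l : Fin L) (j : (Fin M × Fin S) ⊕ Fin K) :
    (X ω).gradErr sys U ρ (fun t i => ξ t i ω) (t + 1) l j =
      (1 - ρ t) * (X ω).gradErr sys U ρ (fun t i => ξ t i ω) t l j +
      ρ t * (∑ k, ∑ i, (TH : ℝ)⁻¹ * ((X ω).midWeight sys U ρ t k l *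
        sys.centredPartial k j ((X ω).Γ t l, ξ t i ω))) +
      (X ω).gradDrift sys U ρ t l j := by
  have hTH : (TH : ℝ) ≠ 0 := by exact_mod_cast h.batch_pos.ne'
  have h1 : (X ω).auxGrad sys U ρ (fun t i => ξ t i ω) (t + 1) l j =
      (1 - ρ t) * (X ω).auxGrad sys U ρ (fun t i => ξ t i ω) t l j +
      ρ t * ∑ i, (TH : ℝ)⁻¹ * ∑ k, (X ω).midWeight sys U ρ t k l *
        sys.ratePartial k j ((X ω).Γ t l, ξ t i ω) := by
    simp only [Run.auxGrad, PiLp.add_apply, PiLp.smul_apply, smul_eq_mul, WithLp.ofLp_sum,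
      Finset.sum_apply, System.rateGrad]
  have h2 : ∀ k i, sys.ratePartial k j ((X ω).Γ t l, ξ t i ω) =
      sys.centredPartial k j ((X ω).Γ t l, ξ t i ω) + sys.meanGrad k ((X ω).Γ t l) j := by
    intro k i
    rw [System.centredPartial, hB.integral_partialDeriv k j _ ((h.feasible t ω).1 l)]
    ring
  have h3 : sys.ctrlGrad U ((X ω).Γ t) ((X ω).q t) l j =
      ∑ k, (X ω).q t l * utilGrad U (sys.avgRate ((X ω).Γ t) ((X ω).q t)) k *
        sys.meanGrad k ((X ω).Γ t l) j := by
    simp only [System.ctrlGrad, PiLp.smul_apply, smul_eq_mul, WithLp.ofLp_sum, Finset.sum_apply]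
  have h4 : ∑ i, (TH : ℝ)⁻¹ * ∑ k, (X ω).midWeight sys U ρ t k l *
      sys.ratePartial k j ((X ω).Γ t l, ξ t i ω) =
      ∑ k, ∑ i, (TH : ℝ)⁻¹ * ((X ω).midWeight sys U ρ t k l *
        sys.centredPartial k j ((X ω).Γ t l, ξ t i ω)) +
      ∑ k, (X ω).midWeight sys U ρ t k l * sys.meanGrad k ((X ω).Γ t l) j := by
    simp only [h2, Finset.mul_sum]
    rw [Finset.sum_comm, ← Finset.sum_add_distrib]
    refine Finset.sum_congr rfl fun k _ => ?_
    simp only [mul_add, Finset.sum_add_distrib, Finset.sum_const, Finset.card_univ,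
      Fintype.card_fin, nsmul_eq_mul]
    rw [← mul_assoc (TH : ℝ), mul_inv_cancel₀ hTH, one_mul]
  rw [Run.gradErr, Run.gradErr, PiLp.sub_apply, PiLp.sub_apply, h1, h4, Run.gradDrift,
    PiLp.sub_apply, h3]
  simp only [sub_mul, Finset.sum_sub_distrib]
  ring

lemma pastMeas_midWeight (h : SampledRun sys U ρ γ τq τΓ Γ₀ q₀ Pr ξ X) (t : ℕ) (k : Fin K)
    (l : Fin L) : PastMeas Pr ξ t fun ω => (X ω).midWeight sys U ρ t k l := by
  have h0 := h.stateMeas t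
  have h1 : ∀ k l, PastMeas Pr ξ t fun ω => (X ω).midTable sys ρ t k l := fun k l =>
    ((h0.rate k l).prodMk (h.pastMeas_meanRate t k l)).comp
      (φ := fun p : ℝ × ℝ => (1 - ρ t) * p.1 + ρ t * p.2) (by fun_prop)
  have h2 := pastMeas_utilGrad h.utility h1 h0.share
    (fun ω => (h.run ω).midTable_nonneg h.rho_mem (fun t => h.feasible t ω) t)
    (fun ω l => ((h.feasible t ω).2.1 l).1) k
  exact (h0.share.prodMk h2).comp
    (φ := fun p : EuclideanSpace ℝ (Fin L) × ℝ => p.1 l * p.2) (by fun_prop)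

lemma pastMeas_ctrlGrad (h : SampledRun sys U ρ γ τq τΓ Γ₀ q₀ Pr ξ X) (t : ℕ) (l : Fin L) :
    PastMeas Pr ξ t fun ω => sys.ctrlGrad U ((X ω).Γ t) ((X ω).q t) l := by
  have h0 := h.stateMeas t
  obtain ⟨G, hG⟩ := h.regular.gradient_lipschitz
  refine PastMeas.finsetSum _ fun k => ?_
  have h2 := pastMeas_utilGrad (r := fun ω => sys.meanTable ((X ω).Γ t)) h.utility
    (fun k l => h.pastMeas_meanRate t k l) h0.share
    (fun ω k l => System.meanRate_nonneg ((h.feasible t ω).1 l) k)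
    (fun ω l => ((h.feasible t ω).2.1 l).1) k
  have h3 : PastMeas Pr ξ t fun ω => sys.meanGrad k ((X ω).Γ t l) :=
    (h0.ctrl l).comp_continuousOn (hG k).continuousOn sys.isClosed_ctrlSet.measurableSet
      fun ω => (h.feasible t ω).1 l
  exact ((h0.share.prodMk h2).prodMk h3).comp
    (φ := fun p : (EuclideanSpace ℝ (Fin L) × ℝ) × Ctrl K M S => (p.1.1 l * p.1.2) • p.2)
    (by fun_prop)

lemma pastMeas_auxGrad (h : SampledRun sys U ρ γ τq τΓ Γ₀ q₀ Pr ξ X) (t : ℕ) (l : Fin L) :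
    PastMeas Pr ξ t fun ω => (X ω).auxGrad sys U ρ (fun t i => ξ t i ω) t l := by
  induction t with
  | zero => exact .const 0
  | succ t ih =>
    have h1 : PastMeas Pr ξ (t + 1) fun ω => ∑ i : Fin TH, (TH : ℝ)⁻¹ • ∑ k,
        (X ω).midWeight sys U ρ t k l • sys.rateGrad k ((X ω).Γ t l, ξ t i ω) := by
      refine PastMeas.finsetSum _ fun i => PastMeas.comp (φ := fun v => (TH : ℝ)⁻¹ • v)
        (PastMeas.finsetSum _ fun k => ?_) (by fun_prop)
      have h3 := (((h.stateMeas t).ctrl l).succ.prodMk (.sample i)).comp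
        (sys.measurable_rateGrad k)
      exact ((h.pastMeas_midWeight t k l).succ.prodMk h3).comp
        (φ := fun p : ℝ × Ctrl K M S => p.1 • p.2) (by fun_prop)
    exact (ih.succ.prodMk h1).comp
      (φ := fun p : Ctrl K M S × Ctrl K M S => (1 - ρ t) • p.1 + ρ t • p.2) (by fun_prop)

lemma pastMeas_gradErr (h : SampledRun sys U ρ γ τq τΓ Γ₀ q₀ Pr ξ X) (t : ℕ) (l : Fin L)
    (j : (Fin M × Fin S) ⊕ Fin K) :
    PastMeas Pr ξ t fun ω => (X ω).gradErr sys U ρ (fun t i => ξ t i ω) t l j :=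
  ((h.pastMeas_auxGrad t l).prodMk (h.pastMeas_ctrlGrad t l)).comp
    (φ := fun p : Ctrl K M S × Ctrl K M S => (p.1 - p.2) j) (by fun_prop)

omit [IsProbabilityMeasure Pr] in
-- The predictable table differs from the table of mean rates by `1 - ρ` times the rate error, and
-- `∇U` is Lipschitz on the orthant, which contains both rate vectors.
lemma abs_midWeight_sub_le (h : SampledRun sys U ρ γ τq τΓ Γ₀ q₀ Pr ξ X) (hc : sys.Bounds U L c)
    (t : ℕ) (ω : Ω) (k : Fin K) (l : Fin L) :
    |(X ω).midWeight sys U ρ t k l -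
      (X ω).q t l * utilGrad U (sys.avgRate ((X ω).Γ t) ((X ω).q t)) k| ≤
      c * ‖tableVec ((X ω).rateErr sys t)‖ := by
  have hf := h.feasible t ω
  have hq1 : |(X ω).q t l| ≤ 1 := abs_le.2 ⟨by linarith [(hf.2.1 l).1], (hf.2.1 l).2⟩
  have hmid := approxRate_mem_orthant
    ((h.run ω).midTable_nonneg h.rho_mem (fun t => h.feasible t ω) t) fun l => (hf.2.1 l).1
  rw [Run.midWeight, ← mul_sub, abs_mul, ← one_mul (c * _)]
  refine mul_le_mul hq1 ?_ (abs_nonneg _) zero_le_one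
  rw [← PiLp.sub_apply]
  refine (abs_apply_le_norm _ k).trans ((hc.utilGrad_lip _
    (System.avgRate_mem_orthant hf.1 fun l => (hf.2.1 l).1) _ hmid).trans ?_)
  refine mul_le_mul_of_nonneg_left ?_ hc.nonneg
  rw [System.avgRate_eq, ← approxRate_sub_left]
  refine (norm_approxRate_le _ _).trans ?_
  have e : tableVec ((X ω).midTable sys ρ t - sys.meanTable ((X ω).Γ t)) =
      (1 - ρ t) • tableVec ((X ω).rateErr sys t) := by
    ext p
    simp only [tableVec, Pi.sub_apply, Run.midTable, System.meanTable, Run.rateErr,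
      PiLp.smul_apply, smul_eq_mul]
    ring
  have h1 : 0 ≤ 1 - ρ t := sub_nonneg.2 (h.rho_mem t).2
  rw [e, norm_smul, Real.norm_of_nonneg h1]
  have h2 := norm_nonneg (tableVec ((X ω).rateErr sys t))
  calc (1 - ρ t) * ‖tableVec ((X ω).rateErr sys t)‖ * ‖(X ω).q t‖
      ≤ 1 * ‖tableVec ((X ω).rateErr sys t)‖ * 1 := by
        gcongr
        exacts [by linarith [(h.rho_mem t).1], norm_le_one_of_mem_shareSet hf.2]
    _ = _ := by ring

omit [IsProbabilityMeasure Pr] in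
lemma abs_midWeight_le (h : SampledRun sys U ρ γ τq τΓ Γ₀ q₀ Pr ξ X) (hc : sys.Bounds U L c)
    (t : ℕ) (ω : Ω) (k : Fin K) (l : Fin L) :
    |(X ω).midWeight sys U ρ t k l| ≤ c + c * ‖tableVec ((X ω).rateErr sys t)‖ := by
  have hf := h.feasible t ω
  have hq1 : |(X ω).q t l| ≤ 1 := abs_le.2 ⟨by linarith [(hf.2.1 l).1], (hf.2.1 l).2⟩
  have h1 := h.abs_midWeight_sub_le hc t ω k l
  have h2 : |(X ω).q t l * utilGrad U (sys.avgRate ((X ω).Γ t) ((X ω).q t)) k| ≤ 1 * c := by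
    rw [abs_mul]
    exact mul_le_mul hq1 ((abs_apply_le_norm _ k).trans (hc.norm_utilGrad_le _ _ hf))
      (abs_nonneg _) zero_le_one
  have h3 := abs_add_le ((X ω).midWeight sys U ρ t k l -
    (X ω).q t l * utilGrad U (sys.avgRate ((X ω).Γ t) ((X ω).q t)) k)
    ((X ω).q t l * utilGrad U (sys.avgRate ((X ω).Γ t) ((X ω).q t)) k)
  rw [sub_add_cancel] at h3
  linarith

lemma memLp_norm_rateErr (h : SampledRun sys U ρ γ τq τΓ Γ₀ q₀ Pr ξ X) (hc : sys.Bounds U L c)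
    (hB : sys.MomentBound B) (t : ℕ) :
    MemLp (fun ω => ‖tableVec ((X ω).rateErr sys t)‖) 2 Pr := by
  have hm : PastMeas Pr ξ t fun ω => (X ω).rateErr sys t :=
    .pi fun k => .pi fun l => h.pastMeas_rateErr t k l
  have hm2 : Measurable fun r : Fin K → Fin L → ℝ => ‖tableVec r‖ := by
    refine Measurable.norm ((PiLp.continuous_toLp 2 _).measurable.comp ?_)
    exact measurable_pi_lambda _ fun p => by fun_prop
  exact (memLp_two_iff_integrable_sq
    ((hm.comp hm2).aemeasurable h.measurable).aestronglyMeasurable).2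
    (h.integrable_rateErr_sq hc hB t)

lemma memLp_midWeight (h : SampledRun sys U ρ γ τq τΓ Γ₀ q₀ Pr ξ X) (hc : sys.Bounds U L c)
    (hB : sys.MomentBound B) (t : ℕ) (k : Fin K) (l : Fin L) :
    MemLp (fun ω => (X ω).midWeight sys U ρ t k l) 2 Pr ∧
      ∫ ω, (X ω).midWeight sys U ρ t k l ^ 2 ∂Pr ≤
        2 * c ^ 2 + 2 * c ^ 2 * meanRateErr sys Pr X t := by
  have hL := h.memLp_norm_rateErr hc hB t
  have hmem : MemLp (fun ω => (X ω).midWeight sys U ρ t k l) 2 Pr :=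
    MemLp.mono' ((memLp_const c).add (hL.const_mul c))
      ((h.pastMeas_midWeight t k l).aemeasurable h.measurable).aestronglyMeasurable
      (Eventually.of_forall fun ω => h.abs_midWeight_le hc t ω k l)
  refine ⟨hmem, ?_⟩
  have hi := (h.integrable_rateErr_sq hc hB t).const_mul (2 * c ^ 2)
  have e : ∫ ω, (2 * c ^ 2 + 2 * c ^ 2 * ‖tableVec ((X ω).rateErr sys t)‖ ^ 2) ∂Pr =
      2 * c ^ 2 + 2 * c ^ 2 * meanRateErr sys Pr X t := by
    rw [integral_add (integrable_const _) hi, meanRateErr]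
    simp [integral_const_mul]
  rw [← e]
  refine integral_mono hmem.integrable_sq ((integrable_const _).add hi) fun ω => ?_
  have h1 := pow_le_pow_left₀ (abs_nonneg _) (h.abs_midWeight_le hc t ω k l) 2
  rw [sq_abs] at h1
  have h2 : (c + c * ‖tableVec ((X ω).rateErr sys t)‖) ^ 2 ≤
      2 * c ^ 2 + 2 * c ^ 2 * ‖tableVec ((X ω).rateErr sys t)‖ ^ 2 := by
    linarith [sq_nonneg (c - c * ‖tableVec ((X ω).rateErr sys t)‖)]
  exact h1.trans h2

/-- The available bound on the weights is `c + c` times the norm of the rate error, which is only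
square integrable; the variance bound therefore involves the mean square rate error. -/
lemma gradNoise (h : SampledRun sys U ρ γ τq τΓ Γ₀ q₀ Pr ξ X) (hc : sys.Bounds U L c)
    (hB : sys.MomentBound B) (t : ℕ) (l : Fin L) (j : (Fin M × Fin S) ⊕ Fin K) :
    MemLp (fun ω => ∑ k, ∑ i, (TH : ℝ)⁻¹ * ((X ω).midWeight sys U ρ t k l *
        sys.centredPartial k j ((X ω).Γ t l, ξ t i ω))) 2 Pr ∧
      ∫ ω, (∑ k, ∑ i, (TH : ℝ)⁻¹ * ((X ω).midWeight sys U ρ t k l *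
        sys.centredPartial k j ((X ω).Γ t l, ξ t i ω))) ^ 2 ∂Pr ≤
        K * (K * (B ^ 2 * (2 * c ^ 2 + 2 * c ^ 2 * meanRateErr sys Pr X t))) ∧
      ∀ b : Ω → ℝ, PastMeas Pr ξ t b → MemLp b 2 Pr →
        ∫ ω, b ω * ∑ k, ∑ i, (TH : ℝ)⁻¹ * ((X ω).midWeight sys U ρ t k l *
          sys.centredPartial k j ((X ω).Γ t l, ξ t i ω)) ∂Pr = 0 := by
  have := h.prob
  have hk := fun k => ((h.stateMeas t).ctrl l).batch_noise h.measurable h.indep h.law h.batch_pos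
    (fun ω => (h.feasible t ω).1 l) (sys.measurable_centredPartial k j) (hB.centredPartial k j)
    (hB.integral_centredPartial k j) (h.pastMeas_midWeight t k l) (h.memLp_midWeight hc hB t k l).1
  have hmem := memLp_finsetSum Finset.univ fun k _ => (hk k).1
  refine ⟨hmem, ?_, fun b hb hb2 => ?_⟩
  · have hpt : ∀ ω, (∑ k, ∑ i, (TH : ℝ)⁻¹ * ((X ω).midWeight sys U ρ t k l *
        sys.centredPartial k j ((X ω).Γ t l, ξ t i ω))) ^ 2 ≤
        K * ∑ k, (∑ i, (TH : ℝ)⁻¹ * ((X ω).midWeight sys U ρ t k l *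
        sys.centredPartial k j ((X ω).Γ t l, ξ t i ω))) ^ 2 := by
      intro ω
      have := sq_sum_le_card_mul_sum_sq (s := (Finset.univ : Finset (Fin K)))
        (f := fun k => ∑ i, (TH : ℝ)⁻¹ * ((X ω).midWeight sys U ρ t k l *
        sys.centredPartial k j ((X ω).Γ t l, ξ t i ω)))
      rwa [Finset.card_univ, Fintype.card_fin] at this
    have hi := fun k => (hk k).1.integrable_sq
    refine (integral_mono hmem.integrable_sq
      ((integrable_finsetSum _ fun k _ => hi k).const_mul _) hpt).trans ?_
    rw [integral_const_mul, integral_finsetSum _ fun k _ => hi k]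
    refine mul_le_mul_of_nonneg_left ?_ (Nat.cast_nonneg K)
    refine (Finset.sum_le_sum fun k _ => (hk k).2.1.trans (mul_le_mul_of_nonneg_left
      (h.memLp_midWeight hc hB t k l).2 (by positivity))).trans ?_
    simp
  · simp only [Finset.mul_sum _ _ (b _)]
    have hi : ∀ k, Integrable (fun ω => ∑ i, b ω * ((TH : ℝ)⁻¹ * ((X ω).midWeight sys U ρ t k l *
        sys.centredPartial k j ((X ω).Γ t l, ξ t i ω)))) Pr := fun k => by
      have := hb2.integrable_mul (hk k).1
      refine this.congr (Eventually.of_forall fun ω => ?_)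
      simp only [Pi.mul_apply, Finset.mul_sum]
    rw [integral_finsetSum _ fun k _ => hi k]
    refine Finset.sum_eq_zero fun k _ => ?_
    have := (hk k).2.2 b hb hb2
    simpa only [Finset.mul_sum] using this

/-- Lipschitz constant of the blocks of the gradient of the objective. -/
def _root_.RCSHP.gradLip (K L : ℕ) (c : ℝ) : ℝ := K * (c * c + c * (c + K * L * c) * c + c * c)

omit [IsProbabilityMeasure Pr] in
lemma abs_gradDrift_le (h : SampledRun sys U ρ γ τq τΓ Γ₀ q₀ Pr ξ X) (hc : sys.Bounds U L c)
    (t : ℕ) (ω : Ω) (l : Fin L) (j : (Fin M × Fin S) ⊕ Fin K) :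
    |(X ω).gradDrift sys U ρ t l j| ≤ ρ t * (K * (c * c)) * ‖tableVec ((X ω).rateErr sys t)‖ +
      gradLip K L c * (γ t * √((X ω).stepSq t)) := by
  have hc0 := hc.nonneg
  refine (abs_sub _ _).trans (add_le_add ?_ ?_)
  · rw [abs_mul, abs_of_nonneg (h.rho_mem t).1.le, mul_assoc]
    refine mul_le_mul_of_nonneg_left ?_ (h.rho_mem t).1.le
    refine (Finset.abs_sum_le_sum_abs _ _).trans ?_
    have hk : ∀ k, |((X ω).midWeight sys U ρ t k l -
        (X ω).q t l * utilGrad U (sys.avgRate ((X ω).Γ t) ((X ω).q t)) k) *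
        sys.meanGrad k ((X ω).Γ t l) j| ≤ c * ‖tableVec ((X ω).rateErr sys t)‖ * c := fun k => by
      rw [abs_mul]
      exact mul_le_mul (h.abs_midWeight_sub_le hc t ω k l)
        ((abs_apply_le_norm _ j).trans (hc.norm_meanGrad_le k _ ((h.feasible t ω).1 l)))
        (abs_nonneg _) (mul_nonneg hc0 (norm_nonneg _))
    refine (Finset.sum_le_sum fun k _ => hk k).trans (le_of_eq ?_)
    simp only [Finset.sum_const, Finset.card_univ, Fintype.card_fin, nsmul_eq_mul]
    ring
  · refine (abs_apply_le_norm _ j).trans ?_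
    exact hc.norm_ctrlGrad_sub_le (h.feasible t ω) (h.feasible (t + 1) ω)
      (fun l => h.norm_ctrl_step_le t ω l) (h.norm_share_step_le t ω) l

lemma memLp_gradDrift (h : SampledRun sys U ρ γ τq τΓ Γ₀ q₀ Pr ξ X) (hc : sys.Bounds U L c)
    (hB : sys.MomentBound B) (t : ℕ) (l : Fin L) (j : (Fin M × Fin S) ⊕ Fin K) :
    MemLp (fun ω => (X ω).gradDrift sys U ρ t l j) 2 Pr ∧
      ∫ ω, (X ω).gradDrift sys U ρ t l j ^ 2 ∂Pr ≤
        2 * (ρ t * (K * (c * c))) ^ 2 * meanRateErr sys Pr X t +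
        2 * (gradLip K L c * γ t) ^ 2 * ∫ ω, (X ω).stepSq t ∂Pr := by
  have hc0 := hc.nonneg
  have hm : PastMeas Pr ξ (t + 1) fun ω => (X ω).gradDrift sys U ρ t l j := by
    obtain ⟨G, hG⟩ := h.regular.gradient_lipschitz
    have h0 := h.stateMeas t
    have h2 := fun k => pastMeas_utilGrad (r := fun ω => sys.meanTable ((X ω).Γ t)) h.utility
      (fun k l => h.pastMeas_meanRate t k l) h0.share
      (fun ω k l => System.meanRate_nonneg ((h.feasible t ω).1 l) k)
      (fun ω l => ((h.feasible t ω).2.1 l).1) k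
    have h3 : ∀ k, PastMeas Pr ξ t fun ω => sys.meanGrad k ((X ω).Γ t l) := fun k =>
      (h0.ctrl l).comp_continuousOn (hG k).continuousOn sys.isClosed_ctrlSet.measurableSet
        fun ω => (h.feasible t ω).1 l
    have h4 : PastMeas Pr ξ t fun ω => ∑ k, ((X ω).midWeight sys U ρ t k l -
        (X ω).q t l * utilGrad U (sys.avgRate ((X ω).Γ t) ((X ω).q t)) k) *
        sys.meanGrad k ((X ω).Γ t l) j := PastMeas.finsetSum _ fun k =>
      (((h.pastMeas_midWeight t k l).prodMk (h0.share.prodMk (h2 k))).prodMk (h3 k)).comp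
        (φ := fun p : (ℝ × EuclideanSpace ℝ (Fin L) × ℝ) × Ctrl K M S =>
          (p.1.1 - p.1.2.1 l * p.1.2.2) * p.2 j) (by fun_prop)
    exact (h4.succ.prodMk ((h.pastMeas_ctrlGrad (t + 1) l).prodMk
      (h.pastMeas_ctrlGrad t l).succ)).comp
      (φ := fun p : ℝ × Ctrl K M S × Ctrl K M S => ρ t * p.1 - (p.2.1 - p.2.2) j) (by fun_prop)
  have hL := h.memLp_norm_rateErr hc hB t
  have hg0 : 0 ≤ gradLip K L c := by unfold gradLip; positivity
  have hD := h.integrable_stepSq hc t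
  have hDm : AEStronglyMeasurable (fun ω => √((X ω).stepSq t)) Pr :=
    (hD.aestronglyMeasurable.aemeasurable.sqrt).aestronglyMeasurable
  have hDL : MemLp (fun ω => √((X ω).stepSq t)) 2 Pr := by
    rw [memLp_two_iff_integrable_sq hDm]
    simpa only [Real.sq_sqrt ((X _).stepSq_nonneg t)] using hD
  have hmem : MemLp (fun ω => (X ω).gradDrift sys U ρ t l j) 2 Pr :=
    MemLp.mono' ((hL.const_mul (ρ t * (K * (c * c)))).add
        ((hDL.const_mul (γ t)).const_mul (gradLip K L c)))
      (hm.aemeasurable h.measurable).aestronglyMeasurable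
      (Eventually.of_forall fun ω => h.abs_gradDrift_le hc t ω l j)
  refine ⟨hmem, ?_⟩
  have hi1 := (h.integrable_rateErr_sq hc hB t).const_mul (2 * (ρ t * (K * (c * c))) ^ 2)
  have hi2 := hD.const_mul (2 * (gradLip K L c * γ t) ^ 2)
  rw [meanRateErr, ← integral_const_mul, ← integral_const_mul, ← integral_add hi1 hi2]
  refine integral_mono hmem.integrable_sq (hi1.add hi2) fun ω => ?_
  have h1 := pow_le_pow_left₀ (abs_nonneg _) (h.abs_gradDrift_le hc t ω l j) 2
  rw [sq_abs] at h1
  have h2 := Real.sq_sqrt ((X ω).stepSq_nonneg t)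
  refine h1.trans ?_
  set a := ρ t * (K * (c * c)) * ‖tableVec ((X ω).rateErr sys t)‖ with ha
  set b := gradLip K L c * (γ t * √((X ω).stepSq t)) with hb
  have h3 : 2 * (ρ t * (K * (c * c))) ^ 2 * ‖tableVec ((X ω).rateErr sys t)‖ ^ 2 = 2 * a ^ 2 := by
    rw [ha]; ring
  -- The drift bound contains the square root of `stepSq`, so squaring it restores `stepSq` itself.
  have h4 : 2 * (gradLip K L c * γ t) ^ 2 * (X ω).stepSq t = 2 * b ^ 2 := by
    have : 2 * b ^ 2 = 2 * (gradLip K L c * γ t) ^ 2 * √((X ω).stepSq t) ^ 2 := by rw [hb]; ring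
    rw [this, h2]
  rw [h3, h4]
  linarith [sq_nonneg (a - b)]

lemma memLp_gradErr (h : SampledRun sys U ρ γ τq τΓ Γ₀ q₀ Pr ξ X) (hc : sys.Bounds U L c)
    (hB : sys.MomentBound B) (t : ℕ) (l : Fin L) (j : (Fin M × Fin S) ⊕ Fin K) :
    MemLp (fun ω => (X ω).gradErr sys U ρ (fun t i => ξ t i ω) t l j) 2 Pr := by
  induction t with
  | zero =>
    have hc0 := hc.nonneg
    refine MemLp.of_bound ((h.pastMeas_gradErr 0 l j).aemeasurable
      h.measurable).aestronglyMeasurable ‖sys.ctrlGrad U Γ₀ q₀ l‖ (Eventually.of_forall fun ω => ?_)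
    refine (abs_apply_le_norm _ j).trans (le_of_eq ?_)
    rw [Run.gradErr, (h.run ω).init_Γ, (h.run ω).init_q]
    simp [Run.auxGrad]
  | succ t ih =>
    simp only [h.gradErr_succ hB]
    exact ((ih.const_mul _).add ((h.gradNoise hc hB t l j).1.const_mul _)).add
      (h.memLp_gradDrift hc hB t l j).1

/-- Mean square of the gradient errors. -/
def _root_.RCSHP.meanGradErr (sys : System K M S Tp) (U : EuclideanSpace ℝ (Fin K) → ℝ) (ρ : ℕ → ℝ)
    (Pr : Measure Ω) (ξ : ℕ → Fin TH → Ω → State K M Tp) (X : Ω → Run K M S L) (t : ℕ) : ℝ :=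
  ∫ ω, ∑ l, ‖(X ω).gradErr sys U ρ (fun t i => ξ t i ω) t l‖ ^ 2 ∂Pr

omit [MeasurableSpace Ω] [IsProbabilityMeasure Pr] in
lemma norm_gradErr_sq (t : ℕ) (ω : Ω) :
    ∑ l, ‖(X ω).gradErr sys U ρ (fun t i => ξ t i ω) t l‖ ^ 2 =
      ∑ l, ∑ j, (X ω).gradErr sys U ρ (fun t i => ξ t i ω) t l j ^ 2 := by
  simp only [EuclideanSpace.norm_sq_eq, Real.norm_eq_abs, sq_abs]

lemma integrable_gradErr_sq (h : SampledRun sys U ρ γ τq τΓ Γ₀ q₀ Pr ξ X) (hc : sys.Bounds U L c)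
    (hB : sys.MomentBound B) (t : ℕ) :
    Integrable (fun ω => ∑ l, ‖(X ω).gradErr sys U ρ (fun t i => ξ t i ω) t l‖ ^ 2) Pr := by
  simp only [norm_gradErr_sq]
  exact integrable_finsetSum _ fun l _ => integrable_finsetSum _ fun j _ =>
    (h.memLp_gradErr hc hB t l j).integrable_sq

lemma meanGradErr_eq (h : SampledRun sys U ρ γ τq τΓ Γ₀ q₀ Pr ξ X) (hc : sys.Bounds U L c)
    (hB : sys.MomentBound B) (t : ℕ) :
    meanGradErr sys U ρ Pr ξ X t =
      ∑ l, ∑ j, ∫ ω, (X ω).gradErr sys U ρ (fun t i => ξ t i ω) t l j ^ 2 ∂Pr := by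
  have hi := fun l j => (h.memLp_gradErr hc hB t l j).integrable_sq
  simp only [meanGradErr, norm_gradErr_sq]
  rw [integral_finsetSum _ fun l _ => integrable_finsetSum _ fun j _ => hi l j]
  exact Finset.sum_congr rfl fun l _ => integral_finsetSum _ fun j _ => hi l j

/-- The weight error enters the drift with a factor `ρ`; squared and weighted by `3/ρ` it costs
order `ρ` times the mean square rate error, a term that the contraction of the rate errors can later
pay for. -/
lemma meanGradErr_succ_le (h : SampledRun sys U ρ γ τq τΓ Γ₀ q₀ Pr ξ X) (hc : sys.Bounds U L c)
    (hB : sys.MomentBound B) :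
    ∃ C ≥ 0, ∀ t, meanGradErr sys U ρ Pr ξ X (t + 1) ≤ (1 - ρ t) * meanGradErr sys U ρ Pr ξ X t +
      C * ρ t ^ 2 + C * ρ t * meanRateErr sys Pr X t +
      C * (γ t ^ 2 / ρ t) * ∫ ω, (X ω).stepSq t ∂Pr := by
  have hc0 := hc.nonneg
  obtain ⟨N, hN⟩ : ∃ N : ℝ, N = (Fintype.card ((Fin M × Fin S) ⊕ Fin K) : ℝ) * L := ⟨_, rfl⟩
  have hN0 : 0 ≤ N := by rw [hN]; positivity
  -- `C₁` comes from `2ρ²` times the noise variance, `C₂` and `C₃` from `3/ρ` times the two halves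
  -- of the squared drift.
  obtain ⟨C₁, hC₁⟩ : ∃ C₁ : ℝ, C₁ = 4 * (K * (K * (B ^ 2 * c ^ 2))) := ⟨_, rfl⟩
  obtain ⟨C₂, hC₂⟩ : ∃ C₂ : ℝ, C₂ = 6 * (K * (c * c)) ^ 2 := ⟨_, rfl⟩
  obtain ⟨C₃, hC₃⟩ : ∃ C₃ : ℝ, C₃ = 6 * gradLip K L c ^ 2 := ⟨_, rfl⟩
  have h1 : 0 ≤ C₁ := by rw [hC₁]; positivity
  have h2 : 0 ≤ C₂ := by rw [hC₂]; positivity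
  have h3 : 0 ≤ C₃ := by rw [hC₃]; positivity
  refine ⟨N * (C₁ + C₂ + C₃), by positivity, fun t => ?_⟩
  have hρ := h.rho_mem t
  have hD : 0 ≤ ∫ ω, (X ω).stepSq t ∂Pr := integral_nonneg fun ω => (X ω).stepSq_nonneg t
  have hA : 0 ≤ meanRateErr sys Pr X t := integral_nonneg fun ω => by positivity
  set D := ∫ ω, (X ω).stepSq t ∂Pr with hDdef
  set A := meanRateErr sys Pr X t with hAdef
  obtain ⟨Y, hY⟩ : ∃ Y, Y = C₁ * ρ t ^ 2 * (1 + A) + C₂ * ρ t * A + C₃ * (γ t ^ 2 / ρ t) * D :=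
    ⟨_, rfl⟩
  have hlj : ∀ l j, ∫ ω, (X ω).gradErr sys U ρ (fun t i => ξ t i ω) (t + 1) l j ^ 2 ∂Pr ≤
      (1 - ρ t) * ∫ ω, (X ω).gradErr sys U ρ (fun t i => ξ t i ω) t l j ^ 2 ∂Pr + Y := by
    intro l j
    obtain ⟨n1, n2, n3⟩ := h.gradNoise hc hB t l j
    obtain ⟨w1, w2⟩ := h.memLp_gradDrift hc hB t l j
    have ha := h.memLp_gradErr hc hB t l j
    simp only [h.gradErr_succ hB]
    refine (integral_sq_recursion_le ha n1 w1 (n3 _ (h.pastMeas_gradErr t l j) ha) hρ).trans ?_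
    rw [add_assoc]
    refine add_le_add le_rfl ?_
    have h3ρ : 0 ≤ 3 / ρ t := div_nonneg (by norm_num) hρ.1.le
    refine (add_le_add (mul_le_mul_of_nonneg_left n2 (by positivity))
      (mul_le_mul_of_nonneg_left w2 h3ρ)).trans (le_of_eq ?_)
    have hρ0 := hρ.1.ne'
    rw [hY, hC₁, hC₂, hC₃]
    field_simp
    ring
  rw [h.meanGradErr_eq hc hB, h.meanGradErr_eq hc hB]
  refine (Finset.sum_le_sum fun l _ => Finset.sum_le_sum fun j _ => hlj l j).trans ?_
  simp only [Finset.sum_add_distrib, ← Finset.mul_sum, Finset.sum_const, Finset.card_univ,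
    Fintype.card_fin, nsmul_eq_mul]
  rw [← mul_assoc, ← hN, hY]
  have hr : 0 ≤ γ t ^ 2 / ρ t * D := mul_nonneg (div_nonneg (sq_nonneg _) hρ.1.le) hD
  -- The part of the noise variance proportional to the rate error is absorbed into the weight error
  -- term, since `ρ ≤ 1`.
  have f1 : ρ t ^ 2 * A ≤ ρ t * A := by
    refine mul_le_mul_of_nonneg_right ?_ hA
    nlinarith [hρ.1, hρ.2]
  have hρA : 0 ≤ ρ t * A := mul_nonneg hρ.1.le hA
  have g1 : N * (C₁ * ρ t ^ 2 * (1 + A) + C₂ * ρ t * A + C₃ * (γ t ^ 2 / ρ t) * D) ≤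
      N * ((C₁ + C₂ + C₃) * ρ t ^ 2 + (C₁ + C₂ + C₃) * (ρ t * A) +
        (C₁ + C₂ + C₃) * (γ t ^ 2 / ρ t * D)) := by
    refine mul_le_mul_of_nonneg_left ?_ hN0
    have k1 := mul_le_mul_of_nonneg_left f1 h1
    have k2 : 0 ≤ (C₂ + C₃) * ρ t ^ 2 := by positivity
    have k3 : 0 ≤ C₃ * (ρ t * A) := by positivity
    have k4 : 0 ≤ (C₁ + C₂) * (γ t ^ 2 / ρ t * D) := by positivity
    linarith
  linarith

end SampledRun

end

end RCSHP

/-! ### Decoupling the utility gradient from the current samples -/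

namespace RCSHP

noncomputable section

variable {K M S Tp L TH : ℕ} {sys : System K M S Tp} {U : EuclideanSpace ℝ (Fin K) → ℝ}
  {ρ γ : ℕ → ℝ} {τq τΓ : ℝ} {Γ₀ : Fin L → Ctrl K M S} {q₀ : EuclideanSpace ℝ (Fin L)}

/-! ### Distance between the recursive and the auxiliary gradient estimates -/

/-- Noise of the rate estimates in one iteration. -/
def System.batchNoise (sys : System K M S Tp) (Γ : Fin L → Ctrl K M S) (z : Fin TH → State K M Tp) :
    Fin K → Fin L → ℝ :=
  fun k l => ∑ i, (TH : ℝ)⁻¹ * (1 * sys.centredRate k (Γ l, z i))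

/-- Second moments of the samples of one iteration that control the error of the recursive gradient
estimate. -/
def System.batchSq (sys : System K M S Tp) (Γ : Fin L → Ctrl K M S) (z : Fin TH → State K M Tp)
    (l : Fin L) : ℝ :=
  ∑ i, (TH : ℝ)⁻¹ * ∑ k, (‖tableVec (sys.batchNoise Γ z)‖ ^ 2 + ‖sys.rateGrad k (Γ l, z i)‖ ^ 2)

namespace SampledRun

variable {Ω : Type*} [MeasurableSpace Ω] {Pr : Measure Ω} [IsProbabilityMeasure Pr]
  {ξ : ℕ → Fin TH → Ω → State K M Tp} {X : Ω → Run K M S L} {c : ℝ} {B : ℝ≥0}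

lemma integrable_batchSq (h : SampledRun sys U ρ γ τq τΓ Γ₀ q₀ Pr ξ X) (hB : sys.MomentBound B)
    (t : ℕ) (l : Fin L) :
    Integrable (fun ω => sys.batchSq ((X ω).Γ t) (fun i => ξ t i ω) l) Pr ∧
      ∫ ω, sys.batchSq ((X ω).Γ t) (fun i => ξ t i ω) l ∂Pr ≤
        K * (K * (L * (B : ℝ) ^ 2) +
          (Fintype.card ((Fin M × Fin S) ⊕ Fin K) : ℝ) * (B : ℝ) ^ 2) := by
  have := h.prob
  have hTH : (TH : ℝ) ≠ 0 := by exact_mod_cast h.batch_pos.ne'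
  have n1 : ∀ k l, Integrable
      (fun ω => sys.batchNoise ((X ω).Γ t) (fun i => ξ t i ω) k l ^ 2) Pr := fun k l =>
    (h.rateNoise hB t k l).1.integrable_sq
  have n2 : Integrable
      (fun ω => ‖tableVec (sys.batchNoise ((X ω).Γ t) (fun i => ξ t i ω))‖ ^ 2) Pr := by
    simp only [norm_tableVec_sq]
    exact integrable_finsetSum _ fun k _ => integrable_finsetSum _ fun l _ => n1 k l
  have n3 : ∫ ω, ‖tableVec (sys.batchNoise ((X ω).Γ t) (fun i => ξ t i ω))‖ ^ 2 ∂Pr ≤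
      K * (L * (B : ℝ) ^ 2) := by
    simp only [norm_tableVec_sq]
    rw [integral_finsetSum _ fun k _ => integrable_finsetSum _ fun l _ => n1 k l]
    simp only [integral_finsetSum _ fun l _ => n1 _ l]
    refine (Finset.sum_le_sum fun k _ => Finset.sum_le_sum fun l _ =>
      (h.rateNoise hB t k l).2.1).trans ?_
    simp
  have p1 := fun i k j => ((h.stateMeas t).ctrl l).memLp_mul h.measurable h.indep h.law
    (fun ω => (h.feasible t ω).1 l) (sys.measurable_ratePartial k j) (hB.partialDeriv k j)
    (a := fun _ => 1) (.const 1) (memLp_const 1) i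
  simp only [one_mul, one_pow, integral_const, probReal_univ, smul_eq_mul, mul_one] at p1
  have p2 : ∀ i k, Integrable (fun ω => ‖sys.rateGrad k ((X ω).Γ t l, ξ t i ω)‖ ^ 2) Pr := by
    intro i k
    simp only [EuclideanSpace.norm_sq_eq, Real.norm_eq_abs, sq_abs]
    exact integrable_finsetSum _ fun j _ => (p1 i k j).1.integrable_sq
  have p3 : ∀ i k, ∫ ω, ‖sys.rateGrad k ((X ω).Γ t l, ξ t i ω)‖ ^ 2 ∂Pr ≤
      (Fintype.card ((Fin M × Fin S) ⊕ Fin K) : ℝ) * (B : ℝ) ^ 2 := by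
    intro i k
    simp only [EuclideanSpace.norm_sq_eq, Real.norm_eq_abs, sq_abs, System.rateGrad]
    rw [integral_finsetSum _ fun j _ => (p1 i k j).1.integrable_sq]
    refine (Finset.sum_le_sum fun j _ => (p1 i k j).2).trans ?_
    simp
  have s1 : ∀ i, Integrable (fun ω => ∑ k,
      (‖tableVec (sys.batchNoise ((X ω).Γ t) (fun i => ξ t i ω))‖ ^ 2 +
        ‖sys.rateGrad k ((X ω).Γ t l, ξ t i ω)‖ ^ 2)) Pr := fun i =>
    integrable_finsetSum _ fun k _ => n2.add (p2 i k)
  refine ⟨integrable_finsetSum _ fun i _ => (s1 i).const_mul _, ?_⟩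
  unfold System.batchSq
  rw [integral_finsetSum _ fun i _ => (s1 i).const_mul _]
  have s2 : ∀ i, ∫ ω, ∑ k, (‖tableVec (sys.batchNoise ((X ω).Γ t) (fun i => ξ t i ω))‖ ^ 2 +
      ‖sys.rateGrad k ((X ω).Γ t l, ξ t i ω)‖ ^ 2) ∂Pr ≤ K * (K * (L * (B : ℝ) ^ 2) +
        (Fintype.card ((Fin M × Fin S) ⊕ Fin K) : ℝ) * (B : ℝ) ^ 2) := by
    intro i
    refine (integral_finsetSum _ fun k _ => n2.add (p2 i k)).trans_le ?_
    refine (Finset.sum_le_sum (g := fun _ => K * (L * (B : ℝ) ^ 2) +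
        (Fintype.card ((Fin M × Fin S) ⊕ Fin K) : ℝ) * (B : ℝ) ^ 2) fun k _ => ?_).trans
      (le_of_eq ?_)
    · exact (integral_add n2 (p2 i k)).trans_le (add_le_add n3 (p3 i k))
    · rw [Finset.sum_const, Finset.card_univ, Fintype.card_fin, nsmul_eq_mul]
  simp only [integral_const_mul]
  refine (Finset.sum_le_sum fun i _ => mul_le_mul_of_nonneg_left (s2 i) (by positivity)).trans ?_
  rw [Finset.sum_const, Finset.card_univ, Fintype.card_fin, nsmul_eq_mul, ← mul_assoc,
    mul_inv_cancel₀ hTH, one_mul]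

omit [IsProbabilityMeasure Pr] in
-- The new rate estimate differs from its predictable part by `ρ t` times the batch noise, and `∇U`
-- is Lipschitz.
lemma abs_utilGrad_rhat_sub_le (h : SampledRun sys U ρ γ τq τΓ Γ₀ q₀ Pr ξ X)
    (hc : sys.Bounds U L c) (t : ℕ) (ω : Ω) (k : Fin K) (l : Fin L) :
    |(X ω).q t l * utilGrad U (approxRate ((X ω).rhat t) ((X ω).q t)) k -
      (X ω).midWeight sys U ρ t k l| ≤
      c * (ρ t * ‖tableVec (sys.batchNoise ((X ω).Γ t) (fun i => ξ t i ω))‖) := by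
  have hf := h.feasible t ω
  have hc0 := hc.nonneg
  have hq1 : |(X ω).q t l| ≤ 1 := abs_le.2 ⟨by linarith [(hf.2.1 l).1], (hf.2.1 l).2⟩
  have hm1 := approxRate_mem_orthant ((h.run ω).midTable_nonneg h.rho_mem
    (fun t => h.feasible t ω) t) fun l => (hf.2.1 l).1
  have hm2 := approxRate_mem_orthant ((h.run ω).prev_rhat_nonneg h.rho_mem
    (fun t => h.feasible t ω) (t + 1)) fun l => (hf.2.1 l).1
  have h1 := hc.utilGrad_lip _ hm1 _ hm2
  have e : (X ω).rhat t - (X ω).midTable sys ρ t =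
      ρ t • sys.batchNoise ((X ω).Γ t) (fun i => ξ t i ω) := by
    funext k l
    simp only [Pi.sub_apply, Pi.smul_apply, smul_eq_mul, h.rhat_eq_midTable, System.batchNoise]
    ring
  have h2 : ‖approxRate ((X ω).rhat t) ((X ω).q t) -
      approxRate ((X ω).midTable sys ρ t) ((X ω).q t)‖ ≤
      ρ t * ‖tableVec (sys.batchNoise ((X ω).Γ t) (fun i => ξ t i ω))‖ := by
    rw [← approxRate_sub_left, e]
    refine (norm_approxRate_le _ _).trans ?_
    have e2 : tableVec (ρ t • sys.batchNoise ((X ω).Γ t) (fun i => ξ t i ω)) =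
      ρ t • tableVec (sys.batchNoise ((X ω).Γ t) (fun i => ξ t i ω)) := rfl
    rw [e2, norm_smul, Real.norm_of_nonneg (h.rho_mem t).1.le]
    exact mul_le_of_le_one_right (mul_nonneg (h.rho_mem t).1.le (norm_nonneg _))
      (norm_le_one_of_mem_shareSet hf.2)
  rw [Run.midWeight, ← mul_sub, abs_mul, ← PiLp.sub_apply]
  refine (mul_le_of_le_one_left (abs_nonneg _) hq1).trans ?_
  exact (abs_apply_le_norm _ k).trans (h1.trans (mul_le_mul_of_nonneg_left h2 hc0))

/-- Subtracting the two recursions leaves the contraction and a source `ρ` times weight difference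
times rate gradient. The weight difference is itself `O(ρ)` times noise. Noise and gradient come
from the same samples and are correlated, so their product is bounded by the sum of their squares,
and the distance is controlled in mean rather than in mean square. -/
lemma ae_auxErr_succ_le (h : SampledRun sys U ρ γ τq τΓ Γ₀ q₀ Pr ξ X) (hc : sys.Bounds U L c)
    (t : ℕ) (l : Fin L) : ∀ᵐ ω ∂Pr,
      (X ω).auxErr sys U ρ (fun t i => ξ t i ω) (t + 1) l ≤
        (1 - ρ t) * (X ω).auxErr sys U ρ (fun t i => ξ t i ω) t l +
          c * ρ t ^ 2 * sys.batchSq ((X ω).Γ t) (fun i => ξ t i ω) l := by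
  have hc0 := hc.nonneg
  have hρ := h.rho_mem t
  filter_upwards [ae_all_iff.2 fun i => h.ae_gradient_eq ((h.stateMeas t).ctrl l) i] with ω hω
  set w : Fin K → ℝ := fun k =>
    (X ω).q t l * utilGrad U (approxRate ((X ω).rhat t) ((X ω).q t)) k with hw
  set g : Fin TH → Fin K → Ctrl K M S := fun i k => sys.rateGrad k ((X ω).Γ t l, ξ t i ω) with hg
  set N := ‖tableVec (sys.batchNoise ((X ω).Γ t) (fun i => ξ t i ω))‖ with hN
  have e1 : (X ω).grad t l = (1 - ρ t) • prev (X ω).grad t l +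
      ρ t • ∑ i, (TH : ℝ)⁻¹ • ∑ k, w k • g i k := by
    rw [(h.run ω).grad_eq]
    simp only [jacobianMul, hω]
    rfl
  have e2 : (X ω).grad t l - (X ω).auxGrad sys U ρ (fun t i => ξ t i ω) (t + 1) l =
      (1 - ρ t) • (prev (X ω).grad t l - (X ω).auxGrad sys U ρ (fun t i => ξ t i ω) t l) +
      ρ t • ∑ i, (TH : ℝ)⁻¹ • ∑ k, (w k - (X ω).midWeight sys U ρ t k l) • g i k := by
    have e3 : ∀ i k, (w k - (X ω).midWeight sys U ρ t k l) • g i k =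
        w k • g i k - (X ω).midWeight sys U ρ t k l • g i k := fun i k => sub_smul _ _ _
    rw [e1, Run.auxGrad]
    simp only [e3, Finset.sum_sub_distrib, smul_sub]
    abel
  change ‖(X ω).grad t l - _‖ ≤ _
  rw [e2]
  refine (norm_add_le _ _).trans ?_
  rw [norm_smul, norm_smul, Real.norm_of_nonneg (sub_nonneg.2 hρ.2), Real.norm_of_nonneg hρ.1.le]
  refine add_le_add le_rfl ?_
  have hk : ∀ i k, ‖(w k - (X ω).midWeight sys U ρ t k l) • g i k‖ ≤
      c * ρ t * (N ^ 2 + ‖g i k‖ ^ 2) := by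
    intro i k
    rw [norm_smul, Real.norm_eq_abs]
    have h1 := mul_le_mul_of_nonneg_right (h.abs_utilGrad_rhat_sub_le hc t ω k l)
      (norm_nonneg (g i k))
    refine h1.trans ?_
    have h2 : N * ‖g i k‖ ≤ N ^ 2 + ‖g i k‖ ^ 2 := by
      nlinarith [sq_nonneg (N - ‖g i k‖), sq_nonneg N, sq_nonneg ‖g i k‖]
    have h3 := mul_le_mul_of_nonneg_left h2 (mul_nonneg hc0 hρ.1.le)
    calc c * (ρ t * N) * ‖g i k‖ = c * ρ t * (N * ‖g i k‖) := by ring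
      _ ≤ _ := h3
  have hi : ∀ i, ‖(TH : ℝ)⁻¹ • ∑ k, (w k - (X ω).midWeight sys U ρ t k l) • g i k‖ ≤
      c * ρ t * ((TH : ℝ)⁻¹ * ∑ k, (N ^ 2 + ‖g i k‖ ^ 2)) := by
    intro i
    have h0 : (0 : ℝ) ≤ (TH : ℝ)⁻¹ := by positivity
    rw [norm_smul, Real.norm_of_nonneg h0]
    have := (norm_sum_le _ _).trans (Finset.sum_le_sum fun k (_ : k ∈ Finset.univ) => hk i k)
    rw [← Finset.mul_sum] at this
    calc _ ≤ (TH : ℝ)⁻¹ * (c * ρ t * ∑ k, (N ^ 2 + ‖g i k‖ ^ 2)) :=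
          mul_le_mul_of_nonneg_left this h0
      _ = _ := by ring
  have hs := (norm_sum_le _ _).trans (Finset.sum_le_sum fun i (_ : i ∈ Finset.univ) => hi i)
  rw [← Finset.mul_sum] at hs
  calc _ ≤ ρ t * (c * ρ t * ∑ i, (TH : ℝ)⁻¹ * ∑ k, (N ^ 2 + ‖g i k‖ ^ 2)) :=
        mul_le_mul_of_nonneg_left hs hρ.1.le
    _ = _ := by rw [System.batchSq]; ring

lemma pastMeas_auxErr (h : SampledRun sys U ρ γ τq τΓ Γ₀ q₀ Pr ξ X) (t : ℕ) (l : Fin L) :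
    PastMeas Pr ξ t fun ω => (X ω).auxErr sys U ρ (fun t i => ξ t i ω) t l :=
  (((h.stateMeas t).grad l).prodMk (h.pastMeas_auxGrad t l)).comp
    (φ := fun p : Ctrl K M S × Ctrl K M S => ‖p.1 - p.2‖) (by fun_prop)

lemma integrable_auxErr (h : SampledRun sys U ρ γ τq τΓ Γ₀ q₀ Pr ξ X) (hc : sys.Bounds U L c)
    (hB : sys.MomentBound B) (t : ℕ) (l : Fin L) :
    Integrable (fun ω => (X ω).auxErr sys U ρ (fun t i => ξ t i ω) t l) Pr := by
  induction t with
  | zero => simp [Run.auxErr, Run.auxGrad, prev]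
  | succ t ih =>
    refine Integrable.mono' ((ih.const_mul (1 - ρ t)).add
      ((h.integrable_batchSq hB t l).1.const_mul (c * ρ t ^ 2)))
      ((h.pastMeas_auxErr (t + 1) l).aemeasurable h.measurable).aestronglyMeasurable ?_
    filter_upwards [h.ae_auxErr_succ_le hc t l] with ω hω
    exact (Real.norm_of_nonneg (norm_nonneg _)).le.trans hω

/-- Mean distance between the recursive and the auxiliary gradient estimates. -/
def _root_.RCSHP.meanAuxErr (sys : System K M S Tp) (U : EuclideanSpace ℝ (Fin K) → ℝ) (ρ : ℕ → ℝ)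
    (Pr : Measure Ω) (ξ : ℕ → Fin TH → Ω → State K M Tp) (X : Ω → Run K M S L) (t : ℕ) : ℝ :=
  ∫ ω, ∑ l, (X ω).auxErr sys U ρ (fun t i => ξ t i ω) t l ∂Pr

lemma meanAuxErr_succ_le (h : SampledRun sys U ρ γ τq τΓ Γ₀ q₀ Pr ξ X) (hc : sys.Bounds U L c)
    (hB : sys.MomentBound B) :
    ∃ C ≥ 0, ∀ t, meanAuxErr sys U ρ Pr ξ X (t + 1) ≤
      (1 - ρ t) * meanAuxErr sys U ρ Pr ξ X t + C * ρ t ^ 2 := by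
  have hc0 := hc.nonneg
  obtain ⟨W, hW⟩ : ∃ W, W = K * (K * (L * (B : ℝ) ^ 2) +
    (Fintype.card ((Fin M × Fin S) ⊕ Fin K) : ℝ) * (B : ℝ) ^ 2) := ⟨_, rfl⟩
  have hW0 : 0 ≤ W := by rw [hW]; positivity
  refine ⟨L * (c * W), by positivity, fun t => ?_⟩
  have hl : ∀ l, ∫ ω, (X ω).auxErr sys U ρ (fun t i => ξ t i ω) (t + 1) l ∂Pr ≤
      (1 - ρ t) * ∫ ω, (X ω).auxErr sys U ρ (fun t i => ξ t i ω) t l ∂Pr + c * ρ t ^ 2 * W := by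
    intro l
    have h1 := (h.integrable_auxErr hc hB t l).const_mul (1 - ρ t)
    have h2 := (h.integrable_batchSq hB t l).1.const_mul (c * ρ t ^ 2)
    refine (integral_mono_ae (h.integrable_auxErr hc hB (t + 1) l) (h1.add h2)
      (h.ae_auxErr_succ_le hc t l)).trans ?_
    have e := integral_add h1 h2
    simp only [Pi.add_apply, integral_const_mul] at e ⊢
    rw [e]
    refine add_le_add le_rfl (mul_le_mul_of_nonneg_left ?_ (by positivity))
    rw [hW]
    exact (h.integrable_batchSq hB t l).2
  unfold meanAuxErr
  rw [integral_finsetSum _ fun l _ => h.integrable_auxErr hc hB (t + 1) l,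
    integral_finsetSum _ fun l _ => h.integrable_auxErr hc hB t l]
  refine (Finset.sum_le_sum fun l _ => hl l).trans (le_of_eq ?_)
  simp only [Finset.sum_add_distrib, ← Finset.mul_sum, Finset.sum_const, Finset.card_univ,
    Fintype.card_fin, nsmul_eq_mul]
  ring

end SampledRun

end

end RCSHP

/-! ### The Lyapunov function and summability of the weighted errors -/

namespace RCSHP

noncomputable section

variable {K M S Tp L TH : ℕ} {sys : System K M S Tp} {U : EuclideanSpace ℝ (Fin K) → ℝ}
  {ρ γ : ℕ → ℝ} {τq τΓ : ℝ} {Γ₀ : Fin L → Ctrl K M S} {q₀ : EuclideanSpace ℝ (Fin L)}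

/-! ### Summability of the weighted errors -/

/-- Telescoping, with `W` bounded below. -/
lemma summable_of_descent {W a b : ℕ → ℝ} {c : ℝ} {T : ℕ} (ha : ∀ t, 0 ≤ a t) (hb : ∀ t, 0 ≤ b t)
    (hbs : Summable b) (hW : ∀ t, -c ≤ W t) (h : ∀ t ≥ T, W (t + 1) ≤ W t - a t + b t) :
    Summable a := by
  rw [← summable_nat_add_iff T]
  refine summable_of_sum_range_le (c := W T + c + ∑' t, b (t + T)) (fun t => ha _) fun n => ?_
  have h1 : ∀ n, ∑ i ∈ Finset.range n, a (i + T) ≤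
      W T - W (n + T) + ∑ i ∈ Finset.range n, b (i + T) := by
    intro n
    induction n with
    | zero => simp
    | succ n ih =>
      rw [Finset.sum_range_succ, Finset.sum_range_succ]
      have := h (n + T) (Nat.le_add_left _ _)
      rw [show n + 1 + T = n + T + 1 by ring]
      linarith
  have h2 := ((summable_nat_add_iff T).2 hbs).sum_le_tsum (Finset.range n) fun i _ => hb _
  linarith [h1 n, hW (n + T)]

/-- The Lyapunov function is `(C+2)A + B + E - V`. The weight `C + 2` lets the contraction of `A`
pay for the term `CρA` in the recursion of `B`. Once `γ ≤ ηρ` with small `η`, the remaining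
contraction pays for the errors in the ascent inequality, and the ascent `κγD` pays for the drift
terms `(γ²/ρ)D`. -/
lemma summable_weighted_errors (hs : StepSizes ρ γ) {V D A B E : ℕ → ℝ} {c C κ : ℝ} (hC : 0 ≤ C)
    (hκ : 0 < κ) (hV : ∀ t, V t ≤ c) (hD : ∀ t, 0 ≤ D t) (hA : ∀ t, 0 ≤ A t) (hB : ∀ t, 0 ≤ B t)
    (hE : ∀ t, 0 ≤ E t)
    (hA' : ∀ t, A (t + 1) ≤ (1 - ρ t) * A t + C * ρ t ^ 2 + C * (γ t ^ 2 / ρ t) * D t)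
    (hB' : ∀ t, B (t + 1) ≤ (1 - ρ t) * B t + C * ρ t ^ 2 + C * ρ t * A t +
      C * (γ t ^ 2 / ρ t) * D t)
    (hE' : ∀ t, E (t + 1) ≤ (1 - ρ t) * E t + C * ρ t ^ 2)
    (hV' : ∀ t, γ t * (κ * D t - C * (A (t + 1) + B (t + 1) + E (t + 1))) - C * γ t ^ 2 ≤
      V (t + 1) - V t) :
    Summable fun t => γ t * (D t + (A (t + 1) + B (t + 1) + E (t + 1))) := by
  set C₂ : ℝ := C * (C + 4) with hC₂
  have hC₂0 : 0 ≤ C₂ := by positivity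
  -- The first condition lets the ascent errors use at most half of `ρ(A+B+E)`, the second lets all
  -- drift terms use at most half of `κγD`. The added `1`s keep the denominators positive.
  obtain ⟨η, hη, hη1, hη2⟩ : ∃ η > 0, C * (1 + C) * η ≤ 1 / 2 ∧ (C₂ + 2 * C ^ 2) * η ≤ κ / 2 := by
    refine ⟨min (1 / (2 * (C * (1 + C) + 1))) (κ / (2 * (C₂ + 2 * C ^ 2 + 1))), by positivity, ?_, ?_⟩
    · refine (mul_le_mul_of_nonneg_left (min_le_left _ _) (by positivity)).trans ?_
      rw [mul_one_div, div_le_div_iff₀ (by positivity) (by norm_num)]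
      linarith
    · refine (mul_le_mul_of_nonneg_left (min_le_right _ _) (by positivity)).trans ?_
      rw [mul_div_assoc', div_le_div_iff₀ (by positivity) (by norm_num)]
      nlinarith
  obtain ⟨T, hT⟩ := eventually_atTop.1 (hs.ratio_tendsto.eventually (ge_mem_nhds hη))
  have hρ := hs.rho_mem
  have hγ := hs.gamma_mem
  have hγρ : ∀ t ≥ T, γ t ≤ η * ρ t := fun t ht => (div_le_iff₀ (hρ t).1).1 (hT t ht)
  have hr0 : ∀ t, 0 ≤ γ t ^ 2 / ρ t * D t := fun t =>
    mul_nonneg (div_nonneg (sq_nonneg _) (hρ t).1.le) (hD t)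
  have hr : ∀ t ≥ T, γ t ^ 2 / ρ t * D t ≤ η * (γ t * D t) := by
    intro t ht
    have h1 : γ t ^ 2 / ρ t = γ t * (γ t / ρ t) := by ring
    rw [h1]
    have h2 := mul_le_mul_of_nonneg_left (hT t ht) (mul_nonneg (hγ t).1.le (hD t))
    linarith
  have hSum : ∀ t, A (t + 1) + B (t + 1) + E (t + 1) ≤
      (1 + C) * (A t + B t + E t) + 3 * C * ρ t ^ 2 + 2 * C * (γ t ^ 2 / ρ t * D t) := by
    intro t
    have h1 := mul_nonneg (hρ t).1.le (hA t)
    have h2 := mul_nonneg (hρ t).1.le (hB t)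
    have h3 := mul_nonneg (hρ t).1.le (hE t)
    have h4 := mul_nonneg hC (mul_nonneg (sub_nonneg.2 (hρ t).2) (hA t))
    have h5 := mul_nonneg hC (hB t)
    have h6 := mul_nonneg hC (hE t)
    linarith [hA' t, hB' t, hE' t]
  -- The ascent inequality contains the errors at `t + 1`; this bounds them by those at `t`, with
  -- `γ` replaced by `ηρ`.
  have hγSum : ∀ t ≥ T, γ t * (A (t + 1) + B (t + 1) + E (t + 1)) ≤
      (1 + C) * η * (ρ t * (A t + B t + E t)) + 3 * C * ρ t ^ 2 + 2 * C * η * (γ t * D t) := by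
    intro t ht
    have hS0 : 0 ≤ A t + B t + E t := add_nonneg (add_nonneg (hA t) (hB t)) (hE t)
    have h1 := mul_le_mul_of_nonneg_left (hSum t) (hγ t).1.le
    have h2 := mul_le_mul_of_nonneg_right (hγρ t ht) (mul_nonneg (by linarith : 0 ≤ 1 + C) hS0)
    have h3 : γ t * (3 * C * ρ t ^ 2) ≤ 1 * (3 * C * ρ t ^ 2) :=
      mul_le_mul_of_nonneg_right (hγ t).2 (by positivity)
    have h4 : γ t * (2 * C * (γ t ^ 2 / ρ t * D t)) ≤ 1 * (2 * C * (γ t ^ 2 / ρ t * D t)) :=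
      mul_le_mul_of_nonneg_right (hγ t).2 (mul_nonneg (by positivity) (hr0 t))
    have h5 := mul_le_mul_of_nonneg_left (hr t ht) (by positivity : 0 ≤ 2 * C)
    linarith
  have hsum : Summable fun t => 1 / 2 * (ρ t * (A t + B t + E t)) + κ / 2 * (γ t * D t) := by
    refine summable_of_descent (c := c) (T := T)
      (W := fun t => (C + 2) * A t + B t + E t - V t)
      (b := fun t => (C₂ + 3 * C ^ 2) * ρ t ^ 2 + C * γ t ^ 2) (fun t => ?_) (fun t => by positivity)
      ((hs.rho_sq_summable.mul_left _).add (hs.gamma_sq_summable.mul_left _)) (fun t => ?_) ?_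
    · have h1 : 0 ≤ A t + B t + E t := add_nonneg (add_nonneg (hA t) (hB t)) (hE t)
      have h2 := mul_nonneg (hρ t).1.le h1
      have h3 := mul_nonneg (hγ t).1.le (hD t)
      positivity
    · have := mul_nonneg (by linarith : 0 ≤ C + 2) (hA t)
      linarith [hV t, hB t, hE t]
    · intro t ht
      have hS0 : 0 ≤ A t + B t + E t := add_nonneg (add_nonneg (hA t) (hB t)) (hE t)
      have hρS := mul_nonneg (hρ t).1.le hS0
      have hγD := mul_nonneg (hγ t).1.le (hD t)
      have a1 := mul_le_mul_of_nonneg_left (hA' t) (by linarith : 0 ≤ C + 2)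
      have a2 := mul_le_mul_of_nonneg_left (hγSum t ht) hC
      have a3 := mul_le_mul_of_nonneg_left (hr t ht) hC₂0
      have a4 := mul_le_mul_of_nonneg_right hη1 hρS
      have a5 := mul_le_mul_of_nonneg_right hη2 hγD
      have a6 := mul_nonneg (hρ t).1.le (hA t)
      have a7 := mul_nonneg hC (hr0 t)
      have a8 := mul_nonneg hC (sq_nonneg (ρ t))
      linarith [hB' t, hE' t, hV' t]
  have s1 : Summable fun t => ρ t * (A t + B t + E t) := by
    refine Summable.of_nonneg_of_le (fun t => ?_) (fun t => ?_) (hsum.mul_left 2)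
    · exact mul_nonneg (hρ t).1.le (add_nonneg (add_nonneg (hA t) (hB t)) (hE t))
    · have := mul_nonneg hκ.le (mul_nonneg (hγ t).1.le (hD t))
      linarith
  have s2 : Summable fun t => γ t * D t := by
    refine Summable.of_nonneg_of_le (fun t => mul_nonneg (hγ t).1.le (hD t)) (fun t => ?_)
      (hsum.mul_left (2 / κ))
    have h1 := mul_nonneg (hρ t).1.le (add_nonneg (add_nonneg (hA t) (hB t)) (hE t))
    have h2 : γ t * D t = 2 / κ * (κ / 2 * (γ t * D t)) := by field_simp
    rw [mul_add, ← h2]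
    have : 0 ≤ 2 / κ * (1 / 2 * (ρ t * (A t + B t + E t))) := by positivity
    linarith
  have s3 : Summable fun t => (1 + C) * η * (ρ t * (A t + B t + E t)) + 3 * C * ρ t ^ 2 +
      2 * C * η * (γ t * D t) :=
    ((s1.mul_left _).add (hs.rho_sq_summable.mul_left _)).add (s2.mul_left _)
  have s4 : Summable fun t => γ t * (A (t + 1) + B (t + 1) + E (t + 1)) := by
    rw [← summable_nat_add_iff T] at s3 ⊢
    refine Summable.of_nonneg_of_le (fun t => ?_) (fun t => hγSum _ (Nat.le_add_left _ _)) s3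
    exact mul_nonneg (hγ _).1.le (add_nonneg (add_nonneg (hA _) (hB _)) (hE _))
  simpa only [mul_add] using s2.add s4

/-- By Tonelli the sum has finite expectation, so it is finite almost surely. -/
lemma ae_summable_of_summable_integral {Ω : Type*} [MeasurableSpace Ω] {μ : Measure Ω}
    {F : ℕ → Ω → ℝ} (hF : ∀ t, Integrable (F t) μ) (h0 : ∀ t ω, 0 ≤ F t ω)
    (hs : Summable fun t => ∫ ω, F t ω ∂μ) : ∀ᵐ ω ∂μ, Summable fun t => F t ω := by
  have h1 : ∫⁻ ω, ∑' t, ENNReal.ofReal (F t ω) ∂μ ≠ ∞ := by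
    rw [lintegral_tsum fun t => (hF t).aestronglyMeasurable.aemeasurable.ennreal_ofReal]
    have : ∀ t, ∫⁻ ω, ENNReal.ofReal (F t ω) ∂μ = ENNReal.ofReal (∫ ω, F t ω ∂μ) := fun t =>
      (ofReal_integral_eq_lintegral_ofReal (hF t) (Eventually.of_forall (h0 t))).symm
    simp only [this]
    exact hs.tsum_ofReal_ne_top
  have h2 := ae_lt_top' (AEMeasurable.tsum fun t =>
    (hF t).aestronglyMeasurable.aemeasurable.ennreal_ofReal) h1
  filter_upwards [h2] with ω hω
  have := ENNReal.summable_toReal hω.ne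
  simpa only [ENNReal.toReal_ofReal (h0 _ ω)] using this

/-- Errors of the recursive estimates after iteration `t`. -/
def Run.estErr (sys : System K M S Tp) (U : EuclideanSpace ℝ (Fin K) → ℝ) (ρ : ℕ → ℝ)
    (X : Run K M S L) (ω : ℕ → Fin TH → State K M Tp) (t : ℕ) : ℝ :=
  ‖tableVec (X.rateErr sys t)‖ ^ 2 + ∑ l, ‖X.gradErr sys U ρ ω t l‖ ^ 2 +
    ∑ l, X.auxErr sys U ρ ω t l

lemma Run.estErr_nonneg (X : Run K M S L) (ω : ℕ → Fin TH → State K M Tp) (t : ℕ) :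
    0 ≤ X.estErr sys U ρ ω t := by
  have : ∀ l, 0 ≤ X.auxErr sys U ρ ω t l := fun l => norm_nonneg _
  have := Finset.sum_nonneg fun l (_ : l ∈ Finset.univ) => this l
  unfold Run.estErr
  positivity

namespace SampledRun

variable {Ω : Type*} [MeasurableSpace Ω] {Pr : Measure Ω} [IsProbabilityMeasure Pr]
  {ξ : ℕ → Fin TH → Ω → State K M Tp} {X : Ω → Run K M S L} {c : ℝ} {B : ℝ≥0}

lemma integrable_objective (h : SampledRun sys U ρ γ τq τΓ Γ₀ q₀ Pr ξ X) (hc : sys.Bounds U L c)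
    (t : ℕ) : Integrable (fun ω => sys.objective U ((X ω).Γ t, (X ω).q t)) Pr := by
  have h1 : PastMeas Pr ξ t fun ω => approxRate (sys.meanTable ((X ω).Γ t)) ((X ω).q t) :=
    PastMeas.comp (.prodMk (.pi fun k => .pi fun l => h.pastMeas_meanRate t k l)
      (h.stateMeas t).share) continuous_approxRate.measurable
  have h2 := h1.comp_continuousOn h.utility.differentiableOn.continuousOn
    isClosed_orthant.measurableSet fun ω => System.avgRate_mem_orthant (h.feasible t ω).1
      fun l => ((h.feasible t ω).2.1 l).1
  exact Integrable.of_bound (h2.aemeasurable h.measurable).aestronglyMeasurable c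
    (Eventually.of_forall fun ω => hc.abs_objective_le _ _ (h.feasible t ω))

lemma integrable_estErr (h : SampledRun sys U ρ γ τq τΓ Γ₀ q₀ Pr ξ X) (hc : sys.Bounds U L c)
    (hB : sys.MomentBound B) (t : ℕ) :
    Integrable (fun ω => (X ω).estErr sys U ρ (fun t i => ξ t i ω) t) Pr ∧
      ∫ ω, (X ω).estErr sys U ρ (fun t i => ξ t i ω) t ∂Pr = meanRateErr sys Pr X t +
        meanGradErr sys U ρ Pr ξ X t + meanAuxErr sys U ρ Pr ξ X t := by
  have h1 := h.integrable_rateErr_sq hc hB t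
  have h2 := h.integrable_gradErr_sq hc hB t
  have h3 : Integrable (fun ω => ∑ l, (X ω).auxErr sys U ρ (fun t i => ξ t i ω) t l) Pr :=
    integrable_finsetSum _ fun l _ => h.integrable_auxErr hc hB t l
  exact ⟨(h1.add h2).add h3,
    (integral_add (h1.add h2) h3).trans (congrArg (· + _) (integral_add h1 h2))⟩

/-- The pathwise ascent inequality is integrated with `v` the auxiliary gradient. Its errors carry
the index `t + 1`, because the estimates formed in iteration `t` are `prev` at `t + 1` and are
compared with the next iterate. -/
lemma expected_ascent (h : SampledRun sys U ρ γ τq τΓ Γ₀ q₀ Pr ξ X) (hc : sys.Bounds U L c)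
    (hB : sys.MomentBound B) : ∃ κ > 0, ∃ C ≥ 0, ∀ t,
      γ t * (κ * ∫ ω, (X ω).stepSq t ∂Pr - C * (meanRateErr sys Pr X (t + 1) +
        meanGradErr sys U ρ Pr ξ X (t + 1) + meanAuxErr sys U ρ Pr ξ X (t + 1))) - C * γ t ^ 2 ≤
      ∫ ω, sys.objective U ((X ω).Γ (t + 1), (X ω).q (t + 1)) ∂Pr -
        ∫ ω, sys.objective U ((X ω).Γ t, (X ω).q t) ∂Pr := by
  obtain ⟨κ, hκ, C, hC, hasc⟩ := hc.exists_ascent h.share_pos h.ctrl_pos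
  refine ⟨κ, hκ, C, hC, fun t => ?_⟩
  have i1 := h.integrable_stepSq hc t
  obtain ⟨i2, e2⟩ := h.integrable_estErr hc hB (t + 1)
  have i3 := h.integrable_objective hc t
  have i4 := h.integrable_objective hc (t + 1)
  have hpt : ∀ ω, γ t * (κ * (X ω).stepSq t -
      C * (X ω).estErr sys U ρ (fun t i => ξ t i ω) (t + 1)) - C * γ t ^ 2 ≤
      sys.objective U ((X ω).Γ (t + 1), (X ω).q (t + 1)) -
        sys.objective U ((X ω).Γ t, (X ω).q t) := fun ω =>
    hasc ((X ω).Γ t) ((X ω).Γ (t + 1)) ((X ω).Γbar t) ((X ω).q t) ((X ω).q (t + 1)) ((X ω).qbar t)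
      ((X ω).rhat t) ((X ω).grad t) ((X ω).auxGrad sys U ρ (fun t i => ξ t i ω) (t + 1)) (γ t)
      (h.gamma_mem t).1.le (h.gamma_mem t).2 (h.feasible t ω) (h.feasible (t + 1) ω)
      ⟨(h.run ω).Γbar_mem t, (h.run ω).qbar_mem t⟩
      ((h.run ω).prev_rhat_nonneg h.rho_mem (fun t => h.feasible t ω) (t + 1))
      ((h.run ω).Γ_succ t) ((h.run ω).q_succ t) ((h.run ω).Γbar_max t) ((h.run ω).qbar_max t)
  have i5 := ((i1.const_mul κ).sub (i2.const_mul C)).const_mul (γ t)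
  have key := integral_mono (i5.sub (integrable_const (C * γ t ^ 2))) (i4.sub i3) hpt
  have k1 := integral_sub i5 (integrable_const (C * γ t ^ 2))
  have k2 := integral_sub (i1.const_mul κ) (i2.const_mul C)
  have k3 := integral_sub i4 i3
  simp only [Pi.sub_apply, integral_const_mul, integral_const, probReal_univ, one_smul] at key k1 k2 k3
  rw [k1, k2, k3, e2] at key
  exact key

/-- Almost surely, the search directions and the estimation errors are summable with the weights
`γ`. -/
lemma ae_summable (h : SampledRun sys U ρ γ τq τΓ Γ₀ q₀ Pr ξ X) (hs : StepSizes ρ γ) :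
    ∀ᵐ ω ∂Pr, Summable fun t =>
      γ t * ((X ω).stepSq t + (X ω).estErr sys U ρ (fun t i => ξ t i ω) (t + 1)) := by
  have := h.prob
  obtain ⟨c, hc⟩ := System.exists_bounds h.regular h.utility L
  obtain ⟨B, hB⟩ := h.regular.exists_momentBound h.pmax_pos
  obtain ⟨κ, hκ, C₀, h0, hasc⟩ := h.expected_ascent hc hB
  obtain ⟨C₁, h1, hA⟩ := h.meanRateErr_succ_le hc hB
  obtain ⟨C₂, h2, hG⟩ := h.meanGradErr_succ_le hc hB
  obtain ⟨C₃, h3, hE⟩ := h.meanAuxErr_succ_le hc hB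
  set C := C₀ + C₁ + C₂ + C₃ with hC
  have hD0 : ∀ t, 0 ≤ ∫ ω, (X ω).stepSq t ∂Pr := fun t =>
    integral_nonneg fun ω => (X ω).stepSq_nonneg t
  have hA0 : ∀ t, 0 ≤ meanRateErr sys Pr X t := fun t => integral_nonneg fun ω => by positivity
  have hG0 : ∀ t, 0 ≤ meanGradErr sys U ρ Pr ξ X t := fun t =>
    integral_nonneg fun ω => by positivity
  have hE0 : ∀ t, 0 ≤ meanAuxErr sys U ρ Pr ξ X t := fun t =>
    integral_nonneg fun ω => Finset.sum_nonneg fun l _ => norm_nonneg _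
  have hr : ∀ t, 0 ≤ γ t ^ 2 / ρ t * ∫ ω, (X ω).stepSq t ∂Pr := fun t =>
    mul_nonneg (div_nonneg (sq_nonneg _) (h.rho_mem t).1.le) (hD0 t)
  -- The recursions and the ascent inequality come with separate constants; their sum serves in all
  -- of them.
  have key := summable_weighted_errors hs (V := fun t =>
      ∫ ω, sys.objective U ((X ω).Γ t, (X ω).q t) ∂Pr) (c := c) (C := C) (by positivity) hκ
    (fun t => ?_) hD0 hA0 hG0 hE0 (fun t => ?_) (fun t => ?_) (fun t => ?_) (fun t => ?_)
  · refine ae_summable_of_summable_integral (F := fun t ω => γ t * ((X ω).stepSq t +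
      (X ω).estErr sys U ρ (fun t i => ξ t i ω) (t + 1))) (fun t => ?_) (fun t ω => ?_) ?_
    · exact ((h.integrable_stepSq hc t).add (h.integrable_estErr hc hB (t + 1)).1).const_mul _
    · exact mul_nonneg (h.gamma_mem t).1.le
        (add_nonneg ((X ω).stepSq_nonneg t) ((X ω).estErr_nonneg _ _))
    · refine key.congr fun t => ?_
      rw [integral_const_mul, integral_add (h.integrable_stepSq hc t)
        (h.integrable_estErr hc hB (t + 1)).1, (h.integrable_estErr hc hB (t + 1)).2]
  · have := integral_mono (h.integrable_objective hc t) (integrable_const c) fun ω =>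
      (le_abs_self _).trans (hc.abs_objective_le _ _ (h.feasible t ω))
    simpa using this
  · have e1 : 0 ≤ (C₀ + C₂ + C₃) * ρ t ^ 2 := by positivity
    have e2 := mul_nonneg (by positivity : 0 ≤ C₀ + C₂ + C₃) (hr t)
    have := hA t
    rw [hC]; linarith
  · have e1 : 0 ≤ (C₀ + C₁ + C₃) * ρ t ^ 2 := by positivity
    have e2 := mul_nonneg (by positivity : 0 ≤ C₀ + C₁ + C₃) (hr t)
    have e3 := mul_nonneg (by positivity : 0 ≤ C₀ + C₁ + C₃)
      (mul_nonneg (h.rho_mem t).1.le (hA0 t))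
    have := hG t
    rw [hC]; linarith
  · have e1 : 0 ≤ (C₀ + C₁ + C₂) * ρ t ^ 2 := by positivity
    have := hE t
    rw [hC]; linarith
  · have e1 : 0 ≤ (C₁ + C₂ + C₃) * γ t ^ 2 := by positivity
    have e2 := mul_nonneg (by positivity : 0 ≤ C₁ + C₂ + C₃) (mul_nonneg (h.gamma_mem t).1.le
      (add_nonneg (add_nonneg (hA0 (t + 1)) (hG0 (t + 1))) (hE0 (t + 1))))
    have := hasc t
    rw [hC]; linarith

end SampledRun

end

end RCSHP

/-! ### Passing to limit points along a sample path -/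

namespace RCSHP

noncomputable section

variable {K M S Tp L TH : ℕ} {sys : System K M S Tp} {U : EuclideanSpace ℝ (Fin K) → ℝ}
  {ρ γ : ℕ → ℝ} {τq τΓ : ℝ} {Γ₀ : Fin L → Ctrl K M S} {q₀ : EuclideanSpace ℝ (Fin L)}

/-! ### Limit points -/

/-- If the `γ`-weighted sum of `s` is finite, then `s` is small at some late time close to a given
limit point of the iterates `y`. -/
lemma exists_close_of_summable {E : Type*} [NormedAddCommGroup E] {y : ℕ → E} {γ s : ℕ → ℝ} {R : ℝ}
    (hγ : ∀ t, 0 ≤ γ t) (hs : ∀ t, 0 ≤ s t) (hy : ∀ t, ‖y (t + 1) - y t‖ ≤ R * γ t)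
    (hsum : Summable fun t => γ t * s t)
    (hdiv : Tendsto (fun n => ∑ t ∈ Finset.range n, γ t) atTop atTop) {z : E} {φ : ℕ → ℕ}
    (hφ : StrictMono φ) (hz : Tendsto (fun j => y (φ j)) atTop (𝓝 z)) {ε : ℝ} (hε : 0 < ε) (T : ℕ) :
    ∃ t ≥ T, ‖y t - z‖ < ε ∧ s t < ε := by
  -- Otherwise `s ≥ ε` at every late time when `y` is within `ε` of `z`. Starting from a late `y N`
  -- within `ε/2` of `z`, as long as `s ≥ ε` the path has moved at most `R' ∑ γ ≤ (R'/ε) ∑ γ s <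
  -- ε/2`. It therefore never leaves the ball, `s ≥ ε` persists forever, and `∑ γ` is finite, a
  -- contradiction.
  by_contra! hcon
  obtain ⟨R', hR', hy'⟩ : ∃ R' > 0, ∀ t, ‖y (t + 1) - y t‖ ≤ R' * γ t :=
    ⟨|R| + 1, by positivity, fun t => (hy t).trans
      (mul_le_mul_of_nonneg_right (by linarith [le_abs_self R]) (hγ t))⟩
  have htail := tendsto_sum_nat_add fun t => γ t * s t
  -- A tail below this threshold limits the later movement to `ε/2`.
  have h1 : ∀ᶠ N in atTop, ∑' k, γ (k + N) * s (k + N) < ε / R' * (ε / 2) :=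
    htail.eventually (gt_mem_nhds (by positivity))
  have h2 : ∀ᶠ j in atTop, ‖y (φ j) - z‖ < ε / 2 := by
    have := (tendsto_iff_norm_sub_tendsto_zero.1 hz).eventually (gt_mem_nhds (half_pos hε))
    exact this
  obtain ⟨j, hj1, hj2, hj3⟩ := ((hφ.tendsto_atTop.eventually h1).and
    (h2.and (hφ.tendsto_atTop.eventually (eventually_ge_atTop T)))).exists
  set N := φ j with hN
  have hsN : Summable fun k => γ (k + N) * s (k + N) := (summable_nat_add_iff N).2 hsum
  have hγs : ∀ k, 0 ≤ γ (k + N) * s (k + N) := fun k => mul_nonneg (hγ _) (hs _)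
  have hpart : ∀ n, (∀ k < n, ε ≤ s (k + N)) →
      ε * ∑ k ∈ Finset.range n, γ (k + N) ≤ ∑' k, γ (k + N) * s (k + N) := by
    intro n hn
    refine le_trans ?_ (hsN.sum_le_tsum (Finset.range n) fun k _ => hγs k)
    rw [Finset.mul_sum]
    refine Finset.sum_le_sum fun k hk => ?_
    rw [mul_comm]
    exact mul_le_mul_of_nonneg_left (hn k (Finset.mem_range.1 hk)) (hγ _)
  have hdist : ∀ n, ‖y (n + N) - y N‖ ≤ R' * ∑ k ∈ Finset.range n, γ (k + N) := by
    intro n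
    induction n with
    | zero => simp
    | succ n ih =>
      rw [Finset.sum_range_succ, show n + 1 + N = n + N + 1 by ring]
      have := norm_add_le (y (n + N + 1) - y (n + N)) (y (n + N) - y N)
      rw [sub_add_sub_cancel] at this
      linarith [hy' (n + N)]
  have hstay : ∀ n, ε ≤ s (n + N) := by
    intro n
    induction n using Nat.strong_induction_on with
    | _ n ih =>
      refine hcon _ (hj3.trans (Nat.le_add_left _ _)) ?_
      have a1 := (hpart n ih).trans_lt hj1
      have a2 : ∑ k ∈ Finset.range n, γ (k + N) < 1 / R' * (ε / 2) := by
        have : ε * ∑ k ∈ Finset.range n, γ (k + N) < ε * (1 / R' * (ε / 2)) :=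
          a1.trans_eq (by ring)
        exact lt_of_mul_lt_mul_left this hε.le
      have a3 : R' * ∑ k ∈ Finset.range n, γ (k + N) < ε / 2 := by
        have := mul_lt_mul_of_pos_left a2 hR'
        rwa [← mul_assoc, mul_one_div_cancel hR'.ne', one_mul] at this
      have a4 := norm_add_le (y (n + N) - y N) (y N - z)
      rw [sub_add_sub_cancel] at a4
      linarith [hdist n]
  have hbdd : ∀ n, ∑ k ∈ Finset.range n, γ k ≤
      (∑' k, γ (k + N) * s (k + N)) / ε + ∑ k ∈ Finset.range N, γ k := by
    intro n
    have b1 : ∑ k ∈ Finset.range n, γ k ≤ ∑ k ∈ Finset.range (N + n), γ k :=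
      Finset.sum_le_sum_of_subset_of_nonneg (Finset.range_mono (Nat.le_add_left _ _))
        fun k _ _ => hγ k
    rw [Finset.sum_range_add] at b1
    have b2 : ∑ k ∈ Finset.range n, γ (k + N) ≤ (∑' k, γ (k + N) * s (k + N)) / ε := by
      rw [le_div_iff₀ hε, mul_comm]
      exact hpart n fun k _ => hstay k
    simp only [add_comm N] at b1
    linarith
  exact not_bddAbove_of_tendsto_atTop hdiv ⟨_, Set.forall_mem_range.2 hbdd⟩

namespace SampledRun

variable {Ω : Type*} [MeasurableSpace Ω] {Pr : Measure Ω} {ξ : ℕ → Fin TH → Ω → State K M Tp}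
  {X : Ω → Run K M S L} {c : ℝ}

/-- Along a suitable sequence of iterations that tends to a limit point, the errors vanish. -/
lemma exists_tendsto (h : SampledRun sys U ρ γ τq τΓ Γ₀ q₀ Pr ξ X) (hs : StepSizes ρ γ) {ω : Ω}
    (hsum : Summable fun t =>
      γ t * ((X ω).stepSq t + (X ω).estErr sys U ρ (fun t i => ξ t i ω) (t + 1)))
    {x : (Fin L → Ctrl K M S) × EuclideanSpace ℝ (Fin L)} {φ : ℕ → ℕ} (hφ : StrictMono φ)
    (hx : Tendsto (fun j => ((X ω).Γ (φ j), (X ω).q (φ j))) atTop (𝓝 x)) :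
    ∃ ψ : ℕ → ℕ, Tendsto ψ atTop atTop ∧
      Tendsto (fun j => ((X ω).Γ (ψ j), (X ω).q (ψ j))) atTop (𝓝 x) ∧
      Tendsto (fun j => (X ω).stepSq (ψ j)) atTop (𝓝 0) ∧
      Tendsto (fun j => (X ω).estErr sys U ρ (fun t i => ξ t i ω) (ψ j + 1)) atTop (𝓝 0) := by
  have := h.prob
  obtain ⟨c, hc⟩ := System.exists_bounds h.regular h.utility L
  set s : ℕ → ℝ := fun t =>
    (X ω).stepSq t + (X ω).estErr sys U ρ (fun t i => ξ t i ω) (t + 1) with hsdef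
  have hs0 : ∀ t, 0 ≤ s t := fun t =>
    add_nonneg ((X ω).stepSq_nonneg t) ((X ω).estErr_nonneg _ _)
  have hstep : ∀ t, ‖((X ω).Γ (t + 1), (X ω).q (t + 1)) - ((X ω).Γ t, (X ω).q t)‖ ≤
      √(L * c ^ 2 + 4) * γ t := by
    intro t
    have hb : γ t * √((X ω).stepSq t) ≤ √(L * c ^ 2 + 4) * γ t := by
      rw [mul_comm]
      exact mul_le_mul_of_nonneg_right (Real.sqrt_le_sqrt (h.stepSq_le hc t ω))
        (h.gamma_mem t).1.le
    have hb0 : 0 ≤ √(L * c ^ 2 + 4) * γ t :=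
      mul_nonneg (Real.sqrt_nonneg _) (h.gamma_mem t).1.le
    rw [Prod.mk_sub_mk, Prod.norm_mk]
    refine max_le ((pi_norm_le_iff_of_nonneg hb0).2 fun l => ?_)
      ((h.norm_share_step_le t ω).trans hb)
    exact (h.norm_ctrl_step_le t ω l).trans hb
  have key := fun j : ℕ => exists_close_of_summable (y := fun t => ((X ω).Γ t, (X ω).q t))
    (fun t => (h.gamma_mem t).1.le) hs0 hstep hsum hs.gamma_sum hφ hx
    (ε := 1 / ((j : ℝ) + 1)) (by positivity) j
  choose ψ h1 h2 h3 using key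
  have hlim := tendsto_one_div_add_atTop_nhds_zero_nat (𝕜 := ℝ)
  refine ⟨ψ, tendsto_atTop_mono h1 tendsto_id, ?_, ?_, ?_⟩
  · exact tendsto_iff_norm_sub_tendsto_zero.2
      (squeeze_zero (fun _ => norm_nonneg _) (fun j => (h2 j).le) hlim)
  · exact squeeze_zero (fun j => (X ω).stepSq_nonneg _)
      (fun j => (le_add_of_nonneg_right ((X ω).estErr_nonneg _ _)).trans (h3 j).le) hlim
  · exact squeeze_zero (fun j => (X ω).estErr_nonneg _ _)
      (fun j => (le_add_of_nonneg_left ((X ω).stepSq_nonneg _)).trans (h3 j).le) hlim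

lemma feasible_of_tendsto (h : SampledRun sys U ρ γ τq τΓ Γ₀ q₀ Pr ξ X) {ω : Ω}
    {x : (Fin L → Ctrl K M S) × EuclideanSpace ℝ (Fin L)} {ψ : ℕ → ℕ}
    (hx : Tendsto (fun j => ((X ω).Γ (ψ j), (X ω).q (ψ j))) atTop (𝓝 x)) :
    sys.Feasible x.1 x.2 := by
  have hΓ : Tendsto (fun j => (X ω).Γ (ψ j)) atTop (𝓝 x.1) := (continuous_fst.tendsto x).comp hx
  have hq : Tendsto (fun j => (X ω).q (ψ j)) atTop (𝓝 x.2) := (continuous_snd.tendsto x).comp hx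
  exact ⟨fun l => sys.isClosed_ctrlSet.mem_of_tendsto (tendsto_pi_nhds.1 hΓ l)
    (Eventually.of_forall fun j => (h.feasible _ ω).1 l),
    isCompact_shareSet.isClosed.mem_of_tendsto hq
      (Eventually.of_forall fun j => (h.feasible _ ω).2)⟩

/-- At a limit point, the surrogate problems with the true rates and gradients are solved by the
limit point itself. -/
lemma surrogate_optimal (h : SampledRun sys U ρ γ τq τΓ Γ₀ q₀ Pr ξ X) (hs : StepSizes ρ γ) {ω : Ω}
    (hsum : Summable fun t =>
      γ t * ((X ω).stepSq t + (X ω).estErr sys U ρ (fun t i => ξ t i ω) (t + 1)))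
    {x : (Fin L → Ctrl K M S) × EuclideanSpace ℝ (Fin L)} {φ : ℕ → ℕ} (hφ : StrictMono φ)
    (hx : Tendsto (fun j => ((X ω).Γ (φ j), (X ω).q (φ j))) atTop (𝓝 x)) :
    (∀ l, ∀ y ∈ sys.ctrlSet,
      inner ℝ (sys.ctrlGrad U x.1 x.2 l) (y - x.1 l) - τΓ * ‖y - x.1 l‖ ^ 2 ≤ 0) ∧
    ∀ p ∈ shareSet L, U (approxRate (sys.meanTable x.1) p) - τq * ‖p - x.2‖ ^ 2 ≤
      sys.objective U x := by
  have := h.prob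
  obtain ⟨c, hc⟩ := System.exists_bounds h.regular h.utility L
  obtain ⟨ψ, -, hxψ, hstep, herr⟩ := h.exists_tendsto hs hsum hφ hx
  have hfx := h.feasible_of_tendsto hxψ
  have hΓ : ∀ l, Tendsto (fun j => (X ω).Γ (ψ j) l) atTop (𝓝 (x.1 l)) :=
    tendsto_pi_nhds.1 ((continuous_fst.tendsto x).comp hxψ)
  have hq : Tendsto (fun j => (X ω).q (ψ j)) atTop (𝓝 x.2) := (continuous_snd.tendsto x).comp hxψ
  have hsqrt : Tendsto (fun j => √((X ω).stepSq (ψ j))) atTop (𝓝 0) := by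
    simpa [Function.comp_def] using (Real.continuous_sqrt.tendsto 0).comp hstep
  have hdΓ : ∀ l, Tendsto (fun j => (X ω).Γbar (ψ j) l - (X ω).Γ (ψ j) l) atTop (𝓝 0) := by
    intro l
    refine squeeze_zero_norm (fun j => Real.le_sqrt_of_sq_le ?_) hsqrt
    have h1 := Finset.single_le_sum (f := fun l => ‖(X ω).Γbar (ψ j) l - (X ω).Γ (ψ j) l‖ ^ 2)
      (fun _ _ => by positivity) (Finset.mem_univ l)
    have h2 : 0 ≤ ‖(X ω).qbar (ψ j) - (X ω).q (ψ j)‖ ^ 2 := by positivity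
    unfold Run.stepSq
    linarith
  have hdq : Tendsto (fun j => (X ω).qbar (ψ j) - (X ω).q (ψ j)) atTop (𝓝 0) := by
    refine squeeze_zero_norm (fun j => Real.le_sqrt_of_sq_le ?_) hsqrt
    have : 0 ≤ ∑ l, ‖(X ω).Γbar (ψ j) l - (X ω).Γ (ψ j) l‖ ^ 2 := by positivity
    unfold Run.stepSq
    linarith
  have hqb : Tendsto (fun j => (X ω).qbar (ψ j)) atTop (𝓝 x.2) := by
    simpa using hdq.add hq
  have hstep0 : Tendsto (fun j => γ (ψ j) * √((X ω).stepSq (ψ j))) atTop (𝓝 0) :=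
    squeeze_zero (fun j => mul_nonneg (h.gamma_mem _).1.le (Real.sqrt_nonneg _))
      (fun j => mul_le_of_le_one_left (Real.sqrt_nonneg _) (h.gamma_mem _).2) hsqrt
  -- The estimates of iteration `t` are accurate relative to the iterate at `t + 1`, so the shifted
  -- iterates are needed; they have the same limit because the steps vanish.
  have hΓ' : ∀ l, Tendsto (fun j => (X ω).Γ (ψ j + 1) l) atTop (𝓝 (x.1 l)) := by
    intro l
    have := (squeeze_zero_norm (fun j => h.norm_ctrl_step_le (ψ j) ω l) hstep0).add (hΓ l)
    simpa using this
  have hq' : Tendsto (fun j => (X ω).q (ψ j + 1)) atTop (𝓝 x.2) := by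
    have := (squeeze_zero_norm (fun j => h.norm_share_step_le (ψ j) ω) hstep0).add hq
    simpa using this
  have haux0 : ∀ j l, 0 ≤ (X ω).auxErr sys U ρ (fun t i => ξ t i ω) (ψ j + 1) l :=
    fun j l => norm_nonneg _
  have hsq : ∀ {a : ℕ → ℝ}, (∀ j, 0 ≤ a j) → (∀ j, a j ^ 2 ≤
      (X ω).estErr sys U ρ (fun t i => ξ t i ω) (ψ j + 1)) → Tendsto a atTop (𝓝 0) := by
    intro a ha0 ha
    have h1 : Tendsto (fun j => √((X ω).estErr sys U ρ (fun t i => ξ t i ω) (ψ j + 1))) atTop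
        (𝓝 0) := by
      simpa [Function.comp_def] using (Real.continuous_sqrt.tendsto 0).comp herr
    exact squeeze_zero ha0 (fun j => Real.le_sqrt_of_sq_le (ha j)) h1
  have hauxs : ∀ j, 0 ≤ ∑ l, (X ω).auxErr sys U ρ (fun t i => ξ t i ω) (ψ j + 1) l := fun j =>
    Finset.sum_nonneg fun l _ => haux0 j l
  have hgrads : ∀ j, 0 ≤ ∑ l, ‖(X ω).gradErr sys U ρ (fun t i => ξ t i ω) (ψ j + 1) l‖ ^ 2 :=
    fun j => by positivity
  have hrates : ∀ j, 0 ≤ ‖tableVec ((X ω).rateErr sys (ψ j + 1))‖ ^ 2 := fun j => by positivity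
  have hrate : Tendsto (fun j => ‖tableVec ((X ω).rateErr sys (ψ j + 1))‖) atTop (𝓝 0) := by
    refine hsq (fun j => norm_nonneg _) fun j => ?_
    have h1 := hauxs j
    have h2 := hgrads j
    unfold Run.estErr
    linarith
  have hgrad : ∀ l, Tendsto (fun j => (X ω).gradErr sys U ρ (fun t i => ξ t i ω) (ψ j + 1) l) atTop
      (𝓝 0) := by
    intro l
    refine tendsto_zero_iff_norm_tendsto_zero.2 (hsq (fun j => norm_nonneg _) fun j => ?_)
    have h1 := hauxs j
    have h2 := hrates j
    have h3 := Finset.single_le_sum (f := fun l =>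
      ‖(X ω).gradErr sys U ρ (fun t i => ξ t i ω) (ψ j + 1) l‖ ^ 2)
      (fun _ _ => by positivity) (Finset.mem_univ l)
    unfold Run.estErr
    linarith
  have haux : ∀ l, Tendsto (fun j => (X ω).grad (ψ j) l -
      (X ω).auxGrad sys U ρ (fun t i => ξ t i ω) (ψ j + 1) l) atTop (𝓝 0) := by
    intro l
    refine squeeze_zero_norm (fun j => ?_) herr
    have h1 := hgrads j
    have h2 := hrates j
    have h3 : (X ω).auxErr sys U ρ (fun t i => ξ t i ω) (ψ j + 1) l ≤ _ :=
      Finset.single_le_sum (f := fun l => (X ω).auxErr sys U ρ (fun t i => ξ t i ω) (ψ j + 1) l)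
        (fun l _ => haux0 j l) (Finset.mem_univ l)
    change (X ω).auxErr sys U ρ (fun t i => ξ t i ω) (ψ j + 1) l ≤ _
    unfold Run.estErr
    linarith
  have hctrl : ∀ l, Tendsto (fun j => sys.ctrlGrad U ((X ω).Γ (ψ j + 1)) ((X ω).q (ψ j + 1)) l)
      atTop (𝓝 (sys.ctrlGrad U x.1 x.2 l)) := by
    intro l
    have h1 := tendsto_iff_norm_sub_tendsto_zero.1 (tendsto_pi_nhds.2 hΓ')
    have h2 := ((h1.add (tendsto_iff_norm_sub_tendsto_zero.1 hq')).const_mul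
      (K * (c * c + c * (c + K * L * c) * c + c * c)))
    rw [add_zero, mul_zero] at h2
    refine tendsto_sub_nhds_zero_iff.1 (squeeze_zero_norm (fun j => ?_) h2)
    refine hc.norm_ctrlGrad_sub_le hfx (h.feasible _ ω) (fun l => ?_) ?_ l
    · exact (norm_le_pi_norm (fun l => (X ω).Γ (ψ j + 1) l - x.1 l) l).trans
        (le_add_of_nonneg_right (norm_nonneg _))
    · exact le_add_of_nonneg_left (norm_nonneg _)
  have hf : ∀ l, Tendsto (fun j => (X ω).grad (ψ j) l) atTop (𝓝 (sys.ctrlGrad U x.1 x.2 l)) := by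
    intro l
    have := ((haux l).add (hgrad l)).add (hctrl l)
    simpa [Run.gradErr] using this
  have hmean : ∀ k l, Tendsto (fun j => sys.meanRate k ((X ω).Γ (ψ j + 1) l)) atTop
      (𝓝 (sys.meanRate k (x.1 l))) := by
    intro k l
    have hb : ∀ j, ‖sys.meanRate k ((X ω).Γ (ψ j + 1) l) - sys.meanRate k (x.1 l)‖ ≤
        c * ‖(X ω).Γ (ψ j + 1) l - x.1 l‖ := fun j =>
      hc.meanRate_lip k _ (hfx.1 l) _ ((h.feasible _ ω).1 l)
    have h0 := (tendsto_iff_norm_sub_tendsto_zero.1 (hΓ' l)).const_mul c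
    rw [mul_zero] at h0
    exact tendsto_sub_nhds_zero_iff.1 (squeeze_zero_norm hb h0)
  have hr : Tendsto (fun j => (X ω).rhat (ψ j)) atTop (𝓝 (sys.meanTable x.1)) := by
    refine tendsto_pi_nhds.2 fun k => tendsto_pi_nhds.2 fun l => ?_
    have h1 : Tendsto (fun j => (X ω).rateErr sys (ψ j + 1) k l) atTop (𝓝 0) :=
      squeeze_zero_norm (fun j =>
        abs_apply_le_norm (tableVec ((X ω).rateErr sys (ψ j + 1))) (k, l)) hrate
    have := h1.add (hmean k l)
    simpa [Run.rateErr, prev, System.meanTable] using this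
  -- Both claims are limits of the maximality inequalities of the surrogate solutions. As the search
  -- directions vanish, the maximal surrogate values tend to `0` for the control blocks and to the
  -- true objective for the time-sharing block.
  refine ⟨fun l y hy => ?_, fun p hp => ?_⟩
  · have l1 : Tendsto (fun j => inner ℝ ((X ω).grad (ψ j) l) (y - (X ω).Γ (ψ j) l) -
        τΓ * ‖y - (X ω).Γ (ψ j) l‖ ^ 2) atTop
        (𝓝 (inner ℝ (sys.ctrlGrad U x.1 x.2 l) (y - x.1 l) - τΓ * ‖y - x.1 l‖ ^ 2)) :=
      ((hf l).inner ((hΓ l).const_sub y)).sub ((((hΓ l).const_sub y).norm.pow 2).const_mul τΓ)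
    have l2 : Tendsto (fun j =>
        inner ℝ ((X ω).grad (ψ j) l) ((X ω).Γbar (ψ j) l - (X ω).Γ (ψ j) l) -
        τΓ * ‖(X ω).Γbar (ψ j) l - (X ω).Γ (ψ j) l‖ ^ 2) atTop
        (𝓝 (inner ℝ (sys.ctrlGrad U x.1 x.2 l) (0 : Ctrl K M S) - τΓ * ‖(0 : Ctrl K M S)‖ ^ 2)) :=
      ((hf l).inner (hdΓ l)).sub (((hdΓ l).norm.pow 2).const_mul τΓ)
    have := le_of_tendsto_of_tendsto' l1 l2 fun j => (h.run ω).Γbar_max (ψ j) l hy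
    simpa using this
  · have hUc := h.utility.differentiableOn.continuousOn
    have happ : ∀ {p : ℕ → EuclideanSpace ℝ (Fin L)} {p' : EuclideanSpace ℝ (Fin L)},
        (∀ j, p j ∈ shareSet L) → p' ∈ shareSet L → Tendsto p atTop (𝓝 p') →
        Tendsto (fun j => U (approxRate ((X ω).rhat (ψ j)) (p j))) atTop
          (𝓝 (U (approxRate (sys.meanTable x.1) p'))) := by
      intro p p' hpm hpm' hpt
      have ht : Tendsto (fun j => approxRate ((X ω).rhat (ψ j)) (p j)) atTop
          (𝓝 (approxRate (sys.meanTable x.1) p')) :=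
        (continuous_approxRate.tendsto (sys.meanTable x.1, p')).comp (hr.prodMk_nhds hpt)
      refine (hUc _ (System.avgRate_mem_orthant hfx.1 fun l => (hpm'.1 l).1)).tendsto.comp
        (tendsto_nhdsWithin_iff.2 ⟨ht, Eventually.of_forall fun j => ?_⟩)
      exact approxRate_mem_orthant ((h.run ω).prev_rhat_nonneg h.rho_mem
        (fun t => h.feasible t ω) (ψ j + 1)) fun l => ((hpm j).1 l).1
    have l1 := (happ (fun _ => hp) hp tendsto_const_nhds).sub
      (((hq.const_sub p).norm.pow 2).const_mul τq)
    have l2 := (happ (fun j => (h.run ω).qbar_mem (ψ j)) hfx.2 hqb).sub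
      ((hdq.norm.pow 2).const_mul τq)
    have := le_of_tendsto_of_tendsto' l1 l2 fun j => (h.run ω).qbar_max (ψ j) hp
    simpa [System.objective, System.avgRate_eq] using this

end SampledRun

end

end RCSHP

/-! ### From proximal optimality to Lagrange multipliers -/

namespace RCSHP

noncomputable section

variable {K M S Tp L : ℕ} {sys : System K M S Tp} {U : EuclideanSpace ℝ (Fin K) → ℝ}

/-! ### KKT points -/

lemma nonpos_of_forall_mul_le {a C : ℝ} (h : ∀ ε ∈ Set.Ioc (0 : ℝ) 1, ε * a ≤ ε ^ 2 * C) : a ≤ 0 := by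
  have h1 : ∀ ε ∈ Set.Ioc (0 : ℝ) 1, a ≤ ε * C := fun ε hε =>
    le_of_mul_le_mul_left (by linarith [h ε hε]) hε.1
  have h2 : Tendsto (fun ε : ℝ => ε * C) (𝓝[>] 0) (𝓝 (0 * C)) :=
    ((continuous_mul_const C).tendsto 0).mono_left nhdsWithin_le_nhds
  rw [zero_mul] at h2
  exact ge_of_tendsto h2 (by
    filter_upwards [Ioc_mem_nhdsGT (zero_lt_one' ℝ)] with ε hε using h1 ε hε)

/-- Moving only a fraction `ε` of the way to `y` scales the linear term by `ε` and the proximal term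
by `ε²`; dividing by `ε` and letting `ε → 0` leaves the linear term. -/
lemma inner_nonpos_of_prox {E : Type*} [NormedAddCommGroup E] [InnerProductSpace ℝ E] {s : Set E}
    (hs : Convex ℝ s) {g x : E} (hx : x ∈ s) {τ : ℝ}
    (h : ∀ y ∈ s, inner ℝ g (y - x) - τ * ‖y - x‖ ^ 2 ≤ 0) {y : E} (hy : y ∈ s) :
    inner ℝ g (y - x) ≤ 0 := by
  refine nonpos_of_forall_mul_le (C := τ * ‖y - x‖ ^ 2) fun ε hε => ?_
  have h1 := h (x + ε • (y - x)) (hs.add_smul_sub_mem hx hy ⟨hε.1.le, hε.2⟩)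
  rw [add_sub_cancel_left, inner_smul_right, norm_smul, mul_pow, Real.norm_eq_abs, sq_abs] at h1
  linarith

/-- Derivatives of the objective with respect to the time-sharing factors. -/
def System.shareGrad (sys : System K M S Tp) (U : EuclideanSpace ℝ (Fin K) → ℝ)
    (Γ : Fin L → Ctrl K M S) (q : EuclideanSpace ℝ (Fin L)) (l : Fin L) : ℝ :=
  ∑ k, utilGrad U (sys.avgRate Γ q) k * sys.meanRate k (Γ l)

lemma System.inner_utilGrad_approxRate (Γ : Fin L → Ctrl K M S) (q p : EuclideanSpace ℝ (Fin L)) :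
    inner ℝ (utilGrad U (sys.avgRate Γ q)) (approxRate (sys.meanTable Γ) p) =
      ∑ l, sys.shareGrad U Γ q l * p l := by
  simp only [PiLp.inner_apply, approxRate, System.shareGrad, System.meanTable, Finset.sum_mul,
    RCLike.inner_apply, conj_trivial]
  rw [Finset.sum_comm]
  exact Finset.sum_congr rfl fun k _ => Finset.sum_congr rfl fun l _ => by ring

/-- The same scaling as for the control blocks; here the Taylor remainder of `U` is a second term of
order `ε²`. -/
lemma System.Bounds.shareGrad_nonpos {c τ : ℝ} (hc : sys.Bounds U L c) {Γ : Fin L → Ctrl K M S}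
    {q : EuclideanSpace ℝ (Fin L)} (hf : sys.Feasible Γ q)
    (h : ∀ p ∈ shareSet L, U (approxRate (sys.meanTable Γ) p) - τ * ‖p - q‖ ^ 2 ≤
      sys.objective U (Γ, q)) {p : EuclideanSpace ℝ (Fin L)} (hp : p ∈ shareSet L) :
    ∑ l, sys.shareGrad U Γ q l * (p l - q l) ≤ 0 := by
  have hmem : ∀ {p : EuclideanSpace ℝ (Fin L)}, p ∈ shareSet L →
      approxRate (sys.meanTable Γ) p ∈ orthant K := fun hp =>
    System.avgRate_mem_orthant hf.1 fun l => (hp.1 l).1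
  refine nonpos_of_forall_mul_le
    (C := τ * ‖p - q‖ ^ 2 + c * ‖approxRate (sys.meanTable Γ) (p - q)‖ ^ 2) fun ε hε => ?_
  have hpε := convex_shareSet.add_smul_sub_mem hf.2 hp ⟨hε.1.le, hε.2⟩
  have h1 := h _ hpε
  have h2 := (abs_le.1 (hc.util_taylor _ (hmem hf.2) _ (hmem hpε))).1
  have e : approxRate (sys.meanTable Γ) (ε • (p - q)) = ε • approxRate (sys.meanTable Γ) (p - q) := by
    ext k
    simp only [approxRate, PiLp.smul_apply, smul_eq_mul, Finset.mul_sum, mul_assoc]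
  have hi := System.inner_utilGrad_approxRate (sys := sys) (U := U) Γ q (p - q)
  rw [System.avgRate_eq] at hi
  rw [← approxRate_sub_right, add_sub_cancel_left, e, inner_smul_right, hi, norm_smul, mul_pow, Real.norm_eq_abs, sq_abs] at h2
  rw [add_sub_cancel_left, norm_smul, mul_pow, Real.norm_eq_abs, sq_abs] at h1
  simp only [PiLp.sub_apply, System.objective, System.avgRate_eq] at h1 h2
  linarith

/-! ### The derivative of the objective -/

/-- The derivative of the objective. -/
def System.objectiveDeriv (sys : System K M S Tp) (U : EuclideanSpace ℝ (Fin K) → ℝ)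
    (x : (Fin L → Ctrl K M S) × EuclideanSpace ℝ (Fin L)) :
    ((Fin L → Ctrl K M S) × EuclideanSpace ℝ (Fin L)) →L[ℝ] ℝ :=
  ∑ l, (innerSL ℝ (sys.ctrlGrad U x.1 x.2 l) ∘L ContinuousLinearMap.proj l ∘L
      ContinuousLinearMap.fst ℝ (Fin L → Ctrl K M S) (EuclideanSpace ℝ (Fin L)) +
    sys.shareGrad U x.1 x.2 l • EuclideanSpace.proj l ∘L
      ContinuousLinearMap.snd ℝ (Fin L → Ctrl K M S) (EuclideanSpace ℝ (Fin L)))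

lemma System.objectiveDeriv_apply (x v : (Fin L → Ctrl K M S) × EuclideanSpace ℝ (Fin L)) :
    sys.objectiveDeriv U x v = ∑ l, inner ℝ (sys.ctrlGrad U x.1 x.2 l) (v.1 l) +
      ∑ l, sys.shareGrad U x.1 x.2 l * v.2 l := by
  simp [System.objectiveDeriv, Finset.sum_add_distrib]

/-- A chain rule with one-sided derivatives throughout: the domain is mapped into the control set by
each block of `Γ` and into the orthant by the average rates, which is where the mean rates and `U`
are differentiable. -/
lemma System.hasFDerivWithinAt_objective (hreg : sys.RegularRates) (hU : IsUtility U)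
    {x : (Fin L → Ctrl K M S) × EuclideanSpace ℝ (Fin L)} (hx : x ∈ domain sys L) :
    HasFDerivWithinAt (sys.objective U) (sys.objectiveDeriv U x) (domain sys L) x := by
  have h1 : ∀ k l, HasFDerivWithinAt
      (fun y : (Fin L → Ctrl K M S) × EuclideanSpace ℝ (Fin L) => sys.meanRate k (y.1 l))
      (innerSL ℝ (sys.meanGrad k (x.1 l)) ∘L ContinuousLinearMap.proj l ∘L
        ContinuousLinearMap.fst ℝ (Fin L → Ctrl K M S) (EuclideanSpace ℝ (Fin L)))
      (domain sys L) x := by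
    intro k l
    have a1 : HasFDerivWithinAt (sys.meanRate k) (innerSL ℝ (sys.meanGrad k (x.1 l))) sys.ctrlSet
        (x.1 l) :=
      (hreg.meanRate_differentiable k (x.1 l) (hx.1 l)).hasGradientWithinAt.hasFDerivWithinAt
    exact HasFDerivWithinAt.comp x
      (f := fun y : (Fin L → Ctrl K M S) × EuclideanSpace ℝ (Fin L) => y.1 l) a1
      ((ContinuousLinearMap.proj (R := ℝ) (φ := fun _ : Fin L => Ctrl K M S) l ∘L
        ContinuousLinearMap.fst ℝ (Fin L → Ctrl K M S)
          (EuclideanSpace ℝ (Fin L))).hasFDerivAt.hasFDerivWithinAt) fun y hy => hy.1 l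
  have h2 : ∀ l : Fin L, HasFDerivWithinAt
      (fun y : (Fin L → Ctrl K M S) × EuclideanSpace ℝ (Fin L) => y.2 l)
      (EuclideanSpace.proj l ∘L
        ContinuousLinearMap.snd ℝ (Fin L → Ctrl K M S) (EuclideanSpace ℝ (Fin L)))
      (domain sys L) x := fun l =>
    ((EuclideanSpace.proj l : EuclideanSpace ℝ (Fin L) →L[ℝ] ℝ) ∘L
      ContinuousLinearMap.snd ℝ (Fin L → Ctrl K M S)
        (EuclideanSpace ℝ (Fin L))).hasFDerivAt.hasFDerivWithinAt
  have h3 := fun k => HasFDerivWithinAt.fun_sum (u := Finset.univ) fun l _ => (h2 l).mul (h1 k l)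
  have h4 : HasFDerivWithinAt (fun y : (Fin L → Ctrl K M S) × EuclideanSpace ℝ (Fin L) =>
      sys.avgRate y.1 y.2) _ (domain sys L) x :=
    (PiLp.hasFDerivAt_toLp (𝕜 := ℝ) 2 _).comp_hasFDerivWithinAt x
      (hasFDerivWithinAt_pi.2 h3)
  have h5 : HasFDerivWithinAt U (innerSL ℝ (utilGrad U (sys.avgRate x.1 x.2))) (orthant K)
      (sys.avgRate x.1 x.2) :=
    (hU.differentiableOn _ (System.avgRate_mem_orthant hx.1 hx.2)
      ).hasGradientWithinAt.hasFDerivWithinAt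
  refine (h5.comp x h4 fun y hy => System.avgRate_mem_orthant hy.1 hy.2).congr_fderiv ?_
  refine ContinuousLinearMap.ext fun v => ?_
  rw [System.objectiveDeriv_apply]
  have e : ∀ w : EuclideanSpace ℝ (Fin K), ∀ a : Fin K → ℝ,
      innerSL ℝ w ((PiLp.continuousLinearEquiv 2 ℝ fun _ : Fin K => ℝ).symm a) =
        ∑ k, w k * a k := by
    intro w a
    simp [PiLp.inner_apply, mul_comm]
  have e2 : ∀ k, (∑ l, (x.2 l • innerSL ℝ (sys.meanGrad k (x.1 l)) ∘L ContinuousLinearMap.proj l ∘L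
      ContinuousLinearMap.fst ℝ (Fin L → Ctrl K M S) (EuclideanSpace ℝ (Fin L)) +
      sys.meanRate k (x.1 l) • EuclideanSpace.proj l ∘L
        ContinuousLinearMap.snd ℝ (Fin L → Ctrl K M S) (EuclideanSpace ℝ (Fin L)))) v =
      ∑ l, (x.2 l * inner ℝ (sys.meanGrad k (x.1 l)) (v.1 l) +
        sys.meanRate k (x.1 l) * v.2 l) := by
    intro k
    simp
  refine (e _ _).trans ((Finset.sum_congr rfl fun k _ => congrArg _ (e2 k)).trans ?_)
  simp only [System.ctrlGrad, System.shareGrad, sum_inner, inner_smul_left, Finset.mul_sum,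
    Finset.sum_mul, conj_trivial]
  rw [Finset.sum_comm, ← Finset.sum_add_distrib]
  refine Finset.sum_congr rfl fun l _ => ?_
  rw [← Finset.sum_add_distrib]
  exact Finset.sum_congr rfl fun k _ => by ring

/-! ### Lagrange multipliers -/

/-- The number `max (0, max g)` serves as the multiplier of the power budget. The last alternative
says which test allocation attains it: no power at all, or everything on one user. -/
lemma exists_dominating {ι : Type*} [Finite ι] (g : ι → ℝ) :
    ∃ a, 0 ≤ a ∧ (∀ i, g i ≤ a) ∧ (a = 0 ∨ ∃ i, a = g i) := by
  by_cases h : ∃ i, 0 < g i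
  · obtain ⟨i, hi⟩ := h
    have : Nonempty ι := ⟨i⟩
    obtain ⟨j, hj⟩ := Finite.exists_max g
    exact ⟨g j, hi.le.trans (hj i), hj, Or.inr ⟨j, rfl⟩⟩
  · push Not at h
    exact ⟨0, le_rfl, h, Or.inl rfl⟩

lemma mul_eq_zero_of_sum_nonpos {ι : Type*} [Fintype ι] {a b : ι → ℝ} (ha : ∀ i, 0 ≤ a i)
    (hb : ∀ i, 0 ≤ b i) (h : ∑ i, a i * b i ≤ 0) (i : ι) : a i * b i = 0 :=
  (Finset.sum_eq_zero_iff_of_nonneg fun i _ => mul_nonneg (ha i) (hb i)).1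
    (h.antisymm (Finset.sum_nonneg fun i _ => mul_nonneg (ha i) (hb i))) i (Finset.mem_univ i)

/-- Multipliers for the variational inequality over the control set. -/
lemma exists_ctrl_multipliers (hP : 0 < sys.Pmax) {g x : Ctrl K M S} (hx : x ∈ sys.ctrlSet)
    (h : ∀ y ∈ sys.ctrlSet, inner ℝ g (y - x) ≤ 0) :
    ∃ (low up : Fin M → Fin S → ℝ) (pl : Fin K → ℝ) (ps : ℝ),
      (∀ m s, 0 ≤ low m s) ∧ (∀ m s, 0 ≤ up m s) ∧ (∀ k, 0 ≤ pl k) ∧ 0 ≤ ps ∧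
      (∀ m s, low m s * phase x m s = 0) ∧ (∀ m s, up m s * (phase x m s - 2 * Real.pi) = 0) ∧
      (∀ k, pl k * pow x k = 0) ∧ ps * (∑ k, pow x k - sys.Pmax) = 0 ∧
      ∀ v : Ctrl K M S, inner ℝ g v =
        ∑ m, ∑ s, (up m s - low m s) * phase v m s + ∑ k, (ps - pl k) * pow v k := by
  have hinner : ∀ v : Ctrl K M S, inner ℝ g v =
      ∑ m, ∑ s, phase g m s * phase v m s + ∑ k, pow g k * pow v k := by
    intro v
    simp only [PiLp.inner_apply, RCLike.inner_apply, conj_trivial, Fintype.sum_sum_type,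
      Fintype.sum_prod_type, phase, pow, mul_comm]
  have hpi : (0 : ℝ) ≤ 2 * Real.pi := by positivity
  -- The phase constraints form a box, so a single phase can be varied alone.
  have hθ : ∀ m s, ∀ a ∈ Set.Icc 0 (2 * Real.pi), phase g m s * (a - phase x m s) ≤ 0 := by
    intro m s a ha
    set y : Ctrl K M S := x + EuclideanSpace.single (Sum.inl (m, s)) (a - phase x m s) with hy
    have hyp : ∀ k, pow y k = pow x k := fun k => by simp [hy, pow]
    have hyθ : ∀ m' s', phase y m' s' ∈ Set.Icc 0 (2 * Real.pi) := by
      intro m' s'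
      by_cases he : (m', s') = (m, s)
      · obtain ⟨rfl, rfl⟩ := Prod.mk.inj he
        simpa [hy, phase] using ha
      · have : phase y m' s' = phase x m' s' := by
          simp only [hy, phase, PiLp.add_apply, PiLp.single_apply, Sum.inl.injEq, he,
            if_false, add_zero]
        rw [this]
        exact hx.1 m' s'
    have := h y ⟨hyθ, fun k => by rw [hyp]; exact hx.2.1 k, by simpa only [hyp] using hx.2.2⟩
    rw [hy, add_sub_cancel_left, EuclideanSpace.inner_single_right] at this
    simpa [phase, mul_comm] using this
  -- The powers are coupled by the budget and have to be varied together.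
  have hp : ∀ p : Fin K → ℝ, (∀ k, 0 ≤ p k) → ∑ k, p k ≤ sys.Pmax →
      ∑ k, pow g k * p k ≤ ∑ k, pow g k * pow x k := by
    intro p hp0 hps
    set y : Ctrl K M S := WithLp.toLp 2 (Sum.elim (fun j => x (Sum.inl j)) p) with hy
    have := h y ⟨hx.1, hp0, hps⟩
    rw [hinner] at this
    have e1 : ∀ m s, phase (y - x) m s = 0 := fun m s => by simp [hy, phase]
    have e2 : ∀ k, pow (y - x) k = p k - pow x k := fun k => by simp [hy, pow]
    simp only [e1, e2, mul_zero, Finset.sum_const_zero, zero_add, mul_sub,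
      Finset.sum_sub_distrib] at this
    linarith
  obtain ⟨ps, hps0, hps, hcase⟩ := exists_dominating fun k => pow g k
  have hval : ps * sys.Pmax ≤ ∑ k, pow g k * pow x k := by
    rcases hcase with rfl | ⟨j, rfl⟩
    · simpa using hp (fun _ => 0) (fun _ => le_rfl) (by simpa using hP.le)
    · have := hp (Pi.single j sys.Pmax) (fun k => ?_) (by simp)
      · simpa [Pi.single_apply] using this
      · by_cases hk : k = j
        · subst hk; simpa using hP.le
        · simp [hk]
  have hsum : ∑ k, (ps - pow g k) * pow x k = ps * ∑ k, pow x k - ∑ k, pow g k * pow x k := by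
    simp only [sub_mul, Finset.sum_sub_distrib, Finset.mul_sum]
  have hle := mul_le_mul_of_nonneg_left hx.2.2 hps0
  have hnn : 0 ≤ ∑ k, (ps - pow g k) * pow x k :=
    Finset.sum_nonneg fun k _ => mul_nonneg (sub_nonneg.2 (hps k)) (hx.2.1 k)
  -- Negative and positive parts of the phase gradient go to the lower and upper phase bounds. For
  -- the powers, the multipliers `ps - g_k` are nonnegative and `∑ (ps - g_k) p_k ≤ 0` by the value
  -- of the test allocation, so every term vanishes.
  refine ⟨fun m s => max (-phase g m s) 0, fun m s => max (phase g m s) 0,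
    fun k => ps - pow g k, ps, fun m s => le_max_right _ _, fun m s => le_max_right _ _,
    fun k => sub_nonneg.2 (hps k), hps0, fun m s => ?_, fun m s => ?_,
    mul_eq_zero_of_sum_nonpos (fun k => sub_nonneg.2 (hps k)) hx.2.1 (by linarith),
    by rw [mul_sub]; linarith, fun v => ?_⟩
  · rcases le_or_gt 0 (phase g m s) with hg | hg
    · simp [hg]
    · have h1 := hθ m s 0 ⟨le_rfl, hpi⟩
      have h2 := (hx.1 m s).1
      have : phase x m s = 0 := by nlinarith
      simp [this]
  · rcases le_or_gt (phase g m s) 0 with hg | hg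
    · simp [hg]
    · have h1 := hθ m s _ ⟨hpi, le_rfl⟩
      have h2 := (hx.1 m s).2
      have : phase x m s - 2 * Real.pi = 0 := by nlinarith
      simp [this]
  · rw [hinner]
    have e : ∀ m s, max (phase g m s) 0 - max (-phase g m s) 0 = phase g m s := fun m s =>
      max_zero_sub_max_neg_zero_eq_self _
    simp only [e, sub_sub_cancel]

/-- Multipliers for the variational inequality over the simplex. -/
lemma exists_share_multipliers {c : Fin L → ℝ} {q : EuclideanSpace ℝ (Fin L)} (hq : q ∈ shareSet L)
    (h : ∀ p ∈ shareSet L, ∑ l, c l * (p l - q l) ≤ 0) :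
    ∃ (a : ℝ) (b : Fin L → ℝ), (∀ l, 0 ≤ b l) ∧ (∀ l, b l * q l = 0) ∧ ∀ l, c l = 0 - b l + a := by
  have hne : Nonempty (Fin L) := by
    by_contra hcon
    rw [not_nonempty_iff] at hcon
    simpa using hq.2
  -- The largest coefficient is the multiplier of `∑ q = 1`; testing with the vertex of its index
  -- shows that `q` puts mass only on maximal coefficients.
  obtain ⟨j, hj⟩ := Finite.exists_max c
  have hmem : EuclideanSpace.single j (1 : ℝ) ∈ shareSet L := by
    refine ⟨fun l => ?_, by simp⟩
    rw [PiLp.single_apply]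
    split_ifs <;> simp
  have h1 := h _ hmem
  simp only [mul_sub, Finset.sum_sub_distrib, PiLp.single_apply, mul_ite, mul_one, mul_zero,
    Finset.sum_ite_eq', Finset.mem_univ, if_true] at h1
  refine ⟨c j, fun l => c j - c l, fun l => sub_nonneg.2 (hj l),
    mul_eq_zero_of_sum_nonpos (fun l => sub_nonneg.2 (hj l)) (fun l => (hq.1 l).1) ?_,
    fun l => by ring⟩
  simp only [sub_mul, Finset.sum_sub_distrib, ← Finset.mul_sum]
  rw [hq.2]
  linarith

lemma isKKT_of_variational (hP : 0 < sys.Pmax) (hreg : sys.RegularRates) (hU : IsUtility U)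
    {x : (Fin L → Ctrl K M S) × EuclideanSpace ℝ (Fin L)} (hx : sys.Feasible x.1 x.2)
    (hΓ : ∀ l, ∀ y ∈ sys.ctrlSet, inner ℝ (sys.ctrlGrad U x.1 x.2 l) (y - x.1 l) ≤ 0)
    (hq : ∀ p ∈ shareSet L, ∑ l, sys.shareGrad U x.1 x.2 l * (p l - x.2 l) ≤ 0) :
    IsKKT sys U x := by
  choose low up pl ps h1 h2 h3 h4 h5 h6 h7 h8 h9 using
    fun l => exists_ctrl_multipliers hP (hx.1 l) (hΓ l)
  obtain ⟨a, b, hb, hbq, hab⟩ := exists_share_multipliers hx.2 hq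
  refine ⟨hx.1, hx.2, sys.objectiveDeriv U x,
    System.hasFDerivWithinAt_objective hreg hU ⟨hx.1, fun l => (hx.2.1 l).1⟩,
    -- The constraints `q ≤ 1` follow from `q ≥ 0` and `∑ q = 1`, so their multipliers can be zero.
    ⟨low, up, pl, ps, b, 0, a⟩, h1, h2, h3, h4, hb, fun _ => le_rfl, h5, h6, h7, h8, hbq,
    fun l => by simp, fun v => ?_⟩
  rw [System.objectiveDeriv_apply]
  simp only [h9, hab, Pi.zero_apply]

end

end RCSHP

theorem theorem1 {K M S Tp L TH : ℕ} (hTH : 0 < TH)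
    -- the system and the utility function
    (sys : RCSHP.System K M S Tp) (hP : 0 < sys.Pmax)
    (hcov : sys.HasCovariances) (hreg : sys.RegularRates)
    (U : EuclideanSpace ℝ (Fin K) → ℝ) (hU : RCSHP.IsUtility U)
    -- the parameters of the algorithm
    (ρ γ : ℕ → ℝ) (hstep : RCSHP.StepSizes ρ γ)
    (τq τΓ : ℝ) (hτq : 0 < τq) (hτΓ : 0 < τΓ)
    (Γ₀ : Fin L → RCSHP.Ctrl K M S) (hΓ₀ : ∀ l, Γ₀ l ∈ sys.ctrlSet)
    (q₀ : EuclideanSpace ℝ (Fin L)) (hq₀ : q₀ ∈ RCSHP.shareSet L)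
    -- independent samples of the channels and of the estimation noise
    {Ω : Type*} [MeasurableSpace Ω] (Pr : Measure Ω) [IsProbabilityMeasure Pr]
    (ξ : ℕ → Fin TH → Ω → RCSHP.State K M Tp)
    (hξ_meas : ∀ t i, Measurable (ξ t i))
    (hξ_indep : iIndepFun (fun ti : ℕ × Fin TH => ξ ti.1 ti.2) Pr)
    (hξ_law : ∀ t i, Pr.map (ξ t i) = sys.stateLaw)
    -- the run of the algorithm on these samples
    (X : Ω → RCSHP.Run K M S L)
    (hX : ∀ ω, RCSHP.IsRun sys U ρ γ τq τΓ Γ₀ q₀ (fun t i => ξ t i ω) (X ω)) :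
    ∀ᵐ ω ∂Pr, ∀ x : (Fin L → RCSHP.Ctrl K M S) × EuclideanSpace ℝ (Fin L),
      ∀ φ : ℕ → ℕ, StrictMono φ →
        Tendsto (fun j => ((X ω).Γ (φ j), (X ω).q (φ j))) atTop (𝓝 x) →
        RCSHP.IsKKT sys U x := by
  have h : RCSHP.SampledRun sys U ρ γ τq τΓ Γ₀ q₀ Pr ξ X :=
    ⟨hP, hcov.isProbabilityMeasure, hreg, hU, hstep.rho_mem, hstep.gamma_mem, hτq, hτΓ, hTH, hΓ₀, hq₀,
      hξ_meas, hξ_indep, hξ_law, hX⟩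
  obtain ⟨c, hc⟩ := RCSHP.System.exists_bounds hreg hU L
  -- The exceptional null set is fixed by the convergence of a single series, so it serves all
  -- subsequences and limit points at once.
  filter_upwards [h.ae_summable hstep] with ω hω x φ hφ hx
  obtain ⟨h1, h2⟩ := h.surrogate_optimal hstep hω hφ hx
  have hf := h.feasible_of_tendsto hx
  exact RCSHP.isKKT_of_variational hP hreg hU hf
    (fun l y hy => RCSHP.inner_nonpos_of_prox sys.convex_ctrlSet (hf.1 l) (h1 l) hy)
    fun p hp => hc.shareGrad_nonpos hf h2 hp
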